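/- Let $a<b$, let $\gamma\in C^\infty([a,b];\mathbb{R}^3)$ be parameterized by arc-length ($|\gamma'|\equiv 1$), with unit tangent field $T=\gamma'$, and let $\varrho\in C^\infty([a,b];\mathbb{R}_{>0})$ be a bending stiffness. For a regular curve $\eta$ on $[a,b]$, with $\frac{d}{ds}=\frac{1}{|\eta'|}\frac{d}{dx}$, $ds=|\eta'|\,dx$ and unit tangent $T_\eta=\frac{d\eta}{ds}$, the bending energy is $$\mathcal{B}_\varrho(\eta)=\tfrac12\int_a^b\varrho\,\big\langle \tfrac{dT_\eta}{ds},\tfrac{dT_\eta}{ds}\big\rangle\,ds .$$ A parallel normal field along $\eta$ is a smooth $Z:[a,b]\to\mathbb{R}^3$ with $\langle Z,T_\eta\rangle=0$ and $Z'=\lambda T_\eta$ for some smooth function $\lambda$. For unit vectors $W_a\perp T_\eta(a)$ and $W_b\perp T_\eta(b)$, the holonomy of $\eta$ with respect to $(W_a,W_b)$ is the angle $\theta\in\mathbb{R}/2\pi\mathbb{Z}$ such that the parallel normal field $Z$ with $Z(a)=W_a$ satisfies $Z(b)=\cos\theta\, W_b+\sin\theta\,T_\eta(b)\times W_b$. The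 curve $\gamma$ is called holonomy constrained elastic (with bending stiffness $\varrho$) if $\frac{d}{dt}\big|_{t=0}\mathcal{B}_\varrho(\gamma_t)=0$ for every smooth variation $(t,x)\mapsto\gamma_t(x)$ on $[-\epsilon,\epsilon]\times[a,b]$, $\epsilon>0$, $\gamma_0=\gamma$, with compact support in the interior (there is $\delta>0$ such that $\gamma_t=\gamma$ on $[a,a+\delta]\cup[b-\delta,b]$ for all $t$), which preserves the arc-length ($|\gamma_t'|=|\gamma'|$ for all $t$) and the holonomy (the holonomy of $\gamma_t$ with respect to every such pair $(W_a,W_b)$ does not depend on $t$). Put $$\mathcal{G}^{\mathcal B}=\varrho T'''+3\varrho\langle T'',T'\rangle T+\tfrac32\varrho\langle T',T'\rangle T'+\varrho''T'+\varrho'\big(2T''+\tfrac32\langle T',T'\rangle T\big).$$ Then the following are equivalent. 1. $\gamma$ is holonomy constrained elastic. 2. There are $\Lambda\in C^\infty([a,b];\mathbb{R})$ and a constant $\mu\in\mathbb{R}$ such that on $[a,b]$ $$\mathcal{G}^{\mathcal B}-2\Lambda'T-2\Lambda T'-\mu\,T\times T''=0.$$ 3. There are $\Lambda\in C^\infty([a,b];\mathbb{R})$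 and a constant $\mu\in\mathbb{R}$ such that on $[a,b]$ $$\varrho T'''-\varrho\langle T''',T\rangle T+\tfrac32\varrho\langle T',T'\rangle T'+\varrho''T'+\varrho'\big(2T''+\tfrac32\langle T',T'\rangle T\big)-\Lambda'T-\Lambda T'-\mu\,T\times T''=0.$$ 4. There are $\Lambda\in C^\infty([a,b];\mathbb{R})$ and a constant $\mu\in\mathbb{R}$ such that on $[a,b]$ $$\varrho\gamma''''-\varrho\langle\gamma'''',\gamma'\rangle\gamma'+\tfrac32\varrho\langle\gamma'',\gamma''\rangle\gamma''+\varrho''\gamma''+\varrho'\big(2\gamma'''+\tfrac32\langle\gamma'',\gamma''\rangle\gamma'\big)-\Lambda'\gamma'-\Lambda\gamma''-\mu\,\gamma'\times\gamma'''=0.$$ Moreover, for every $\Lambda\in C^\infty([a,b];\mathbb{R})$ and $\mu\in\mathbb{R}$, the left-hand side in 2 for $(\Lambda,\mu)$ equals the left-hand side in 3 for $(2\Lambda,\mu)$, and the left-hand sides in 3 and 4 for the same $(\Lambda,\mu)$ are equal. -/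

import Mathlib

open Set
open scoped ContDiff

noncomputable section

/-- Euclidean three-space. -/
abbrev E3 : Type := EuclideanSpace ℝ (Fin 3)

/-- The cross product on Euclidean three-space. -/
def cross (u v : E3) : E3 := WithLp.toLp 2 (crossProduct u.ofLp v.ofLp)

/-- `g ∈ C^∞([a,b]; F)` (only the values of `g` on `[a,b]` matter). -/
def SmoothOnIcc {F : Type*} [NormedAddCommGroup F] [NormedSpace ℝ F] (a b : ℝ) (g : ℝ → F) :
    Prop :=
  ContDiffOn ℝ ∞ g (Icc a b)

/-- The `k`-th derivative of a function on `[a,b]` (one-sided at the end points). -/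
def D {F : Type*} [NormedAddCommGroup F] [NormedSpace ℝ F] (a b : ℝ) (k : ℕ) (g : ℝ → F) :
    ℝ → F :=
  iteratedDerivWithin k g (Icc a b)

/-- A curve: a smooth map `γ : [a,b] → ℝ³` with nowhere vanishing derivative. -/
def IsCurve (a b : ℝ) (γ : ℝ → E3) : Prop :=
  SmoothOnIcc a b γ ∧ ∀ x ∈ Icc a b, D a b 1 γ x ≠ 0

/-- A curve parameterized by arc-length. -/
def IsArcLengthCurve (a b : ℝ) (γ : ℝ → E3) : Prop :=
  IsCurve a b γ ∧ ∀ x ∈ Icc a b, ‖D a b 1 γ x‖ = 1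

/-- The derivative `dg/ds = g' / |γ'|` of `g` with respect to the arc-length of `γ`. -/
def arcDeriv {F : Type*} [NormedAddCommGroup F] [NormedSpace ℝ F] (a b : ℝ) (γ : ℝ → E3)
    (g : ℝ → F) : ℝ → F :=
  fun x => ‖D a b 1 γ x‖⁻¹ • D a b 1 g x

/-- The unit tangent field `T = dγ/ds`. -/
def unitTangent (a b : ℝ) (γ : ℝ → E3) : ℝ → E3 := arcDeriv a b γ γ

/-- The bending energy `½ ∫ ϱ ⟨dT/ds, dT/ds⟩ ds` with bending stiffness `ϱ`, where
`ds = |γ'| dx`. -/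
def bendingEnergy (a b : ℝ) (ρ : ℝ → ℝ) (γ : ℝ → E3) : ℝ :=
  (1 / 2) * ∫ x in a..b,
    ρ x * inner ℝ (arcDeriv a b γ (unitTangent a b γ) x) (arcDeriv a b γ (unitTangent a b γ) x)
      * ‖D a b 1 γ x‖

/-- `Z` is a parallel normal field along `γ`: `⟨Z, T⟩ = 0` and `Z' = lam T` with `lam` smooth. -/
def IsParallelNormalField (a b : ℝ) (γ Z : ℝ → E3) : Prop :=
  SmoothOnIcc a b Z ∧ (∀ x ∈ Icc a b, inner ℝ (Z x) (unitTangent a b γ x) = 0) ∧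
    ∃ lam : ℝ → ℝ, SmoothOnIcc a b lam ∧
      ∀ x ∈ Icc a b, D a b 1 Z x = lam x • unitTangent a b γ x

/-- `W = (Wa, Wb)` is a pair of unit vectors, normal to `γ` at `a` and at `b` respectively. -/
def IsUnitNormalPair (a b : ℝ) (γ : ℝ → E3) (Wa Wb : E3) : Prop :=
  ‖Wa‖ = 1 ∧ ‖Wb‖ = 1 ∧ inner ℝ Wa (unitTangent a b γ a) = 0 ∧
    inner ℝ Wb (unitTangent a b γ b) = 0

/-- The holonomy of `γ` with respect to `(Wa, Wb)` is the angle `θ ∈ ℝ/2πℤ`: the parallel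
transport of `Wa` along `γ` ends at `cos θ Wb + sin θ (T(b) × Wb)`. -/
def HasHolonomy (a b : ℝ) (γ : ℝ → E3) (Wa Wb : E3) (θ : Real.Angle) : Prop :=
  ∃ Z : ℝ → E3, IsParallelNormalField a b γ Z ∧ Z a = Wa ∧
    Z b = θ.cos • Wb + θ.sin • cross (unitTangent a b γ b) Wb

/-- `t ↦ Γ t`, `t ∈ [-ε, ε]`, is a smooth variation of `γ`. -/
structure IsSmoothVariation (a b : ℝ) (γ : ℝ → E3) (ε : ℝ) (Γ : ℝ → ℝ → E3) : Prop where
  pos : 0 < ε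
  smooth : ContDiffOn ℝ ∞ (fun p : ℝ × ℝ => Γ p.1 p.2) (Icc (-ε) ε ×ˢ Icc a b)
  initial : ∀ x ∈ Icc a b, Γ 0 x = γ x

/-- The variation has compact support in the interior of `[a,b]`. -/
def HasCompactInteriorSupport (a b : ℝ) (γ : ℝ → E3) (ε : ℝ) (Γ : ℝ → ℝ → E3) : Prop :=
  ∃ δ > 0, ∀ t ∈ Icc (-ε) ε, ∀ x ∈ Icc a b, (x ≤ a + δ ∨ b - δ ≤ x) → Γ t x = γ x

/-- The variation keeps the arc-length `|γ'|` fixed pointwise. -/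
def PreservesArcLength (a b : ℝ) (γ : ℝ → E3) (ε : ℝ) (Γ : ℝ → ℝ → E3) : Prop :=
  ∀ t ∈ Icc (-ε) ε, ∀ x ∈ Icc a b, ‖D a b 1 (Γ t) x‖ = ‖D a b 1 γ x‖

/-- The variation keeps the holonomy fixed (with respect to every pair of unit normals at the
end points; for a variation supported in the interior the unit tangents at the end points
do not depend on `t`, and fixing the holonomy for one pair fixes it for all). -/
def PreservesHolonomy (a b : ℝ) (γ : ℝ → E3) (ε : ℝ) (Γ : ℝ → ℝ → E3) : Prop :=
  ∀ Wa Wb : E3, IsUnitNormalPair a b γ Wa Wb →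
    ∃ θ : Real.Angle, ∀ t ∈ Icc (-ε) ε, HasHolonomy a b (Γ t) Wa Wb θ

/-- `γ` is a holonomy constrained elastic curve with bending stiffness `ρ`: a critical point of
the bending energy under all smooth variations with compact support in the interior that
preserve arc-length and holonomy. -/
def IsHolonomyConstrainedElastic (a b : ℝ) (ρ : ℝ → ℝ) (γ : ℝ → E3) : Prop :=
  ∀ (ε : ℝ) (Γ : ℝ → ℝ → E3), IsSmoothVariation a b γ ε Γ →
    HasCompactInteriorSupport a b γ ε Γ → PreservesArcLength a b γ ε Γ →
    PreservesHolonomy a b γ ε Γ →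
    HasDerivAt (fun t => bendingEnergy a b ρ (Γ t)) 0 0

/-- The variational gradient `𝒢^ℬ` of the bending energy with bending stiffness `ρ`. -/
def gradB (a b : ℝ) (ρ : ℝ → ℝ) (γ : ℝ → E3) (x : ℝ) : E3 :=
  let T := unitTangent a b γ
  let T1 := arcDeriv a b γ T
  let T2 := arcDeriv a b γ T1
  let T3 := arcDeriv a b γ T2
  let ρ1 := arcDeriv a b γ ρ
  let ρ2 := arcDeriv a b γ ρ1
  ρ x • T3 x + (3 * ρ x * inner ℝ (T2 x) (T1 x)) • T x
    + (3 / 2 * ρ x * inner ℝ (T1 x) (T1 x)) • T1 x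
    + ρ2 x • T1 x + ρ1 x • ((2 : ℝ) • T2 x + (3 / 2 * inner ℝ (T1 x) (T1 x)) • T x)

/-- `𝒢^ℬ_{Λ,μ} = 𝒢^ℬ - 2 Λ' T - 2 Λ T' - μ T × T''`. -/
def gradBConstrained (a b : ℝ) (ρ : ℝ → ℝ) (γ : ℝ → E3) (Λ : ℝ → ℝ) (μ : ℝ) (x : ℝ) : E3 :=
  let T := unitTangent a b γ
  gradB a b ρ γ x - (2 * D a b 1 Λ x) • T x - (2 * Λ x) • D a b 1 T x
    - μ • cross (T x) (D a b 2 T x)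

/-- The left-hand side of the Euler-Lagrange equation written in the unit tangent field. -/
def tangentODE (a b : ℝ) (ρ : ℝ → ℝ) (γ : ℝ → E3) (Λ : ℝ → ℝ) (μ : ℝ) (x : ℝ) : E3 :=
  let T := unitTangent a b γ
  ρ x • D a b 3 T x - (ρ x * inner ℝ (D a b 3 T x) (T x)) • T x
    + (3 / 2 * ρ x * inner ℝ (D a b 1 T x) (D a b 1 T x)) • D a b 1 T x
    + D a b 2 ρ x • D a b 1 T x
    + D a b 1 ρ x • ((2 : ℝ) • D a b 2 T x
        + (3 / 2 * inner ℝ (D a b 1 T x) (D a b 1 T x)) • T x)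
    - D a b 1 Λ x • T x - Λ x • D a b 1 T x - μ • cross (T x) (D a b 2 T x)

/-- The left-hand side of the fourth-order Euler-Lagrange equation written in `γ`. -/
def curveODE (a b : ℝ) (ρ : ℝ → ℝ) (γ : ℝ → E3) (Λ : ℝ → ℝ) (μ : ℝ) (x : ℝ) : E3 :=
  ρ x • D a b 4 γ x - (ρ x * inner ℝ (D a b 4 γ x) (D a b 1 γ x)) • D a b 1 γ x
    + (3 / 2 * ρ x * inner ℝ (D a b 2 γ x) (D a b 2 γ x)) • D a b 2 γ x
    + D a b 2 ρ x • D a b 2 γ x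
    + D a b 1 ρ x • ((2 : ℝ) • D a b 3 γ x
        + (3 / 2 * inner ℝ (D a b 2 γ x) (D a b 2 γ x)) • D a b 1 γ x)
    - D a b 1 Λ x • D a b 1 γ x - Λ x • D a b 2 γ x
    - μ • cross (D a b 1 γ x) (D a b 3 γ x)

end

/-! Everything is expressed through the unit tangent T = γ'. An interior, arc-length preserving
variation amounts to a family of unit fields τ_t which agree with T near the ends and have the same
integral as T; the curves are recovered by integration. The energy becomes ½∫ρ|τ'|², and its first
variation is -∫⟨(ρT')', u⟩ with u = ∂τ/∂t orthogonal to T.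

For the holonomy, take a vector v nowhere parallel to T (`exists_frame_vector`). Projecting v to the
normal planes frames all nearby tangent fields, and the holonomy is a constant minus the integral H
of the connection form of this frame (`exists_hasHolonomy`, `parallel_end`). H is the integral along
the tangent of a 1-form on the sphere whose exterior derivative is minus the area form, so its first
variation is ∫⟨T × T', u⟩ (`hasDerivAt_connection`). The constraints thus have the gradients T × T'
and the normal parts of constant vectors, and the Lagrange condition reads: the normal part of
(ρT')' equals μ T × T' plus the normal part of a constant V. That this suffices follows by pairing
with u.

For necessity there are two cases. If the constraint gradients are linearly independent, the
implicit function theorem turns every infinitesimally admissible field into a genuine admissible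
family, and multipliers exist by linear algebra and the fundamental lemma
(`exists_multipliers_of_dual`). If they are dependent, either T is constant, where nothing is to be
shown, or T' = T × U for a constant U and T runs on a circle. There the constraint map is no
submersion, so explicit families are used: in height ζ and longitude ψ over the circle the
connection integrand is (z₀ + ζ)(ψ' + κ). If ζ and ψ' have disjoint supports and ζ has mean zero,
its integral does not change at all, and only two lateral closing conditions remain, which are
submersive. These variations already force the Lagrange condition, with μ = 0
(`IsCircleFrame.exists_perp_eq`).

Finally, (ρT')' + (3/2 ρ|T'|² - 2Λ)T - μ T × T' has the left-hand side of 2 as its derivative. Hence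
2 says that this vector is a constant V, which is the Lagrange condition with Λ absorbing the
tangential component. Equation 3 follows from ⟨T''', T⟩ = -3⟨T'', T'⟩, and 4 is 3 with T = γ'. -/

open MeasureTheory Filter Topology

/-! ### Smooth dependence of integrals on parameters. -/

section ParametricIntegral

variable {P F : Type} [NormedAddCommGroup P] [NormedSpace ℝ P] [NormedAddCommGroup F]
  [NormedSpace ℝ F]

/-- Differentiation under the integral by dominated convergence; the dominating function can be a
constant because the interval is compact. -/
theorem hasFDerivAt_intervalIntegral_of_contDiffOn {V : Set P} (hV : IsOpen V) (a b : ℝ)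
    {f : P × ℝ → F} (hf : ContDiffOn ℝ 1 f (V ×ˢ univ)) {p₀ : P} (hp : p₀ ∈ V) :
    HasFDerivAt (fun p => ∫ x in a..b, f (p, x))
      (∫ x in a..b, (fderiv ℝ f (p₀, x)).comp (ContinuousLinearMap.inl ℝ P ℝ)) p₀ := by
  have hO : IsOpen (V ×ˢ (univ : Set ℝ)) := hV.prod isOpen_univ
  set F' : P → ℝ → P →L[ℝ] F :=
    fun p x => (fderiv ℝ f (p, x)).comp (ContinuousLinearMap.inl ℝ P ℝ) with hF'
  have hc : ContinuousOn (fun q : P × ℝ => F' q.1 q.2) (V ×ˢ univ) := by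
    have := hf.continuousOn_fderiv_of_isOpen hO le_rfl
    exact (ContinuousLinearMap.compL ℝ P (P × ℝ) F).flip
      (ContinuousLinearMap.inl ℝ P ℝ) |>.continuous.comp_continuousOn this
  have hslice : ∀ p ∈ V, Continuous (fun x => f (p, x)) := fun p hp =>
    continuousOn_univ.1 (hf.continuousOn.comp (Continuous.continuousOn (by fun_prop))
      fun x _ => ⟨hp, mem_univ _⟩)
  have hslice' : Continuous (fun x => F' p₀ x) :=
    continuousOn_univ.1 (hc.comp (f := fun x : ℝ => (p₀, x))
      (Continuous.continuousOn (by fun_prop)) fun x _ => ⟨hp, mem_univ _⟩)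
  obtain ⟨C, hC⟩ := (isCompact_uIcc (a := a) (b := b)).exists_bound_of_continuousOn
    hslice'.continuousOn
  -- Compactness makes the bound uniform in x for all p near p₀; the slack between C and C + 1
  -- leaves room for continuity.
  have hs : ∀ᶠ p in 𝓝 p₀, ∀ x ∈ uIcc a b, p ∈ V ∧ ‖F' p x‖ < C + 1 := by
    refine isCompact_uIcc.eventually_forall_of_forall_eventually fun x hx => ?_
    have hm : V ×ˢ (univ : Set ℝ) ∈ 𝓝 (p₀, x) := hO.mem_nhds ⟨hp, mem_univ _⟩
    have h1 := (hc.continuousAt hm).norm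
    have h2 : ∀ᶠ q : P × ℝ in 𝓝 (p₀, x), ‖F' q.1 q.2‖ < C + 1 :=
      h1.eventually_lt continuousAt_const (by have := hC x hx; simp only; linarith)
    filter_upwards [h2, hm] with q hq hq' using ⟨hq'.1, hq⟩
  refine intervalIntegral.hasFDerivAt_integral_of_dominated_of_fderiv_le
    (F := fun p x => f (p, x)) (F' := F') (bound := fun _ => C + 1) hs ?_ ?_ ?_ ?_ ?_ ?_
  · filter_upwards [hV.mem_nhds hp] with p hp'
    exact (hslice p hp').aestronglyMeasurable
  · exact (hslice p₀ hp).intervalIntegrable _ _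
  · exact hslice'.aestronglyMeasurable
  · exact ae_of_all _ fun x hx p hp' => (hp' x (uIoc_subset_uIcc hx)).2.le
  · exact intervalIntegrable_const
  · refine ae_of_all _ fun x hx p hp' => ?_
    have hpV := (hp' x (uIoc_subset_uIcc hx)).1
    have h1 : HasFDerivAt f (fderiv ℝ f (p, x)) (p, x) :=
      ((hf.contDiffAt (hO.mem_nhds ⟨hpV, mem_univ _⟩)).differentiableAt
        one_ne_zero).hasFDerivAt
    exact h1.comp p (hasFDerivAt_prodMk_left p x)

/-- The derivative is again a parametric integral, but with values in `P →L[ℝ] F`; hence the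
induction quantifies over the target space. -/
theorem contDiffOn_intervalIntegral_nat (n : ℕ) : ∀ {F : Type} [NormedAddCommGroup F]
    [NormedSpace ℝ F] {V : Set P} (_ : IsOpen V) (a b : ℝ)
    {f : P × ℝ → F} (_ : ContDiffOn ℝ n f (V ×ˢ univ)),
    ContDiffOn ℝ n (fun p => ∫ x in a..b, f (p, x)) V := by
  induction n with
  | zero =>
    intro F _ _ V hV a b f hf
    rw [Nat.cast_zero, contDiffOn_zero] at hf ⊢
    intro p hp
    refine ContinuousAt.continuousWithinAt ?_
    have hO : IsOpen (V ×ˢ (univ : Set ℝ)) := hV.prod isOpen_univ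
    have hslice : ∀ p ∈ V, Continuous (fun x => f (p, x)) := fun p hp =>
      continuousOn_univ.1 (hf.comp (Continuous.continuousOn (by fun_prop))
        fun x _ => ⟨hp, mem_univ _⟩)
    obtain ⟨C, hC⟩ := (isCompact_uIcc (a := a) (b := b)).exists_bound_of_continuousOn
      (hslice p hp).continuousOn
    have hs : ∀ᶠ q in 𝓝 p, ∀ x ∈ uIcc a b, q ∈ V ∧ ‖f (q, x)‖ < C + 1 := by
      refine isCompact_uIcc.eventually_forall_of_forall_eventually fun x hx => ?_
      have hm : V ×ˢ (univ : Set ℝ) ∈ 𝓝 (p, x) := hO.mem_nhds ⟨hp, mem_univ _⟩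
      have h2 : ∀ᶠ q : P × ℝ in 𝓝 (p, x), ‖f q‖ < C + 1 :=
        (hf.continuousAt hm).norm.eventually_lt continuousAt_const
          (by have := hC x hx; linarith)
      filter_upwards [h2, hm] with q hq hq' using ⟨hq'.1, hq⟩
    refine intervalIntegral.continuousAt_of_dominated_interval (bound := fun _ => C + 1)
      ?_ ?_ intervalIntegrable_const ?_
    · filter_upwards [hV.mem_nhds hp] with q hq
      exact (hslice q hq).aestronglyMeasurable
    · filter_upwards [hs] with q hq
      exact ae_of_all _ fun x hx => (hq x (uIoc_subset_uIcc hx)).2.le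
    · refine ae_of_all _ fun x hx => ?_
      exact (hf.continuousAt (hO.mem_nhds ⟨hp, mem_univ _⟩)).comp (f := fun q : P => (q, x))
        (by fun_prop)
  | succ n ih =>
    intro F _ _ V hV a b f hf
    have hO : IsOpen (V ×ˢ (univ : Set ℝ)) := hV.prod isOpen_univ
    have h1 : ContDiffOn ℝ 1 f (V ×ˢ univ) :=
      hf.of_le (by exact_mod_cast Nat.le_add_left 1 n)
    rw [Nat.cast_succ] at hf ⊢
    refine (contDiffOn_succ_iff_fderiv_of_isOpen hV).2 ⟨fun p hp =>
      (hasFDerivAt_intervalIntegral_of_contDiffOn hV a b h1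
        hp).differentiableAt.differentiableWithinAt, by simp, ?_⟩
    refine ContDiffOn.congr (ih hV a b (f := fun q =>
      (fderiv ℝ f q).comp (ContinuousLinearMap.inl ℝ P ℝ)) ?_) fun p hp =>
      (hasFDerivAt_intervalIntegral_of_contDiffOn hV a b h1 hp).fderiv
    exact ((contDiffOn_succ_iff_fderiv_of_isOpen hO).1 hf).2.2.clm_comp contDiffOn_const

theorem contDiffOn_intervalIntegral {V : Set P} (hV : IsOpen V) (a b : ℝ)
    {f : P × ℝ → F} (hf : ContDiffOn ℝ ∞ f (V ×ˢ univ)) :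
    ContDiffOn ℝ ∞ (fun p => ∫ x in a..b, f (p, x)) V :=
  contDiffOn_infty.2 fun n =>
    contDiffOn_intervalIntegral_nat n hV a b (hf.of_le (by exact_mod_cast le_top))

/-- The primitive of a smooth family is jointly smooth. -/
theorem contDiffOn_primitive {V : Set P} (hV : IsOpen V) (a : ℝ)
    {f : P × ℝ → F} (hf : ContDiffOn ℝ ∞ f (V ×ˢ univ)) :
    ContDiffOn ℝ ∞ (fun q : P × ℝ => ∫ x in a..q.2, f (q.1, x)) (V ×ˢ univ) := by
  -- The substitution x = a + (q.2 - a)σ moves the variable end point into the integrand, so that it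
  -- becomes one more parameter.
  have h : ContDiffOn ℝ ∞ (fun q : P × ℝ => ∫ σ in (0 : ℝ)..1,
      (fun w : (P × ℝ) × ℝ => (w.1.2 - a) • f (w.1.1, a + (w.1.2 - a) * w.2)) (q, σ))
      (V ×ˢ univ) := by
    refine contDiffOn_intervalIntegral (P := P × ℝ) (V := V ×ˢ univ) (hV.prod isOpen_univ) 0 1
      (f := fun w : (P × ℝ) × ℝ => (w.1.2 - a) • f (w.1.1, a + (w.1.2 - a) * w.2)) ?_
    refine ContDiffOn.smul (ContDiff.contDiffOn (by fun_prop)) ?_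
    exact hf.comp (g := f) (f := fun w : (P × ℝ) × ℝ => (w.1.1, a + (w.1.2 - a) * w.2))
      (ContDiff.contDiffOn (by fun_prop)) fun w hw => ⟨hw.1.1, mem_univ _⟩
  refine h.congr fun q _ => ?_
  simp only [intervalIntegral.integral_smul]
  rw [intervalIntegral.smul_integral_comp_add_mul (fun y => f (q.1, y))]
  simp

end ParametricIntegral

/-! ### Vector algebra and orthonormal frames in three-space. -/

section CrossProduct

theorem inner_eq_coords (u v : E3) : inner ℝ u v = u 0 * v 0 + u 1 * v 1 + u 2 * v 2 := by
  simp [PiLp.inner_apply, Fin.sum_univ_three, mul_comm]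

theorem cross_zero_coord (u v : E3) : cross u v 0 = u 1 * v 2 - u 2 * v 1 := by
  simp [cross, crossProduct]

theorem cross_one_coord (u v : E3) : cross u v 1 = u 2 * v 0 - u 0 * v 2 := by
  simp [cross, crossProduct]

theorem cross_two_coord (u v : E3) : cross u v 2 = u 0 * v 1 - u 1 * v 0 := by
  simp [cross, crossProduct]

theorem E3.ext {u v : E3} (h0 : u 0 = v 0) (h1 : u 1 = v 1) (h2 : u 2 = v 2) : u = v := by
  ext i; fin_cases i <;> assumption

/-- The cross product as a continuous bilinear map. -/
noncomputable def crossL : E3 →L[ℝ] E3 →L[ℝ] E3 :=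
  (LinearMap.mk₂ ℝ cross
    (fun u v w => by apply E3.ext <;> simp [cross_zero_coord, cross_one_coord, cross_two_coord] <;> ring)
    (fun r u v => by apply E3.ext <;> simp [cross_zero_coord, cross_one_coord, cross_two_coord] <;> ring)
    (fun u v w => by apply E3.ext <;> simp [cross_zero_coord, cross_one_coord, cross_two_coord] <;> ring)
    (fun r u v => by
      apply E3.ext <;> simp [cross_zero_coord, cross_one_coord, cross_two_coord] <;> ring)).toContinuousBilinearMap

theorem crossL_apply (u v : E3) : crossL u v = cross u v := rfl

theorem inner_cross_left (u v : E3) : inner ℝ (cross u v) u = 0 := by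
  simp only [inner_eq_coords, cross_zero_coord, cross_one_coord, cross_two_coord]; ring

theorem inner_cross_right (u v : E3) : inner ℝ (cross u v) v = 0 := by
  simp only [inner_eq_coords, cross_zero_coord, cross_one_coord, cross_two_coord]; ring

theorem inner_cross_cycle (u v w : E3) : inner ℝ (cross u v) w = inner ℝ (cross v w) u := by
  simp only [inner_eq_coords, cross_zero_coord, cross_one_coord, cross_two_coord]; ring

theorem inner_cross_cross (u v w z : E3) : inner ℝ (cross u v) (cross w z) =
    inner ℝ u w * inner ℝ v z - inner ℝ u z * inner ℝ v w := by
  simp only [inner_eq_coords, cross_zero_coord, cross_one_coord, cross_two_coord]; ring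

theorem cross_cross_eq (u v w : E3) :
    cross u (cross v w) = inner ℝ u w • v - inner ℝ u v • w := by
  apply E3.ext <;>
    simp only [inner_eq_coords, cross_zero_coord, cross_one_coord, cross_two_coord,
      PiLp.sub_apply, PiLp.smul_apply, smul_eq_mul] <;> ring

theorem cross_comm_neg (u v : E3) : cross v u = -cross u v := by
  apply E3.ext <;>
    simp only [cross_zero_coord, cross_one_coord, cross_two_coord, PiLp.neg_apply] <;> ring

theorem cross_self_eq_zero (u : E3) : cross u u = 0 := by
  apply E3.ext <;>
    simp only [cross_zero_coord, cross_one_coord, cross_two_coord, PiLp.zero_apply] <;> ring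

theorem cross_add_right (u v w : E3) : cross u (v + w) = cross u v + cross u w :=
  (crossL u).map_add v w

theorem cross_sub_right (u v w : E3) : cross u (v - w) = cross u v - cross u w :=
  (crossL u).map_sub v w

theorem cross_smul_right (r : ℝ) (u v : E3) : cross u (r • v) = r • cross u v :=
  (crossL u).map_smul r v

theorem norm_cross_of_orthonormal {u v : E3} (hu : ‖u‖ = 1) (hv : ‖v‖ = 1)
    (huv : inner ℝ u v = 0) : ‖cross u v‖ = 1 := by
  have h := inner_cross_cross u v u v
  rw [real_inner_self_eq_norm_sq, real_inner_self_eq_norm_sq, real_inner_self_eq_norm_sq, huv, hu,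
    hv] at h
  nlinarith [norm_nonneg (cross u v)]

/-- Expansion of a vector in the orthonormal frame `(t, n, t × n)`. -/
theorem frame_expansion {t n : E3} (ht : ‖t‖ = 1) (hn : ‖n‖ = 1) (htn : inner ℝ t n = 0) (w : E3) :
    w = inner ℝ w t • t + inner ℝ w n • n + inner ℝ w (cross t n) • cross t n := by
  -- With b = t × n, the product b × (w × b) is computed in two ways: as w - ⟨b, w⟩b, and by
  -- expanding w × (t × n) first.
  have h1 := cross_cross_eq w t n
  have h2 := cross_cross_eq (cross t n) w (cross t n)
  have hb := norm_cross_of_orthonormal ht hn htn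
  rw [h1, cross_sub_right, cross_smul_right, cross_smul_right, real_inner_self_eq_norm_sq, hb,
    one_pow, one_smul] at h2
  have h3 : cross (cross t n) t = n := by
    rw [cross_comm_neg t, cross_cross_eq, htn, real_inner_self_eq_norm_sq, ht]; simp
  have h4 : cross (cross t n) n = -t := by
    rw [cross_comm_neg n, cross_cross_eq, real_inner_comm t n, htn, real_inner_self_eq_norm_sq, hn]; simp
  rw [h3, h4, real_inner_comm w (cross t n)] at h2
  rw [eq_sub_iff_add_eq] at h2
  refine h2.symm.trans ?_
  module

theorem eq_zero_of_frame {t n w : E3} (ht : ‖t‖ = 1) (hn : ‖n‖ = 1) (htn : inner ℝ t n = 0)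
    (h1 : inner ℝ w t = 0) (h2 : inner ℝ w n = 0) (h3 : inner ℝ w (cross t n) = 0) : w = 0 := by
  rw [frame_expansion ht hn htn w, h1, h2, h3]; simp

/-- Parseval in the frame. -/
theorem frame_inner {t n : E3} (ht : ‖t‖ = 1) (hn : ‖n‖ = 1) (htn : inner ℝ t n = 0) (w z : E3) :
    inner ℝ w z = inner ℝ w t * inner ℝ z t + inner ℝ w n * inner ℝ z n
      + inner ℝ w (cross t n) * inner ℝ z (cross t n) := by
  conv_lhs => rw [frame_expansion ht hn htn w]
  simp only [inner_add_left, real_inner_smul_left]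
  rw [real_inner_comm z t, real_inner_comm z n, real_inner_comm z (cross t n)]

theorem ContDiffOn.cross {E : Type*} [NormedAddCommGroup E] [NormedSpace ℝ E] {f g : E → E3}
    {s : Set E} {n : WithTop ℕ∞} (hf : ContDiffOn ℝ n f s) (hg : ContDiffOn ℝ n g s) :
    ContDiffOn ℝ n (fun x => cross (f x) (g x)) s :=
  (crossL.contDiff.comp_contDiffOn hf).clm_apply hg

theorem HasDerivWithinAt.cross {f g : ℝ → E3} {f' g' : E3} {s : Set ℝ} {x : ℝ}
    (hf : HasDerivWithinAt f f' s x) (hg : HasDerivWithinAt g g' s x) :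
    HasDerivWithinAt (fun x => cross (f x) (g x)) (cross f' (g x) + cross (f x) g') s x :=
  (crossL.hasFDerivAt.comp_hasDerivWithinAt x hf).clm_apply hg

end CrossProduct

/-! ### A primitive of the area form on the sphere minus two points. -/

section ConnectionForm

/-- A potential of the area form on the sphere minus `± v / ‖v‖`, written as a vector field. It
is the connection form of the frame whose first vector is the projection of `v`. -/
noncomputable def areaPotential (v t : E3) : E3 :=
  (inner ℝ v t / (‖v‖ ^ 2 - inner ℝ v t ^ 2)) • cross v t

/-- The directional derivative of `areaPotential v`. -/
noncomputable def areaPotentialDeriv (v t u : E3) : E3 :=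
  (inner ℝ v u / (‖v‖ ^ 2 - inner ℝ v t ^ 2)
    + 2 * inner ℝ v t ^ 2 * inner ℝ v u / (‖v‖ ^ 2 - inner ℝ v t ^ 2) ^ 2) • cross v t
    + (inner ℝ v t / (‖v‖ ^ 2 - inner ℝ v t ^ 2)) • cross v u

theorem hasDerivAt_areaPotential {v : E3} {y : ℝ → E3} {y' : E3} {x : ℝ} (hy : HasDerivAt y y' x)
    (hv : ‖v‖ ^ 2 - inner ℝ v (y x) ^ 2 ≠ 0) :
    HasDerivAt (fun x => areaPotential v (y x)) (areaPotentialDeriv v (y x) y') x := by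
  have h1 : HasDerivAt (fun x => inner ℝ v (y x)) (inner ℝ v y') x := by
    simpa using (hasDerivAt_const x v).inner ℝ hy
  have h2 : HasDerivAt (fun x => ‖v‖ ^ 2 - inner ℝ v (y x) ^ 2)
      (-(2 * inner ℝ v (y x) * inner ℝ v y')) x := by
    simpa using ((h1.pow 2).const_sub (‖v‖ ^ 2))
  have h3 : HasDerivAt (fun x => cross v (y x)) (cross v y') x :=
    (crossL v).hasFDerivAt.comp_hasDerivAt x hy
  have h4 := (h1.div h2 hv).smul h3
  refine h4.congr_deriv ?_
  rw [areaPotentialDeriv, add_comm]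
  congr 2
  field_simp
  ring

theorem areaPotential_contDiffOn {E : Type*} [NormedAddCommGroup E] [NormedSpace ℝ E] {v : E3}
    {f : E → E3} {s : Set E} {n : WithTop ℕ∞} (hf : ContDiffOn ℝ n f s)
    (hv : ∀ x ∈ s, ‖v‖ ^ 2 - inner ℝ v (f x) ^ 2 ≠ 0) :
    ContDiffOn ℝ n (fun x => areaPotential v (f x)) s := by
  have h1 : ContDiffOn ℝ n (fun x => inner ℝ v (f x)) s := contDiffOn_const.inner ℝ hf
  exact (h1.div (contDiffOn_const.sub (h1.pow 2)) hv).smul (contDiffOn_const.cross hf)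

/-- The exterior derivative of the potential is minus the area form. -/
theorem areaPotentialDeriv_antisymm {v t u w : E3} (ht : ‖t‖ = 1) (hu : inner ℝ t u = 0)
    (hw : inner ℝ t w = 0) (hv : ‖v‖ ^ 2 - inner ℝ v t ^ 2 ≠ 0) :
    inner ℝ (areaPotentialDeriv v t u) w - inner ℝ (areaPotentialDeriv v t w) u =
      inner ℝ (cross t w) u := by
  set δ := inner ℝ (cross t w) u with hδ
  -- Both vectors are tangent to the sphere at t, so their product is a multiple of t, and the
  -- multiple is the value of the area form.
  have hwu : cross w u = δ • t := by
    have h1 : cross t (cross w u) = 0 := by rw [cross_cross_eq, hu, hw]; simp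
    have h2 := cross_cross_eq t t (cross w u)
    rw [h1, real_inner_self_eq_norm_sq, ht] at h2
    have h3 : cross t (0 : E3) = 0 := (crossL t).map_zero
    rw [h3, one_pow, one_smul, eq_comm, sub_eq_zero] at h2
    rw [← h2, hδ, inner_cross_cycle, real_inner_comm]
  have e1 : inner ℝ v u * inner ℝ (cross v t) w - inner ℝ v w * inner ℝ (cross v t) u
      = δ * (‖v‖ ^ 2 - inner ℝ v t ^ 2) := by
    have h1 := cross_cross_eq v w u
    rw [hwu, cross_smul_right] at h1
    have h2 : inner ℝ (cross v t) (δ • cross v t) =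
        inner ℝ (cross v t) (inner ℝ v u • w - inner ℝ v w • u) := by rw [h1]
    rw [real_inner_smul_right, inner_cross_cross, inner_sub_right, real_inner_smul_right,
      real_inner_smul_right, real_inner_self_eq_norm_sq, real_inner_self_eq_norm_sq, ht,
      real_inner_comm v t] at h2
    linear_combination -h2
  have e2 : inner ℝ (cross v u) w = -(δ * inner ℝ v t) := by
    have : cross u w = -(δ • t) := by rw [← hwu, cross_comm_neg w u]
    rw [inner_cross_cycle, this, inner_neg_left, real_inner_smul_left, real_inner_comm]
  have e3 : inner ℝ (cross v w) u = δ * inner ℝ v t := by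
    rw [inner_cross_cycle, hwu, real_inner_smul_left, real_inner_comm]
  unfold areaPotentialDeriv
  simp only [inner_add_left, real_inner_smul_left, e2, e3]
  set q := ‖v‖ ^ 2 - inner ℝ v t ^ 2
  field_simp
  linear_combination (q + 2 * inner ℝ v t ^ 2) * e1

end ConnectionForm

/-! ### Families which are fixed near the end points, and their integrals. -/

section CompactSupport

variable {P F : Type} [NormedAddCommGroup P] [NormedSpace ℝ P] [NormedAddCommGroup F]
  [NormedSpace ℝ F] {a b c d : ℝ}

/-- Extension by zero of a smooth family of functions on `(a,b)` supported in `[c,d] ⊆ (a,b)`. -/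
theorem contDiffOn_indicator {V : Set P} (hV : IsOpen V) (hac : a < c) (hdb : d < b)
    {f : P × ℝ → F} (hf : ContDiffOn ℝ ∞ f (V ×ˢ Ioo a b))
    (h0 : ∀ p ∈ V, ∀ x ∈ Ioo a b, x ∉ Ioo c d → f (p, x) = 0) :
    ContDiffOn ℝ ∞ (fun q : P × ℝ => (Ioo a b).indicator (fun x => f (q.1, x)) q.2)
      (V ×ˢ univ) := by
  intro q hq
  refine ContDiffAt.contDiffWithinAt ?_
  by_cases hx : q.2 ∈ Icc c d
  · have hm : q.2 ∈ Ioo a b := ⟨hac.trans_le hx.1, hx.2.trans_lt hdb⟩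
    have hO : V ×ˢ Ioo a b ∈ 𝓝 q := (hV.prod isOpen_Ioo).mem_nhds ⟨hq.1, hm⟩
    refine (hf.contDiffAt hO).congr_of_eventuallyEq ?_
    filter_upwards [hO] with w hw
    simp [indicator_of_mem hw.2]
  · have hO : V ×ˢ (Icc c d)ᶜ ∈ 𝓝 q := (hV.prod isClosed_Icc.isOpen_compl).mem_nhds ⟨hq.1, hx⟩
    refine (contDiffAt_const (c := (0 : F))).congr_of_eventuallyEq ?_
    filter_upwards [hO] with w hw
    by_cases hwm : w.2 ∈ Ioo a b
    · rw [indicator_of_mem hwm]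
      exact h0 _ hw.1 _ hwm fun h => hw.2 ⟨h.1.le, h.2.le⟩
    · exact indicator_of_notMem hwm _

theorem contDiff_indicator (hac : a < c) (hdb : d < b) {f : ℝ → F}
    (hf : ContDiffOn ℝ ∞ f (Ioo a b)) (h0 : ∀ x ∈ Ioo a b, x ∉ Ioo c d → f x = 0) :
    ContDiff ℝ ∞ ((Ioo a b).indicator f) := by
  have h := contDiffOn_indicator (P := ℝ) (V := univ) isOpen_univ hac hdb
    (f := fun q => f q.2) (hf.comp contDiffOn_snd fun q hq => hq.2) fun p _ x hx hx' => h0 x hx hx'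
  rw [univ_prod_univ, contDiffOn_univ] at h
  exact h.comp (f := fun x : ℝ => ((0 : ℝ), x)) (by fun_prop)

theorem intervalIntegral_congr_Ioo (hab : a ≤ b) {f g : ℝ → F} (h : ∀ x ∈ Ioo a b, f x = g x) :
    ∫ x in a..b, f x = ∫ x in a..b, g x := by
  rw [intervalIntegral.integral_of_le hab, intervalIntegral.integral_of_le hab,
    integral_Ioc_eq_integral_Ioo, integral_Ioc_eq_integral_Ioo]
  exact setIntegral_congr_fun measurableSet_Ioo h

theorem intervalIntegrable_congr_Ioo {E : Type} [NormedAddCommGroup E] {a b : ℝ} (hab : a ≤ b)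
    {f g : ℝ → E} (h : ∀ x ∈ Ioo a b, f x = g x)
    (hf : IntervalIntegrable f volume a b) : IntervalIntegrable g volume a b := by
  rw [intervalIntegrable_iff_integrableOn_Ioo_of_le hab] at hf ⊢
  exact hf.congr_fun h measurableSet_Ioo

theorem intervalIntegrable_of_support (hab : a ≤ b) (hac : a < c) (hdb : d < b) {f : ℝ → F}
    (hf : ContDiffOn ℝ ∞ f (Ioo a b)) (h0 : ∀ x ∈ Ioo a b, x ∉ Ioo c d → f x = 0) :
    IntervalIntegrable f volume a b :=
  intervalIntegrable_congr_Ioo hab (fun _ hx => indicator_of_mem hx f)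
    ((contDiff_indicator hac hdb hf h0).continuous.intervalIntegrable _ _)

theorem deriv_eq_indicator {f : ℝ → F} {x : ℝ} (hx : x ∈ Ioo a b) :
    deriv ((Ioo a b).indicator f) x = deriv f x := by
  refine Filter.EventuallyEq.deriv_eq ?_
  filter_upwards [isOpen_Ioo.mem_nhds hx] with y hy using indicator_of_mem hy f

theorem intervalIntegrable_deriv_of_support (hab : a ≤ b) (hac : a < c) (hdb : d < b) {f : ℝ → F}
    (hf : ContDiffOn ℝ ∞ f (Ioo a b)) (h0 : ∀ x ∈ Ioo a b, x ∉ Ioo c d → f x = 0) :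
    IntervalIntegrable (deriv f) volume a b :=
  intervalIntegrable_congr_Ioo hab (fun _ hx => deriv_eq_indicator hx)
    (((contDiff_indicator hac hdb hf h0).continuous_deriv (by simp)).intervalIntegrable _ _)

theorem integral_deriv_of_support [CompleteSpace F] (hab : a ≤ b) (hac : a < c) (hdb : d < b)
    {f : ℝ → F} (hf : ContDiffOn ℝ ∞ f (Ioo a b))
    (h0 : ∀ x ∈ Ioo a b, x ∉ Ioo c d → f x = 0) :
    ∫ x in a..b, deriv f x = 0 := by
  have h := contDiff_indicator hac hdb hf h0
  rw [intervalIntegral_congr_Ioo hab (g := deriv ((Ioo a b).indicator f))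
    fun x hx => (deriv_eq_indicator hx).symm]
  rw [intervalIntegral.integral_deriv_eq_sub
    (fun x _ => (h.differentiable (by simp)).differentiableAt)
    ((h.continuous_deriv (by simp)).intervalIntegrable _ _)]
  simp

/-- A family `f p`, `p ∈ V`, of functions on `(a,b)` which agree with `g` near the end points. -/
structure IsFamilyRelEnds (a b c d : ℝ) (g : ℝ → F) (V : Set P) (f : P × ℝ → F) : Prop where
  isOpen : IsOpen V
  lt_left : a < c
  lt_right : d < b
  le : a ≤ b
  smooth : ContDiffOn ℝ ∞ f (V ×ˢ Ioo a b)
  smooth_base : ContDiffOn ℝ ∞ g (Ioo a b)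
  eq_off : ∀ p ∈ V, ∀ x ∈ Ioo a b, x ∉ Ioo c d → f (p, x) = g x

namespace IsFamilyRelEnds

variable {g : ℝ → F} {V : Set P} {f : P × ℝ → F}

/-- A family is controlled only over the open interval, but its difference from the base function
has compact support there and extends by zero to the whole line. Integrals are therefore split into
a fixed part and this difference. -/
theorem diff_contDiffOn (h : IsFamilyRelEnds a b c d g V f) :
    ContDiffOn ℝ ∞ (fun q : P × ℝ => (Ioo a b).indicator (fun x => f (q.1, x) - g x) q.2)
      (V ×ˢ univ) :=
  contDiffOn_indicator (f := fun q => f q - g q.2) h.isOpen h.lt_left h.lt_right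
    (h.smooth.sub (h.smooth_base.comp contDiffOn_snd fun q hq => hq.2)) fun p hp x hx hx' => by
      simp [h.eq_off p hp x hx hx']

theorem diff_continuous (h : IsFamilyRelEnds a b c d g V f) {p : P} (hp : p ∈ V) :
    Continuous ((Ioo a b).indicator (fun x => f (p, x) - g x)) :=
  continuousOn_univ.1 (h.diff_contDiffOn.continuousOn.comp (f := fun x : ℝ => (p, x))
    (Continuous.continuousOn (by fun_prop)) fun x _ => ⟨hp, mem_univ _⟩)

theorem integral_eq (h : IsFamilyRelEnds a b c d g V f) (hg : IntervalIntegrable g volume a b)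
    {p : P} (hp : p ∈ V) : ∫ x in a..b, f (p, x) = (∫ x in a..b, g x) +
      ∫ x in a..b, (Ioo a b).indicator (fun x => f (p, x) - g x) x := by
  rw [← intervalIntegral.integral_add hg ((h.diff_continuous hp).intervalIntegrable _ _)]
  exact intervalIntegral_congr_Ioo h.le fun x hx => by rw [indicator_of_mem hx]; simp

theorem contDiffOn_integral (h : IsFamilyRelEnds a b c d g V f)
    (hg : IntervalIntegrable g volume a b) :
    ContDiffOn ℝ ∞ (fun p => ∫ x in a..b, f (p, x)) V :=
  (contDiffOn_const.add (contDiffOn_intervalIntegral h.isOpen a b h.diff_contDiffOn)).congr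
    fun _ hp => h.integral_eq hg hp

end IsFamilyRelEnds

theorem IsFamilyRelEnds.hasDerivAt_integral {g : ℝ → F} {V : Set ℝ} {f : ℝ × ℝ → F}
    [CompleteSpace F]
    (h : IsFamilyRelEnds a b c d g V f) (hg : IntervalIntegrable g volume a b) {t : ℝ}
    (ht : t ∈ V) :
    HasDerivAt (fun p => ∫ x in a..b, f (p, x))
      (∫ x in a..b, deriv (fun s => f (s, x)) t) t := by
  have hO : IsOpen (V ×ˢ (univ : Set ℝ)) := h.isOpen.prod isOpen_univ
  set Φ : ℝ × ℝ → F := fun q => (Ioo a b).indicator (fun x => f (q.1, x) - g x) q.2 with hΦ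
  have h1 := hasFDerivAt_intervalIntegral_of_contDiffOn h.isOpen a b
    (h.diff_contDiffOn.of_le (by exact_mod_cast le_top)) ht
  have h2 : HasDerivAt (fun p => ∫ x in a..b, Φ (p, x))
      (∫ x in a..b, deriv (fun s => f (s, x)) t) t := by
    refine h1.hasDerivAt.congr_deriv ?_
    have hint : IntervalIntegrable (fun x => (fderiv ℝ Φ (t, x)).comp
        (ContinuousLinearMap.inl ℝ ℝ ℝ)) volume a b := by
      refine Continuous.intervalIntegrable ?_ _ _
      have := h.diff_contDiffOn.continuousOn_fderiv_of_isOpen hO (by simp)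
      have h3 : Continuous fun x => fderiv ℝ Φ (t, x) :=
        continuousOn_univ.1 (this.comp (f := fun x : ℝ => (t, x))
          (Continuous.continuousOn (by fun_prop)) fun x _ => ⟨ht, mem_univ _⟩)
      exact h3.clm_comp continuous_const
    rw [ContinuousLinearMap.intervalIntegral_apply hint]
    refine intervalIntegral_congr_Ioo h.le fun x hx => ?_
    have h4 : HasFDerivAt Φ (fderiv ℝ Φ (t, x)) (t, x) :=
      ((h.diff_contDiffOn.contDiffAt (hO.mem_nhds ⟨ht, mem_univ x⟩)).differentiableAt
        (by simp)).hasFDerivAt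
    have h5 := (h4.comp t (hasFDerivAt_prodMk_left t x)).hasDerivAt
    rw [← h5.deriv]
    have h6 : (Φ ∘ fun e => (e, x)) = fun s => f (s, x) - g x := by
      ext s; simp [hΦ, indicator_of_mem hx]
    rw [h6, deriv_sub_const]
  refine (h2.const_add (∫ x in a..b, g x)).congr_of_eventuallyEq ?_
  filter_upwards [h.isOpen.mem_nhds ht] with p hp using h.integral_eq hg hp

end CompactSupport

/-! ### Partial derivatives and their symmetry. -/

section Partials

variable {F : Type} [NormedAddCommGroup F] [NormedSpace ℝ F] {U : Set (ℝ × ℝ)} {f : ℝ × ℝ → F}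

/-- The partial derivative in the first variable. -/
noncomputable def partialT (f : ℝ × ℝ → F) (q : ℝ × ℝ) : F := fderiv ℝ f q (1, 0)

theorem ContDiffOn.partialT (hU : IsOpen U) (hf : ContDiffOn ℝ ∞ f U) :
    ContDiffOn ℝ ∞ (partialT f) U :=
  (hf.fderiv_of_isOpen hU (by simp)).clm_apply contDiffOn_const

theorem hasDerivAt_partialT (hU : IsOpen U) (hf : ContDiffOn ℝ ∞ f U) {t x : ℝ}
    (h : (t, x) ∈ U) : HasDerivAt (fun s => f (s, x)) (partialT f (t, x)) t := by
  have h4 : HasFDerivAt f (fderiv ℝ f (t, x)) (t, x) :=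
    ((hf.contDiffAt (hU.mem_nhds h)).differentiableAt (by simp)).hasFDerivAt
  have := (h4.comp t (hasFDerivAt_prodMk_left t x)).hasDerivAt
  simpa [partialT, Function.comp_def] using this

/-- The partial derivative in the second variable, for any space of parameters. -/
noncomputable def partialX {P : Type} [NormedAddCommGroup P] [NormedSpace ℝ P]
    (f : P × ℝ → F) (q : P × ℝ) : F := fderiv ℝ f q (0, 1)

theorem ContDiffOn.partialX {P : Type} [NormedAddCommGroup P] [NormedSpace ℝ P]
    {U : Set (P × ℝ)} {f : P × ℝ → F} (hU : IsOpen U) (hf : ContDiffOn ℝ ∞ f U) :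
    ContDiffOn ℝ ∞ (partialX f) U :=
  (hf.fderiv_of_isOpen hU (by simp)).clm_apply contDiffOn_const

theorem hasDerivAt_partialX {P : Type} [NormedAddCommGroup P] [NormedSpace ℝ P]
    {U : Set (P × ℝ)} {f : P × ℝ → F} (hU : IsOpen U) (hf : ContDiffOn ℝ ∞ f U) {p : P} {x : ℝ}
    (h : (p, x) ∈ U) : HasDerivAt (fun s => f (p, s)) (partialX f (p, x)) x := by
  have h4 : HasFDerivAt f (fderiv ℝ f (p, x)) (p, x) :=
    ((hf.contDiffAt (hU.mem_nhds h)).differentiableAt (by simp)).hasFDerivAt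
  have := (h4.comp x (hasFDerivAt_prodMk_right p x)).hasDerivAt
  simpa [partialX, Function.comp_def] using this

theorem partialT_partialX (hU : IsOpen U) (hf : ContDiffOn ℝ ∞ f U) {q : ℝ × ℝ} (h : q ∈ U) :
    partialT (partialX f) q = partialX (partialT f) q := by
  have h1 : HasFDerivAt (fderiv ℝ f) (fderiv ℝ (fderiv ℝ f) q) q :=
    (((hf.fderiv_of_isOpen hU (m := ∞) (by simp)).contDiffAt (hU.mem_nhds h)).differentiableAt
      (by simp)).hasFDerivAt
  have hs := (hf.contDiffAt (hU.mem_nhds h)).isSymmSndFDerivAt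
    (by rw [minSmoothness_of_isRCLikeNormedField]; exact WithTop.coe_le_coe.2 le_top)
  have h2 : ∀ w : ℝ × ℝ, fderiv ℝ (fun q => fderiv ℝ f q w) q =
      (fderiv ℝ (fderiv ℝ f) q).flip w := fun w => by
    have := (h1.clm_apply (hasFDerivAt_const w q)).fderiv
    simpa using this
  have e1 : partialT (partialX f) q = (fderiv ℝ (fderiv ℝ f) q (1, 0)) (0, 1) := by
    change fderiv ℝ (fun q => fderiv ℝ f q (0, 1)) q (1, 0) = _
    rw [h2]; rfl
  have e2 : partialX (partialT f) q = (fderiv ℝ (fderiv ℝ f) q (0, 1)) (1, 0) := by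
    change fderiv ℝ (fun q => fderiv ℝ f q (1, 0)) q (0, 1) = _
    rw [h2]; rfl
  rw [e1, e2]
  exact hs _ _

end Partials

/-! ### Calculus with one-sided derivatives on a closed interval. -/

section ClosedInterval

variable {F : Type*} [NormedAddCommGroup F] [NormedSpace ℝ F] {a b : ℝ} {g h : ℝ → F} {x : ℝ}

theorem D_zero (a b : ℝ) (g : ℝ → F) : D a b 0 g = g := iteratedDerivWithin_zero

theorem D_succ (a b : ℝ) (k : ℕ) (g : ℝ → F) : D a b (k + 1) g = D a b 1 (D a b k g) := by
  unfold D
  rw [iteratedDerivWithin_succ, iteratedDerivWithin_one]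

theorem D_one (a b : ℝ) (g : ℝ → F) : D a b 1 g = derivWithin g (Icc a b) :=
  iteratedDerivWithin_one

theorem SmoothOnIcc.D_one (hab : a < b) (hg : SmoothOnIcc a b g) :
    SmoothOnIcc a b (D a b 1 g) := by
  rw [_root_.D_one]
  exact ((contDiffOn_infty_iff_derivWithin (uniqueDiffOn_Icc hab)).1 hg).2

theorem D_congr (k : ℕ) (hgh : EqOn g h (Icc a b)) : EqOn (D a b k g) (D a b k h) (Icc a b) := by
  induction k with
  | zero => rwa [D_zero, D_zero]
  | succ k ih =>
    intro x hx
    rw [D_succ a b k g, D_succ a b k h, D_one, D_one]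
    exact derivWithin_congr ih (ih hx)

theorem SmoothOnIcc.hasDerivWithinAt (hg : SmoothOnIcc a b g) (hx : x ∈ Icc a b) :
    HasDerivWithinAt g (_root_.D a b 1 g x) (Icc a b) x := by
  rw [_root_.D_one]
  exact ((hg x hx).differentiableWithinAt (by simp)).hasDerivWithinAt

theorem SmoothOnIcc.hasDerivAt (hg : SmoothOnIcc a b g) (hx : x ∈ Ioo a b) :
    HasDerivAt g (_root_.D a b 1 g x) x :=
  (hg.hasDerivWithinAt (Ioo_subset_Icc_self hx)).hasDerivAt (Icc_mem_nhds hx.1 hx.2)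

theorem HasDerivWithinAt.D_one_eq (hab : a < b) {g' : F} (hx : x ∈ Icc a b)
    (hg : HasDerivWithinAt g g' (Icc a b) x) : D a b 1 g x = g' := by
  rw [D_one]
  exact hg.derivWithin (uniqueDiffOn_Icc hab x hx)

theorem SmoothOnIcc.Ioo (hg : SmoothOnIcc a b g) : ContDiffOn ℝ ∞ g (Ioo a b) :=
  ContDiffOn.mono hg Ioo_subset_Icc_self

theorem SmoothOnIcc.deriv_eq (hg : SmoothOnIcc a b g) (hx : x ∈ Set.Ioo a b) :
    deriv g x = _root_.D a b 1 g x := (hg.hasDerivAt hx).deriv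

theorem ContinuousOn.intervalIntegrable_Icc' {E : Type*} [NormedAddCommGroup E] (hab : a ≤ b)
    {g : ℝ → E} (hg : ContinuousOn g (Icc a b)) : IntervalIntegrable g volume a b :=
  ContinuousOn.intervalIntegrable (by rwa [uIcc_of_le hab])

/-- Two functions with the same derivative on `[a,b]` differ by a constant. -/
theorem eq_of_derivWithin_eq_zero (hab : a < b)
    (hg : ∀ x ∈ Icc a b, HasDerivWithinAt g 0 (Icc a b) x) (hx : x ∈ Icc a b) : g x = g a := by
  refine constant_of_derivWithin_zero (fun y hy => (hg y hy).differentiableWithinAt)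
    (fun y hy => ?_) x hx
  exact (hg y (Ico_subset_Icc_self hy)).derivWithin
    (uniqueDiffOn_Icc hab y (Ico_subset_Icc_self hy))

/-- Primitives of smooth functions on `[a,b]`. -/
theorem SmoothOnIcc.primitive [CompleteSpace F] (hab : a < b) (hg : SmoothOnIcc a b g) :
    SmoothOnIcc a b (fun x => ∫ y in a..x, g y) ∧
      ∀ x ∈ Icc a b, HasDerivWithinAt (fun x => ∫ y in a..x, g y) (g x) (Icc a b) x := by
  have h : ∀ x ∈ Icc a b, HasDerivWithinAt (fun x => ∫ y in a..x, g y) (g x) (Icc a b) x := by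
    intro x hx
    have hc : ContinuousOn g (Icc a b) := ContDiffOn.continuousOn hg
    have : Fact (x ∈ Icc a b) := ⟨hx⟩
    refine intervalIntegral.integral_hasDerivWithinAt_right (s := Icc a b) (t := Icc a b)
      ((hc.mono (Icc_subset_Icc_right hx.2)).intervalIntegrable_Icc' hx.1) ?_ (hc x hx)
    exact hc.stronglyMeasurableAtFilter_nhdsWithin measurableSet_Icc x
  refine ⟨?_, h⟩
  refine (contDiffOn_infty_iff_derivWithin (uniqueDiffOn_Icc hab)).2
    ⟨fun x hx => (h x hx).differentiableWithinAt, ?_⟩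
  exact ContDiffOn.congr hg fun x hx => (h x hx).derivWithin (uniqueDiffOn_Icc hab x hx)

end ClosedInterval

/-! ### Families of unit tangent fields. -/

section TangentFamily

variable {P : Type} [NormedAddCommGroup P] [NormedSpace ℝ P] {a b c d : ℝ}

/-- Derivatives are compared at points where the functions agree on a neighbourhood, so the support
interval is widened halfway towards the ends. -/
theorem IsFamilyRelEnds.partialX {F : Type} [NormedAddCommGroup F] [NormedSpace ℝ F]
    {g : ℝ → F} {V : Set P} {f : P × ℝ → F} (h : IsFamilyRelEnds a b c d g V f) :
    IsFamilyRelEnds a b ((a + c) / 2) ((d + b) / 2) (deriv g) V (partialX f) where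
  isOpen := h.isOpen
  lt_left := by linarith [h.lt_left]
  lt_right := by linarith [h.lt_right]
  le := h.le
  smooth := h.smooth.partialX (h.isOpen.prod isOpen_Ioo)
  smooth_base := ((contDiffOn_infty_iff_deriv_of_isOpen isOpen_Ioo).1 h.smooth_base).2
  eq_off p hp x hx hx' := by
    rw [← (hasDerivAt_partialX (h.isOpen.prod isOpen_Ioo) h.smooth
      (show (p, x) ∈ V ×ˢ Ioo a b from ⟨hp, hx⟩)).deriv]
    refine Filter.EventuallyEq.deriv_eq ?_
    have hm : x ∉ Icc c d := fun hc => hx'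
      ⟨by linarith [h.lt_left, hc.1], by linarith [h.lt_right, hc.2]⟩
    filter_upwards [isOpen_Ioo.mem_nhds hx, isClosed_Icc.isOpen_compl.mem_nhds hm] with y hy hy'
    exact h.eq_off p hp y hy fun hc => hy' (Ioo_subset_Icc_self hc)

/-- A smooth family of unit vector fields along `[a,b]` which agree with `T` outside of `(c,d)`. -/
structure IsTangentFamily (a b c d : ℝ) (T : ℝ → E3) (V : Set P) (τ : P × ℝ → E3) : Prop
    extends IsFamilyRelEnds a b c d T V τ where
  lt : a < b
  smooth_T : SmoothOnIcc a b T
  unit : ∀ p ∈ V, ∀ x ∈ Icc a b, ‖τ (p, x)‖ = 1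
  eq_off_Icc : ∀ p ∈ V, ∀ x ∈ Icc a b, x ∉ Ioo c d → τ (p, x) = T x

namespace IsTangentFamily

variable {T : ℝ → E3} {V : Set P} {τ : P × ℝ → E3}

/-- Joint smoothness covers the interior; near the end points the field is T, which is smooth up to
the boundary. -/
theorem smooth_slice (h : IsTangentFamily a b c d T V τ) {p : P} (hp : p ∈ V) :
    SmoothOnIcc a b (fun x => τ (p, x)) := by
  intro x hx
  by_cases hm : x ∈ Icc c d
  · have hx' : x ∈ Ioo a b := ⟨h.lt_left.trans_le hm.1, hm.2.trans_lt h.lt_right⟩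
    have := h.smooth.contDiffAt ((h.isOpen.prod isOpen_Ioo).mem_nhds
      (show (p, x) ∈ V ×ˢ Ioo a b from ⟨hp, hx'⟩))
    exact (this.comp (f := fun x : ℝ => (p, x)) x
      (ContDiff.contDiffAt (by fun_prop))).contDiffWithinAt
  · refine (h.smooth_T x hx).congr_of_eventuallyEq ?_ ?_
    · filter_upwards [self_mem_nhdsWithin,
        mem_nhdsWithin_of_mem_nhds (isClosed_Icc.isOpen_compl.mem_nhds hm)] with y hy hy'
      exact h.eq_off_Icc p hp y hy fun hc => hy' (Ioo_subset_Icc_self hc)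
    · exact h.eq_off_Icc p hp x hx fun hc => hm (Ioo_subset_Icc_self hc)

theorem D_one_eq (h : IsTangentFamily a b c d T V τ) {p : P} (hp : p ∈ V) {x : ℝ}
    (hx : x ∈ Ioo a b) : D a b 1 (fun x => τ (p, x)) x = partialX τ (p, x) := by
  rw [← (h.smooth_slice hp).deriv_eq hx]
  exact (hasDerivAt_partialX (h.isOpen.prod isOpen_Ioo) h.smooth
    (show (p, x) ∈ V ×ˢ Ioo a b from ⟨hp, hx⟩)).deriv

end IsTangentFamily

end TangentFamily

/-! ### First variations of the energy and of the total connection form. -/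

section Variation

variable {a b c d : ℝ} {T : ℝ → E3} {V : Set ℝ} {τ : ℝ × ℝ → E3}

namespace IsFamilyRelEnds

variable {F : Type} [NormedAddCommGroup F] [NormedSpace ℝ F] {g : ℝ → F} {f : ℝ × ℝ → F}

theorem partialT_eq_zero (h : IsFamilyRelEnds a b c d g V f) {t : ℝ} (ht : t ∈ V) {x : ℝ}
    (hx : x ∈ Ioo a b) (hx' : x ∉ Ioo c d) : partialT f (t, x) = 0 := by
  rw [← (hasDerivAt_partialT (h.isOpen.prod isOpen_Ioo) h.smooth
    (show (t, x) ∈ V ×ˢ Ioo a b from ⟨ht, hx⟩)).deriv]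
  rw [Filter.EventuallyEq.deriv_eq (f₁ := fun s => f (s, x)) (f := fun _ => g x), deriv_const]
  filter_upwards [h.isOpen.mem_nhds ht] with s hs using h.eq_off s hs x hx hx'

theorem smooth_partialT (h : IsFamilyRelEnds a b c d g V f) {t : ℝ} (ht : t ∈ V) :
    ContDiffOn ℝ ∞ (fun x => partialT f (t, x)) (Ioo a b) :=
  (h.smooth.partialT (h.isOpen.prod isOpen_Ioo)).comp (f := fun x : ℝ => (t, x))
    (ContDiff.contDiffOn (by fun_prop)) fun x hx => ⟨ht, hx⟩

end IsFamilyRelEnds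

theorem IsTangentFamily.inner_partialT (h : IsTangentFamily a b c d T V τ) {t : ℝ} (ht : t ∈ V)
    {x : ℝ} (hx : x ∈ Ioo a b) : inner ℝ (τ (t, x)) (partialT τ (t, x)) = 0 := by
  have h1 := hasDerivAt_partialT (h.isOpen.prod isOpen_Ioo) h.smooth
    (show (t, x) ∈ V ×ˢ Ioo a b from ⟨ht, hx⟩)
  have h2 := (h1.inner ℝ h1).deriv
  rw [Filter.EventuallyEq.deriv_eq (f := fun _ => (1 : ℝ)), deriv_const] at h2
  · rw [real_inner_comm] at h2
    rw [real_inner_comm]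
    linarith
  · filter_upwards [h.isOpen.mem_nhds ht] with s hs
    rw [real_inner_self_eq_norm_sq, h.unit s hs x (Ioo_subset_Icc_self hx), one_pow]

theorem IsTangentFamily.inner_partialX {P : Type} [NormedAddCommGroup P] [NormedSpace ℝ P]
    {V : Set P} {τ : P × ℝ → E3} (h : IsTangentFamily a b c d T V τ) {t : P} (ht : t ∈ V)
    {x : ℝ} (hx : x ∈ Ioo a b) : inner ℝ (τ (t, x)) (partialX τ (t, x)) = 0 := by
  have h1 := hasDerivAt_partialX (h.isOpen.prod isOpen_Ioo) h.smooth
    (show (t, x) ∈ V ×ˢ Ioo a b from ⟨ht, hx⟩)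
  have h2 := (h1.inner ℝ h1).deriv
  rw [Filter.EventuallyEq.deriv_eq (f := fun _ => (1 : ℝ)), deriv_const] at h2
  · rw [real_inner_comm] at h2
    rw [real_inner_comm]
    linarith
  · filter_upwards [isOpen_Ioo.mem_nhds hx] with s hs
    rw [real_inner_self_eq_norm_sq, h.unit t ht s (Ioo_subset_Icc_self hs), one_pow]

/-- First variation of the energy `∫ ρ |τ'|²`. -/
theorem IsTangentFamily.hasDerivAt_energy (h : IsTangentFamily a b c d T V τ) {ρ : ℝ → ℝ}
    (hρ : SmoothOnIcc a b ρ) {t : ℝ} (ht : t ∈ V) (hτ : ∀ x ∈ Ioo a b, τ (t, x) = T x) :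
    HasDerivAt (fun s => ∫ x in a..b, ρ x * inner ℝ (D a b 1 (fun y => τ (s, y)) x)
        (D a b 1 (fun y => τ (s, y)) x))
      (-2 * ∫ x in a..b, inner ℝ (D a b 1 (fun y => ρ y • D a b 1 T y) x) (partialT τ (t, x)))
      t := by
  have hO : IsOpen (V ×ˢ Ioo a b) := h.isOpen.prod isOpen_Ioo
  have hX := h.toIsFamilyRelEnds.partialX
  have hρX : ContDiffOn ℝ ∞ (fun q : ℝ × ℝ => ρ q.2) (V ×ˢ Ioo a b) :=
    hρ.Ioo.comp contDiffOn_snd fun q hq => hq.2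
  have hfam : IsFamilyRelEnds a b ((a + c) / 2) ((d + b) / 2)
      (fun x => ρ x * inner ℝ (deriv T x) (deriv T x)) V
      (fun q => ρ q.2 * inner ℝ (partialX τ q) (partialX τ q)) :=
    { hX with
      smooth := hρX.mul (hX.smooth.inner ℝ hX.smooth)
      smooth_base := hρ.Ioo.mul (hX.smooth_base.inner ℝ hX.smooth_base)
      eq_off := fun p hp x hx hx' => by simp only [hX.eq_off p hp x hx hx'] }
  have hT1 : SmoothOnIcc a b (D a b 1 T) := h.smooth_T.D_one h.lt
  have hρT : SmoothOnIcc a b (fun y => ρ y • D a b 1 T y) := ContDiffOn.smul hρ hT1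
  have hbase : IntervalIntegrable (fun x => ρ x * inner ℝ (deriv T x) (deriv T x)) volume a b := by
    refine intervalIntegrable_congr_Ioo h.le
      (f := fun x => ρ x * inner ℝ (D a b 1 T x) (D a b 1 T x)) (fun x hx => ?_) ?_
    · rw [h.smooth_T.deriv_eq hx]
    · exact ContinuousOn.intervalIntegrable_Icc' h.le
        (ContDiffOn.mul hρ (ContDiffOn.inner ℝ hT1 hT1)).continuousOn
  have h1 := hfam.hasDerivAt_integral hbase ht
  refine (h1.congr_deriv ?_).congr_of_eventuallyEq ?_
  · set u : ℝ → E3 := fun x => partialT τ (t, x) with hu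
    have hus : ContDiffOn ℝ ∞ u (Ioo a b) := h.smooth_partialT ht
    have hu0 : ∀ x ∈ Ioo a b, x ∉ Ioo c d → u x = 0 := fun x hx hx' =>
      h.partialT_eq_zero ht hx hx'
    have hgs : ContDiffOn ℝ ∞ (fun x => inner ℝ (ρ x • D a b 1 T x) (u x)) (Ioo a b) :=
      hρT.Ioo.inner ℝ hus
    have hg0 : ∀ x ∈ Ioo a b, x ∉ Ioo c d → inner ℝ (ρ x • D a b 1 T x) (u x) = 0 :=
      fun x hx hx' => by rw [hu0 x hx hx', inner_zero_right]
    have hGs : ContDiffOn ℝ ∞ (fun x => inner ℝ (D a b 1 (fun y => ρ y • D a b 1 T y) x) (u x))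
      (Ioo a b) := (hρT.D_one h.lt).Ioo.inner ℝ hus
    have hG0 : ∀ x ∈ Ioo a b, x ∉ Ioo c d →
        inner ℝ (D a b 1 (fun y => ρ y • D a b 1 T y) x) (u x) = 0 :=
      fun x hx hx' => by rw [hu0 x hx hx', inner_zero_right]
    -- Integration by parts in pointwise form: ρ⟨T', u'⟩ is an exact derivative minus ⟨(ρT')', u⟩,
    -- and the exact derivative of a compactly supported function integrates to zero.
    have key : ∀ x ∈ Ioo a b,
        deriv (fun s => ρ x * inner ℝ (partialX τ (s, x)) (partialX τ (s, x))) t =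
        2 * (deriv (fun x => inner ℝ (ρ x • D a b 1 T x) (u x)) x -
          inner ℝ (D a b 1 (fun y => ρ y • D a b 1 T y) x) (u x)) := by
      intro x hx
      have hm : (t, x) ∈ V ×ˢ Ioo a b := ⟨ht, hx⟩
      have e1 := hasDerivAt_partialT hO (h.smooth.partialX hO) hm
      rw [partialT_partialX hO h.smooth hm] at e1
      have e2 := hasDerivAt_partialX hO (h.smooth.partialT hO) hm
      have e3 := (e1.inner ℝ e1).const_mul (ρ x)
      have e4 := (hρT.hasDerivAt hx).inner ℝ e2
      rw [e3.deriv, e4.deriv]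
      have e5 : partialX τ (t, x) = D a b 1 T x := by
        rw [← h.D_one_eq ht hx]
        rw [D_one, D_one, derivWithin_of_mem_nhds (Icc_mem_nhds hx.1 hx.2),
          derivWithin_of_mem_nhds (Icc_mem_nhds hx.1 hx.2)]
        refine Filter.EventuallyEq.deriv_eq ?_
        filter_upwards [isOpen_Ioo.mem_nhds hx] with y hy using hτ y hy
      rw [e5, real_inner_comm (D a b 1 T x), real_inner_smul_left]
      ring
    rw [intervalIntegral_congr_Ioo h.le key, intervalIntegral.integral_const_mul,
      intervalIntegral.integral_sub
        (intervalIntegrable_deriv_of_support h.le h.lt_left h.lt_right hgs hg0)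
        (intervalIntegrable_of_support h.le h.lt_left h.lt_right hGs hG0),
      integral_deriv_of_support h.le h.lt_left h.lt_right hgs hg0]
    ring
  · filter_upwards [h.isOpen.mem_nhds ht] with s hs
    exact intervalIntegral_congr_Ioo h.le fun x hx => by simp only [h.D_one_eq hs hx]

/-- The connection form of the frame of `areaPotential v`, evaluated on a curve of unit vectors. -/
noncomputable def connectionForm (a b : ℝ) (v : E3) (T : ℝ → E3) (x : ℝ) : ℝ :=
  inner ℝ (areaPotential v (T x)) (D a b 1 T x)

theorem connectionForm_smooth (hab : a < b) (hT : SmoothOnIcc a b T) {v : E3}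
    (hv : ∀ x ∈ Icc a b, ‖v‖ ^ 2 - inner ℝ v (T x) ^ 2 ≠ 0) :
    SmoothOnIcc a b (connectionForm a b v T) :=
  (areaPotential_contDiffOn hT hv).inner ℝ (hT.D_one hab)

section

variable {P : Type} [NormedAddCommGroup P] [NormedSpace ℝ P] {V : Set P} {τ : P × ℝ → E3}

theorem IsTangentFamily.connection_family (h : IsTangentFamily a b c d T V τ) {v : E3}
    (hvT : ∀ x ∈ Icc a b, ‖v‖ ^ 2 - inner ℝ v (T x) ^ 2 ≠ 0)
    (hv : ∀ p ∈ V, ∀ x ∈ Icc a b, ‖v‖ ^ 2 - inner ℝ v (τ (p, x)) ^ 2 ≠ 0) :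
    IsFamilyRelEnds a b ((a + c) / 2) ((d + b) / 2)
      (fun x => inner ℝ (areaPotential v (T x)) (deriv T x)) V
      (fun q => inner ℝ (areaPotential v (τ q)) (partialX τ q)) :=
  { h.toIsFamilyRelEnds.partialX with
    smooth := (areaPotential_contDiffOn h.smooth fun q hq =>
      hv q.1 hq.1 q.2 (Ioo_subset_Icc_self hq.2)).inner ℝ h.toIsFamilyRelEnds.partialX.smooth
    smooth_base := (areaPotential_contDiffOn h.smooth_base fun x hx =>
      hvT x (Ioo_subset_Icc_self hx)).inner ℝ h.toIsFamilyRelEnds.partialX.smooth_base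
    eq_off := fun p hp x hx hx' => by
      simp only [h.toIsFamilyRelEnds.partialX.eq_off p hp x hx hx']
      rw [h.eq_off p hp x hx fun hc => hx' ⟨by linarith [hc.1, h.lt_left],
        by linarith [hc.2, h.lt_right]⟩] }

theorem IsTangentFamily.connection_integrable (h : IsTangentFamily a b c d T V τ) {v : E3}
    (hvT : ∀ x ∈ Icc a b, ‖v‖ ^ 2 - inner ℝ v (T x) ^ 2 ≠ 0) :
    IntervalIntegrable (fun x => inner ℝ (areaPotential v (T x)) (deriv T x)) volume a b :=
  intervalIntegrable_congr_Ioo h.le (f := connectionForm a b v T)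
    (fun x hx => by rw [connectionForm, h.smooth_T.deriv_eq hx])
    (ContinuousOn.intervalIntegrable_Icc' h.le
      (ContDiffOn.continuousOn (connectionForm_smooth h.lt h.smooth_T hvT)))

theorem IsTangentFamily.connection_integral_eq (h : IsTangentFamily a b c d T V τ) (v : E3)
    {p : P} (hp : p ∈ V) : ∫ x in a..b, connectionForm a b v (fun y => τ (p, y)) x =
      ∫ x in a..b, inner ℝ (areaPotential v (τ (p, x))) (partialX τ (p, x)) :=
  intervalIntegral_congr_Ioo h.le fun x hx => by rw [connectionForm, h.D_one_eq hp hx]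

theorem IsTangentFamily.contDiffOn_connection (h : IsTangentFamily a b c d T V τ) {v : E3}
    (hvT : ∀ x ∈ Icc a b, ‖v‖ ^ 2 - inner ℝ v (T x) ^ 2 ≠ 0)
    (hv : ∀ p ∈ V, ∀ x ∈ Icc a b, ‖v‖ ^ 2 - inner ℝ v (τ (p, x)) ^ 2 ≠ 0) :
    ContDiffOn ℝ ∞ (fun p => ∫ x in a..b, connectionForm a b v (fun y => τ (p, y)) x) V :=
  ((h.connection_family hvT hv).contDiffOn_integral (h.connection_integrable hvT)).congr
    fun _ hp => h.connection_integral_eq v hp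

end

/-- First variation of the total connection form. -/
theorem IsTangentFamily.hasDerivAt_connection (h : IsTangentFamily a b c d T V τ) {v : E3}
    (hvT : ∀ x ∈ Icc a b, ‖v‖ ^ 2 - inner ℝ v (T x) ^ 2 ≠ 0)
    (hv : ∀ p ∈ V, ∀ x ∈ Icc a b, ‖v‖ ^ 2 - inner ℝ v (τ (p, x)) ^ 2 ≠ 0) {t : ℝ} (ht : t ∈ V)
    (hτ : ∀ x ∈ Ioo a b, τ (t, x) = T x) :
    HasDerivAt (fun s => ∫ x in a..b, connectionForm a b v (fun y => τ (s, y)) x)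
      (∫ x in a..b, inner ℝ (cross (T x) (D a b 1 T x)) (partialT τ (t, x))) t := by
  have hO : IsOpen (V ×ˢ Ioo a b) := h.isOpen.prod isOpen_Ioo
  have h1 := (h.connection_family hvT hv).hasDerivAt_integral (h.connection_integrable hvT) ht
  refine (h1.congr_deriv ?_).congr_of_eventuallyEq ?_
  · set u : ℝ → E3 := fun x => partialT τ (t, x) with hu
    have hus : ContDiffOn ℝ ∞ u (Ioo a b) := h.smooth_partialT ht
    have hu0 : ∀ x ∈ Ioo a b, x ∉ Ioo c d → u x = 0 := fun x hx hx' =>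
      h.partialT_eq_zero ht hx hx'
    have hT1 : SmoothOnIcc a b (D a b 1 T) := h.smooth_T.D_one h.lt
    have hgs : ContDiffOn ℝ ∞ (fun x => inner ℝ (areaPotential v (T x)) (u x)) (Ioo a b) :=
      (areaPotential_contDiffOn h.smooth_base fun x hx =>
        hvT x (Ioo_subset_Icc_self hx)).inner ℝ hus
    have hg0 : ∀ x ∈ Ioo a b, x ∉ Ioo c d → inner ℝ (areaPotential v (T x)) (u x) = 0 :=
      fun x hx hx' => by rw [hu0 x hx hx', inner_zero_right]
    have hGs : ContDiffOn ℝ ∞ (fun x => inner ℝ (cross (T x) (D a b 1 T x)) (u x)) (Ioo a b) :=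
      (h.smooth_base.cross hT1.Ioo).inner ℝ hus
    have hG0 : ∀ x ∈ Ioo a b, x ∉ Ioo c d →
        inner ℝ (cross (T x) (D a b 1 T x)) (u x) = 0 :=
      fun x hx hx' => by rw [hu0 x hx hx', inner_zero_right]
    -- This is Cartan's formula for the potential: varying the integrand yields an exact derivative
    -- plus the exterior derivative evaluated on u and T', that is, the area form term.
    have key : ∀ x ∈ Ioo a b,
        deriv (fun s => inner ℝ (areaPotential v (τ (s, x))) (partialX τ (s, x))) t =
        deriv (fun x => inner ℝ (areaPotential v (T x)) (u x)) x +
          inner ℝ (cross (T x) (D a b 1 T x)) (u x) := by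
      intro x hx
      have hm : (t, x) ∈ V ×ˢ Ioo a b := ⟨ht, hx⟩
      have hxI := Ioo_subset_Icc_self hx
      have e1 := hasDerivAt_partialT hO (h.smooth.partialX hO) hm
      rw [partialT_partialX hO h.smooth hm] at e1
      have e2 := hasDerivAt_partialX hO (h.smooth.partialT hO) hm
      have e3 := (hasDerivAt_areaPotential (hasDerivAt_partialT hO h.smooth hm)
        (hv t ht x hxI)).inner ℝ e1
      have e4 := (hasDerivAt_areaPotential (h.smooth_T.hasDerivAt hx) (hvT x hxI)).inner ℝ e2
      rw [e3.deriv, e4.deriv]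
      have e5 : partialX τ (t, x) = D a b 1 T x := by
        rw [← h.D_one_eq ht hx]
        rw [D_one, D_one, derivWithin_of_mem_nhds (Icc_mem_nhds hx.1 hx.2),
          derivWithin_of_mem_nhds (Icc_mem_nhds hx.1 hx.2)]
        refine Filter.EventuallyEq.deriv_eq ?_
        filter_upwards [isOpen_Ioo.mem_nhds hx] with y hy using hτ y hy
      have hperp := h.inner_partialT ht hx
      have hperpX := h.inner_partialX ht hx
      rw [e5] at hperpX
      rw [hτ x hx] at hperp hperpX ⊢
      have hunit := h.unit t ht x hxI
      rw [hτ x hx] at hunit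
      have := areaPotentialDeriv_antisymm hunit hperp hperpX (hvT x hxI)
      rw [e5]
      linarith
    rw [intervalIntegral_congr_Ioo h.le key,
      intervalIntegral.integral_add
        (intervalIntegrable_deriv_of_support h.le h.lt_left h.lt_right hgs hg0)
        (intervalIntegrable_of_support h.le h.lt_left h.lt_right hGs hG0),
      integral_deriv_of_support h.le h.lt_left h.lt_right hgs hg0, zero_add]
  · filter_upwards [h.isOpen.mem_nhds ht] with s hs using h.connection_integral_eq v hs

end Variation

/-! ### The energy of a unit speed curve in terms of its tangent. -/

section UnitSpeed

variable {a b : ℝ} {η : ℝ → E3}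

theorem arcDeriv_eq_D {F : Type*} [NormedAddCommGroup F] [NormedSpace ℝ F]
    (hη : ∀ x ∈ Icc a b, ‖D a b 1 η x‖ = 1) (g : ℝ → F) :
    EqOn (arcDeriv a b η g) (D a b 1 g) (Icc a b) := fun x hx => by
  simp [arcDeriv, hη x hx]

theorem unitTangent_eq_D (hη : ∀ x ∈ Icc a b, ‖D a b 1 η x‖ = 1) :
    EqOn (unitTangent a b η) (D a b 1 η) (Icc a b) := arcDeriv_eq_D hη η

theorem bendingEnergy_eq (hab : a ≤ b) (ρ : ℝ → ℝ) (hη : ∀ x ∈ Icc a b, ‖D a b 1 η x‖ = 1)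
    {T : ℝ → E3} (hT : EqOn (D a b 1 η) T (Icc a b)) :
    bendingEnergy a b ρ η =
      (1 / 2) * ∫ x in a..b, ρ x * inner ℝ (D a b 1 T x) (D a b 1 T x) := by
  unfold bendingEnergy
  congr 1
  refine intervalIntegral_congr_Ioo hab fun x hx => ?_
  have hx' := Ioo_subset_Icc_self hx
  rw [hη x hx', mul_one, arcDeriv_eq_D hη _ hx',
    D_congr 1 ((unitTangent_eq_D hη).trans hT) hx']

end UnitSpeed

/-! ### Parallel transport and holonomy through the connection form of a frame. -/

section Frame

variable {a b : ℝ} {T N : ℝ → E3} {h : ℝ → ℝ} {x : ℝ}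

/-- `(T, N, T × N)` is an orthonormal frame with connection form `h = ⟨N', T × N⟩`. -/
structure IsAdaptedFrame (a b : ℝ) (T N : ℝ → E3) (h : ℝ → ℝ) : Prop where
  lt : a < b
  smooth_T : SmoothOnIcc a b T
  smooth_N : SmoothOnIcc a b N
  smooth_h : SmoothOnIcc a b h
  norm_T : ∀ x ∈ Icc a b, ‖T x‖ = 1
  norm_N : ∀ x ∈ Icc a b, ‖N x‖ = 1
  inner_TN : ∀ x ∈ Icc a b, inner ℝ (T x) (N x) = 0
  connection : ∀ x ∈ Icc a b, inner ℝ (D a b 1 N x) (cross (T x) (N x)) = h x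

theorem inner_D_eq_zero_of_norm {a b : ℝ} (hab : a < b) {N : ℝ → E3} (hN : SmoothOnIcc a b N)
    {r : ℝ} (hn : ∀ x ∈ Icc a b, ‖N x‖ = r) {x : ℝ} (hx : x ∈ Icc a b) :
    inner ℝ (D a b 1 N x) (N x) = 0 := by
  have h1 := (hN.hasDerivWithinAt hx).inner ℝ (hN.hasDerivWithinAt hx)
  have h2 : HasDerivWithinAt (fun x => inner ℝ (N x) (N x)) (0 : ℝ) (Icc a b) x :=
    (hasDerivWithinAt_const x _ (r ^ 2)).congr
      (fun y hy => by rw [real_inner_self_eq_norm_sq, hn y hy])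
      (by rw [real_inner_self_eq_norm_sq, hn x hx])
  have h3 := (uniqueDiffOn_Icc hab x hx).eq_deriv _ h1 h2
  rw [real_inner_comm] at h3
  linarith

theorem inner_D_add_eq_zero {a b : ℝ} (hab : a < b) {M N : ℝ → E3} (hM : SmoothOnIcc a b M)
    (hN : SmoothOnIcc a b N)
    {r : ℝ} (hn : ∀ x ∈ Icc a b, inner ℝ (M x) (N x) = r) {x : ℝ} (hx : x ∈ Icc a b) :
    inner ℝ (M x) (D a b 1 N x) + inner ℝ (D a b 1 M x) (N x) = 0 := by
  have h1 := (hM.hasDerivWithinAt hx).inner ℝ (hN.hasDerivWithinAt hx)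
  have h2 : HasDerivWithinAt (fun x => inner ℝ (M x) (N x)) (0 : ℝ) (Icc a b) x :=
    (hasDerivWithinAt_const x _ r).congr (fun y hy => hn y hy) (hn x hx)
  exact (uniqueDiffOn_Icc hab x hx).eq_deriv _ h1 h2

namespace IsAdaptedFrame

theorem smooth_B (F : IsAdaptedFrame a b T N h) : SmoothOnIcc a b (fun x => cross (T x) (N x)) :=
  ContDiffOn.cross F.smooth_T F.smooth_N

theorem norm_B (F : IsAdaptedFrame a b T N h) (hx : x ∈ Icc a b) : ‖cross (T x) (N x)‖ = 1 :=
  norm_cross_of_orthonormal (F.norm_T x hx) (F.norm_N x hx) (F.inner_TN x hx)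

theorem inner_DN_N (F : IsAdaptedFrame a b T N h) (hx : x ∈ Icc a b) :
    inner ℝ (D a b 1 N x) (N x) = 0 := inner_D_eq_zero_of_norm F.lt F.smooth_N F.norm_N hx

theorem inner_DB_B (F : IsAdaptedFrame a b T N h) (hx : x ∈ Icc a b) :
    inner ℝ (D a b 1 (fun x => cross (T x) (N x)) x) (cross (T x) (N x)) = 0 :=
  inner_D_eq_zero_of_norm F.lt F.smooth_B (fun _ hx => F.norm_B hx) hx

theorem inner_DB_N (F : IsAdaptedFrame a b T N h) (hx : x ∈ Icc a b) :
    inner ℝ (D a b 1 (fun x => cross (T x) (N x)) x) (N x) = -h x := by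
  have := inner_D_add_eq_zero F.lt F.smooth_B F.smooth_N
    (fun x _ => inner_cross_right (T x) (N x)) hx
  rw [real_inner_comm, F.connection x hx] at this
  linarith

/-- The frame turns at rate h in the normal plane. Rotating N back by an angle φ with φ' = -h leaves
a field whose derivative has no normal component. -/
theorem exists_parallel (F : IsAdaptedFrame a b T N h) {η : ℝ → E3}
    (hη : ∀ x ∈ Icc a b, unitTangent a b η x = T x) (φ₀ : ℝ) :
    ∃ Z : ℝ → E3, IsParallelNormalField a b η Z ∧
      Z a = Real.cos φ₀ • N a + Real.sin φ₀ • cross (T a) (N a) ∧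
      Z b = Real.cos (φ₀ - ∫ x in a..b, h x) • N b +
        Real.sin (φ₀ - ∫ x in a..b, h x) • cross (T b) (N b) := by
  obtain ⟨hs, hd⟩ := F.smooth_h.primitive F.lt
  set φ : ℝ → ℝ := fun x => φ₀ - ∫ y in a..x, h y with hφ
  have hφs : ContDiffOn ℝ ∞ φ (Icc a b) := contDiffOn_const.sub hs
  have hφd : ∀ x ∈ Icc a b, HasDerivWithinAt φ (-h x) (Icc a b) x := fun x hx =>
    (hd x hx).const_sub φ₀
  set Z : ℝ → E3 := fun x => Real.cos (φ x) • N x + Real.sin (φ x) • cross (T x) (N x) with hZ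
  have hZs : SmoothOnIcc a b Z :=
    ((Real.contDiff_cos.comp_contDiffOn hφs).smul F.smooth_N).add
      ((Real.contDiff_sin.comp_contDiffOn hφs).smul F.smooth_B)
  refine ⟨Z, ⟨hZs, fun x hx => ?_, fun x => inner ℝ (D a b 1 Z x) (T x), ?_, fun x hx => ?_⟩, ?_, ?_⟩
  · rw [hη x hx, inner_add_left, real_inner_smul_left, real_inner_smul_left, inner_cross_left,
      real_inner_comm, F.inner_TN x hx]
    simp
  · exact ContDiffOn.inner ℝ (hZs.D_one F.lt) F.smooth_T
  · rw [hη x hx]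
    have h1 := ((hφd x hx).cos.smul (F.smooth_N.hasDerivWithinAt hx)).add
      ((hφd x hx).sin.smul (F.smooth_B.hasDerivWithinAt hx))
    have h2 := h1.D_one_eq F.lt hx
    change D a b 1 Z x = _ at h2
    have hN : inner ℝ (D a b 1 Z x) (N x) = 0 := by
      rw [h2]
      simp only [inner_add_left, real_inner_smul_left, F.inner_DN_N hx, F.inner_DB_N hx,
        inner_cross_right, real_inner_self_eq_norm_sq, F.norm_N x hx]
      ring
    have hB : inner ℝ (D a b 1 Z x) (cross (T x) (N x)) = 0 := by
      rw [h2]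
      simp only [inner_add_left, real_inner_smul_left, F.connection x hx, F.inner_DB_B hx,
        real_inner_self_eq_norm_sq, F.norm_B hx]
      rw [real_inner_comm, inner_cross_right]
      ring
    have h3 := frame_expansion (F.norm_T x hx) (F.norm_N x hx) (F.inner_TN x hx) (D a b 1 Z x)
    rw [hN, hB, zero_smul, zero_smul, add_zero, add_zero] at h3
    exact h3
  · simp [hZ, hφ]
  · simp [hZ, hφ]

/-- This is uniqueness of parallel transport: the coefficients p = ⟨Z, N⟩ and q = ⟨Z, T × N⟩ satisfy
p' = hq and q' = -hp, so the pair becomes constant after a rotation by the primitive of h. -/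
theorem parallel_end (F : IsAdaptedFrame a b T N h) {η Z : ℝ → E3}
    (hη : ∀ x ∈ Icc a b, unitTangent a b η x = T x) (hZ : IsParallelNormalField a b η Z)
    (hZa : Z a = N a) :
    Real.cos (∫ x in a..b, h x) = inner ℝ (Z b) (N b) ∧
      Real.sin (∫ x in a..b, h x) = -inner ℝ (Z b) (cross (T b) (N b)) := by
  obtain ⟨hZs, hZT, lam, -, hlam⟩ := hZ
  obtain ⟨hs, hd⟩ := F.smooth_h.primitive F.lt
  set φ : ℝ → ℝ := fun x => ∫ y in a..x, h y with hφ
  have hφd : ∀ x ∈ Icc a b, HasDerivWithinAt φ (h x) (Icc a b) x := hd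
  set B : ℝ → E3 := fun x => cross (T x) (N x) with hB
  have hp : ∀ x ∈ Icc a b, HasDerivWithinAt (fun x => inner ℝ (Z x) (N x))
      (h x * inner ℝ (Z x) (B x)) (Icc a b) x := fun x hx => by
    refine ((hZs.hasDerivWithinAt hx).inner ℝ (F.smooth_N.hasDerivWithinAt hx)).congr_deriv ?_
    have hT := hZT x hx
    rw [hη x hx] at hT
    rw [hlam x hx, hη x hx, real_inner_smul_left, F.inner_TN x hx,
      frame_inner (F.norm_T x hx) (F.norm_N x hx) (F.inner_TN x hx) (Z x), hT,
      F.inner_DN_N hx, F.connection x hx]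
    ring
  have hq : ∀ x ∈ Icc a b, HasDerivWithinAt (fun x => inner ℝ (Z x) (B x))
      (-h x * inner ℝ (Z x) (N x)) (Icc a b) x := fun x hx => by
    refine ((hZs.hasDerivWithinAt hx).inner ℝ (F.smooth_B.hasDerivWithinAt hx)).congr_deriv ?_
    have hT := hZT x hx
    rw [hη x hx] at hT
    rw [hlam x hx, hη x hx, real_inner_smul_left, real_inner_comm _ (T x), inner_cross_left,
      frame_inner (F.norm_T x hx) (F.norm_N x hx) (F.inner_TN x hx) (Z x), hT,
      F.inner_DB_N hx, F.inner_DB_B hx]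
    ring
  have hab : a ≤ b := F.lt.le
  have ha : a ∈ Icc a b := left_mem_Icc.2 hab
  have hb : b ∈ Icc a b := right_mem_Icc.2 hab
  have e1 := eq_of_derivWithin_eq_zero (g := fun x => inner ℝ (Z x) (N x) * Real.cos (φ x) -
      inner ℝ (Z x) (B x) * Real.sin (φ x)) F.lt (fun x hx =>
      (((hp x hx).mul (hφd x hx).cos).sub ((hq x hx).mul (hφd x hx).sin)).congr_deriv
        (by ring)) hb
  have e2 := eq_of_derivWithin_eq_zero (g := fun x => inner ℝ (Z x) (N x) * Real.sin (φ x) +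
      inner ℝ (Z x) (B x) * Real.cos (φ x)) F.lt (fun x hx =>
      (((hp x hx).mul (hφd x hx).sin).add ((hq x hx).mul (hφd x hx).cos)).congr_deriv
        (by ring)) hb
  have hφa : φ a = 0 := by simp [hφ]
  simp only [hφa, hZa, real_inner_self_eq_norm_sq, F.norm_N a ha, Real.cos_zero,
    Real.sin_zero] at e1 e2
  have hNB : inner ℝ (N a) (B a) = 0 := by rw [real_inner_comm, hB, inner_cross_right]
  rw [hNB] at e1 e2
  have hcs := Real.sin_sq_add_cos_sq (φ b)
  change Real.cos (φ b) = _ ∧ Real.sin (φ b) = _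
  constructor
  · linear_combination (-Real.cos (φ b)) * e1 - Real.sin (φ b) * e2 +
      inner ℝ (Z b) (N b) * hcs
  · linear_combination (-Real.sin (φ b)) * e1 + Real.cos (φ b) * e2 -
      inner ℝ (Z b) (B b) * hcs

/-- A unit normal vector at a point is determined by an angle. -/
theorem exists_angle {t n w : E3} (ht : ‖t‖ = 1) (hn : ‖n‖ = 1) (htn : inner ℝ t n = 0)
    (hw : ‖w‖ = 1) (hwt : inner ℝ w t = 0) :
    ∃ φ : ℝ, w = Real.cos φ • n + Real.sin φ • cross t n := by
  have h1 := frame_expansion ht hn htn w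
  have h2 := frame_inner ht hn htn w w
  rw [hwt, real_inner_self_eq_norm_sq, hw] at h2
  rw [hwt, zero_smul, zero_add] at h1
  set p := inner ℝ w n
  set q := inner ℝ w (cross t n)
  have hz : ‖(⟨p, q⟩ : ℂ)‖ = 1 := by
    rw [Complex.norm_def, Complex.normSq_mk, Real.sqrt_eq_one]; linarith
  refine ⟨Complex.arg ⟨p, q⟩, ?_⟩
  have hc := Complex.norm_mul_cos_arg ⟨p, q⟩
  have hs := Complex.norm_mul_sin_arg ⟨p, q⟩
  rw [hz, one_mul] at hc hs
  rw [hc, hs]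
  exact h1

/-- The number α is the angle of `Wa` minus the angle of `Wb`, measured in the frame at the ends. It
depends on the end values only, so it serves all frames with the same end values, and only the
integral of the connection form varies. -/
theorem exists_hasHolonomy (F : IsAdaptedFrame a b T N h) {Wa Wb : E3} (hWa : ‖Wa‖ = 1)
    (hWb : ‖Wb‖ = 1) (hWaT : inner ℝ Wa (T a) = 0) (hWbT : inner ℝ Wb (T b) = 0) :
    ∃ α : ℝ, ∀ {T' N' : ℝ → E3} {h' : ℝ → ℝ} (_ : IsAdaptedFrame a b T' N' h') (η : ℝ → E3),
      (∀ x ∈ Icc a b, unitTangent a b η x = T' x) → T' a = T a → T' b = T b → N' a = N a →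
      N' b = N b → HasHolonomy a b η Wa Wb ((α - ∫ x in a..b, h' x : ℝ) : Real.Angle) := by
  have ha : a ∈ Icc a b := left_mem_Icc.2 F.lt.le
  have hb : b ∈ Icc a b := right_mem_Icc.2 F.lt.le
  obtain ⟨φ₀, hφ₀⟩ := exists_angle (F.norm_T a ha) (F.norm_N a ha) (F.inner_TN a ha) hWa hWaT
  obtain ⟨β, hβ⟩ := exists_angle (F.norm_T b hb) (F.norm_N b hb) (F.inner_TN b hb) hWb hWbT
  refine ⟨φ₀ - β, fun {T' N' h'} F' η hη hTa hTb hNa hNb => ?_⟩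
  obtain ⟨Z, hZ, hZa, hZb⟩ := F'.exists_parallel hη φ₀
  refine ⟨Z, hZ, ?_, ?_⟩
  · rw [hZa, hφ₀, hTa, hNa]
  · rw [hZb, hη b hb, hTb, hNb, Real.Angle.cos_coe, Real.Angle.sin_coe]
    set H := ∫ x in a..b, h' x
    have hTW : cross (T b) Wb = Real.cos β • cross (T b) (N b) - Real.sin β • N b := by
      rw [hβ, cross_add_right, cross_smul_right, cross_smul_right, cross_cross_eq,
        F.inner_TN b hb, real_inner_self_eq_norm_sq, F.norm_T b hb]
      module
    rw [hTW]
    have e : φ₀ - H = (φ₀ - β - H) + β := by ring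
    rw [e, Real.cos_add, Real.sin_add]
    conv_rhs => rw [hβ]
    module

end IsAdaptedFrame

/-- The normalized projection of `v` to the orthogonal complement of the unit vector `t`. -/
noncomputable def frameNormal (v t : E3) : E3 :=
  (Real.sqrt (‖v‖ ^ 2 - inner ℝ v t ^ 2))⁻¹ • (v - inner ℝ v t • t)

/-- With N = r(v - sT), s = ⟨v, T⟩, the product T × N is r T × v, which is orthogonal to v and to T.
Of N' only -rsT' is seen by it, and r² = 1/(|v|² - s²) turns the result into the potential evaluated
on T'. -/
theorem adaptedFrame_frameNormal (hab : a < b) (hT : SmoothOnIcc a b T)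
    (hunit : ∀ x ∈ Icc a b, ‖T x‖ = 1) {v : E3}
    (hv : ∀ x ∈ Icc a b, ‖v‖ ^ 2 - inner ℝ v (T x) ^ 2 ≠ 0) :
    IsAdaptedFrame a b T (fun x => frameNormal v (T x)) (connectionForm a b v T) := by
  have hpos : ∀ x ∈ Icc a b, 0 < ‖v‖ ^ 2 - inner ℝ v (T x) ^ 2 := fun x hx => by
    refine lt_of_le_of_ne ?_ (hv x hx).symm
    have h1 := abs_real_inner_le_norm v (T x)
    rw [hunit x hx, mul_one] at h1
    have := sq_le_sq' (abs_le.1 h1).1 (abs_le.1 h1).2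
    linarith
  set s : ℝ → ℝ := fun x => inner ℝ v (T x) with hs
  set r : ℝ → ℝ := fun x => (Real.sqrt (‖v‖ ^ 2 - s x ^ 2))⁻¹ with hr
  have hss : SmoothOnIcc a b s := ContDiffOn.inner ℝ contDiffOn_const hT
  have hrs : SmoothOnIcc a b r :=
    ((contDiffOn_const.sub (ContDiffOn.pow hss 2)).sqrt hv).inv
      fun x hx => (Real.sqrt_pos.2 (hpos x hx)).ne'
  have hr2 : ∀ x ∈ Icc a b, r x ^ 2 * (‖v‖ ^ 2 - s x ^ 2) = 1 := fun x hx => by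
    simp only [hr]
    rw [inv_pow, Real.sq_sqrt (hpos x hx).le, inv_mul_cancel₀ (hv x hx)]
  have hws : SmoothOnIcc a b (fun x => v - s x • T x) :=
    contDiffOn_const.sub (ContDiffOn.smul hss hT)
  have hNs : SmoothOnIcc a b (fun x => frameNormal v (T x)) := ContDiffOn.smul hrs hws
  have hTT : ∀ x ∈ Icc a b, inner ℝ (T x) (T x) = 1 := fun x hx => by
    rw [real_inner_self_eq_norm_sq, hunit x hx, one_pow]
  refine ⟨hab, hT, hNs, connectionForm_smooth hab hT hv, hunit, fun x hx => ?_, fun x hx => ?_,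
    fun x hx => ?_⟩
  · have h1 : ‖frameNormal v (T x)‖ ^ 2 = 1 := by
      rw [← real_inner_self_eq_norm_sq, ← hr2 x hx]
      change inner ℝ (r x • (v - s x • T x)) (r x • (v - s x • T x)) = _
      simp only [real_inner_smul_left, real_inner_smul_right, inner_sub_left, inner_sub_right,
        hTT x hx, real_inner_self_eq_norm_sq v, real_inner_comm v (T x)]
      simp only [hs]
      ring
    nlinarith [norm_nonneg (frameNormal v (T x))]
  · change inner ℝ (T x) (r x • (v - s x • T x)) = _
    simp only [real_inner_smul_right, inner_sub_right, hTT x hx, real_inner_comm v (T x)]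
    simp only [hs]
    ring
  · have h1 := (hrs.hasDerivWithinAt hx).smul (((hasDerivWithinAt_const x (Icc a b) v).sub
      ((hss.hasDerivWithinAt hx).smul (hT.hasDerivWithinAt hx))))
    have h2 := h1.D_one_eq hab hx
    change D a b 1 (fun x => frameNormal v (T x)) x = _ at h2
    have hB : cross (T x) (frameNormal v (T x)) = r x • cross (T x) v := by
      change cross (T x) (r x • (v - s x • T x)) = _
      rw [cross_smul_right, cross_sub_right, cross_smul_right, cross_self_eq_zero, smul_zero,
        sub_zero]
    rw [h2, hB, connectionForm, areaPotential]
    have o1 : inner ℝ v (cross (T x) v) = 0 := by rw [real_inner_comm, inner_cross_right]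
    have o2 : inner ℝ (T x) (cross (T x) v) = 0 := by rw [real_inner_comm, inner_cross_left]
    have o3 : inner ℝ (cross v (T x)) (D a b 1 T x) = -inner ℝ (D a b 1 T x) (cross (T x) v) := by
      rw [cross_comm_neg, inner_neg_left, real_inner_comm]
    have h3 : r x ^ 2 = 1 / (‖v‖ ^ 2 - s x ^ 2) := (eq_div_iff (hv x hx)).2 (hr2 x hx)
    change _ = inner ℝ ((s x / (‖v‖ ^ 2 - s x ^ 2)) • _) _
    clear_value r s
    simp only [inner_add_left, inner_sub_left, real_inner_smul_left, real_inner_smul_right,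
      Pi.sub_apply, Pi.smul_apply', o1, o2, o3, inner_zero_left]
    linear_combination (-s x * inner ℝ (D a b 1 T x) (cross (T x) v)) * h3

end Frame

/-! ### A vector nowhere parallel to the tangents. -/

section FrameVector

variable {a b : ℝ} {T : ℝ → E3}

/-- Some vector is nowhere parallel to a given smooth field of unit vectors. -/
theorem exists_frame_vector (hT : SmoothOnIcc a b T) (hunit : ∀ x ∈ Icc a b, ‖T x‖ = 1) :
    ∃ v : E3, ∀ x ∈ Icc a b, ‖v‖ ^ 2 - inner ℝ v (T x) ^ 2 ≠ 0 := by
  -- The lines spanned by the tangents form the C¹ image of a set of dimension at most two, so they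
  -- miss a dense set of vectors.
  have hs : ContDiffOn ℝ 1 (fun q : ℝ × ℝ => q.1 • T q.2) (univ ×ˢ Icc a b) :=
    contDiffOn_fst.smul ((ContDiffOn.of_le hT (by exact_mod_cast le_top)).comp contDiffOn_snd
      fun q hq => hq.2)
  have hd : Dense ((fun q : ℝ × ℝ => q.1 • T q.2) '' (univ ×ˢ Icc a b))ᶜ := by
    refine hs.dense_compl_image_of_dimH_lt_finrank (convex_univ.prod (convex_Icc a b)) Subset.rfl ?_
    calc dimH (univ ×ˢ Icc a b : Set (ℝ × ℝ)) ≤ dimH (univ : Set (ℝ × ℝ)) :=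
          dimH_mono (subset_univ _)
      _ = Module.finrank ℝ (ℝ × ℝ) := Real.dimH_univ_eq_finrank _
      _ < Module.finrank ℝ E3 := by simp; norm_num
  obtain ⟨v, hv⟩ := hd.nonempty
  refine ⟨v, fun x hx h => hv ⟨(inner ℝ v (T x), x), ⟨mem_univ _, hx⟩, ?_⟩⟩
  have h1 : ‖v - inner ℝ v (T x) • T x‖ ^ 2 = 0 := by
    rw [norm_sub_sq_real, real_inner_smul_right, norm_smul, hunit x hx, mul_one, Real.norm_eq_abs,
      sq_abs, ← h]
    ring
  have h2 := norm_eq_zero.1 (pow_eq_zero_iff two_ne_zero |>.1 h1)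
  exact (sub_eq_zero.1 h2).symm

variable {P : Type} [NormedAddCommGroup P] [NormedSpace ℝ P] {c d : ℝ} {V : Set P}
  {τ : P × ℝ → E3}

theorem IsTangentFamily.mono (h : IsTangentFamily a b c d T V τ) {V' : Set P} (hV' : IsOpen V')
    (hVV : V' ⊆ V) : IsTangentFamily a b c d T V' τ :=
  { h with
    isOpen := hV'
    smooth := h.smooth.mono (prod_mono_left hVV)
    eq_off := fun p hp => h.eq_off p (hVV hp)
    unit := fun p hp => h.unit p (hVV hp)
    eq_off_Icc := fun p hp => h.eq_off_Icc p (hVV hp) }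

/-- The condition on v is open, and uniformly so over the compact interval on which the family
moves; elsewhere the field is T. -/
theorem IsTangentFamily.eventually_frame_vector (h : IsTangentFamily a b c d T V τ) {v : E3}
    (hv : ∀ x ∈ Icc a b, ‖v‖ ^ 2 - inner ℝ v (T x) ^ 2 ≠ 0) {p : P} (hp : p ∈ V)
    (hτ : ∀ x ∈ Ioo a b, τ (p, x) = T x) :
    ∀ᶠ p' in 𝓝 p, ∀ x ∈ Icc a b, ‖v‖ ^ 2 - inner ℝ v (τ (p', x)) ^ 2 ≠ 0 := by
  have h1 : ∀ᶠ p' in 𝓝 p, ∀ x ∈ Icc c d, ‖v‖ ^ 2 - inner ℝ v (τ (p', x)) ^ 2 ≠ 0 := by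
    refine isCompact_Icc.eventually_forall_of_forall_eventually fun x hx => ?_
    have hx' : x ∈ Ioo a b := ⟨h.lt_left.trans_le hx.1, hx.2.trans_lt h.lt_right⟩
    have hm : V ×ˢ Ioo a b ∈ 𝓝 (p, x) := (h.isOpen.prod isOpen_Ioo).mem_nhds ⟨hp, hx'⟩
    have hc : ContinuousAt (fun q : P × ℝ => ‖v‖ ^ 2 - inner ℝ v (τ q) ^ 2) (p, x) :=
      continuousAt_const.sub ((ContinuousAt.inner continuousAt_const
        (h.smooth.continuousOn.continuousAt hm)).pow 2)
    refine hc.eventually_ne ?_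
    rw [hτ x hx']
    exact hv x (Ioo_subset_Icc_self hx')
  filter_upwards [h1, h.isOpen.mem_nhds hp] with p' hp' hV x hx
  by_cases hm : x ∈ Ioo c d
  · exact hp' x (Ioo_subset_Icc_self hm)
  · rw [h.eq_off_Icc p' hV x hx hm]
    exact hv x hx

end FrameVector

/-! ### Criticality in terms of tangent fields. -/

section Criticality

variable {a b : ℝ} {γ : ℝ → E3} {ρ : ℝ → ℝ}

/-- The weak gradient `(ρ T')'` of the bending energy with respect to the unit tangent. -/
noncomputable def tangentGradient (a b : ℝ) (ρ : ℝ → ℝ) (T : ℝ → E3) : ℝ → E3 :=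
  D a b 1 (fun y => ρ y • D a b 1 T y)

/-- The first variation of the bending energy vanishes along families of unit tangents which
preserve the end points of the curve and the total connection form. -/
theorem IsHolonomyConstrainedElastic.integral_eq_zero (hab : a < b)
    (hγ : IsArcLengthCurve a b γ) (hρ : SmoothOnIcc a b ρ)
    (hel : IsHolonomyConstrainedElastic a b ρ γ) {c d ε₀ : ℝ} (hε₀ : 0 < ε₀) {τ : ℝ × ℝ → E3}
    (h : IsTangentFamily a b c d (D a b 1 γ) (Ioo (-ε₀) ε₀) τ)
    (hτ : ∀ x ∈ Ioo a b, τ (0, x) = D a b 1 γ x) {v : E3}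
    (hvT : ∀ x ∈ Icc a b, ‖v‖ ^ 2 - inner ℝ v (D a b 1 γ x) ^ 2 ≠ 0)
    (hv : ∀ t ∈ Ioo (-ε₀) ε₀, ∀ x ∈ Icc a b, ‖v‖ ^ 2 - inner ℝ v (τ (t, x)) ^ 2 ≠ 0)
    (hclosed : ∀ t ∈ Ioo (-ε₀) ε₀, ∫ x in a..b, τ (t, x) = ∫ x in a..b, D a b 1 γ x)
    (hconn : ∀ t ∈ Ioo (-ε₀) ε₀, ∫ x in a..b, connectionForm a b v (fun y => τ (t, y)) x =
      ∫ x in a..b, connectionForm a b v (D a b 1 γ) x) :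
    ∫ x in a..b, inner ℝ (tangentGradient a b ρ (D a b 1 γ) x) (partialT τ (0, x)) = 0 := by
  set T := D a b 1 γ with hT
  have hTs : SmoothOnIcc a b T := h.smooth_T
  have ha : a ∈ Icc a b := left_mem_Icc.2 hab.le
  have hb : b ∈ Icc a b := right_mem_Icc.2 hab.le
  have hTi : IntervalIntegrable T volume a b :=
    ContinuousOn.intervalIntegrable_Icc' hab.le (ContDiffOn.continuousOn hTs)
  -- Variations live on a closed time interval, which has to fit into the open one of the family.
  set ε := ε₀ / 2 with hε
  have hεpos : 0 < ε := by positivity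
  have hsub : Icc (-ε) ε ⊆ Ioo (-ε₀) ε₀ := fun t ht =>
    ⟨by have := ht.1; linarith, by have := ht.2; linarith⟩
  set Δ : ℝ × ℝ → E3 :=
    fun q => (Ioo a b).indicator (fun x => τ (q.1, x) - T x) q.2 with hΔ
  have hΔs : ContDiffOn ℝ ∞ Δ (Ioo (-ε₀) ε₀ ×ˢ univ) := h.diff_contDiffOn
  have hΔc : ∀ t ∈ Ioo (-ε₀) ε₀, Continuous fun x => Δ (t, x) := fun t ht => h.diff_continuous ht
  have hΔi : ∀ t ∈ Ioo (-ε₀) ε₀, ∀ x y, IntervalIntegrable (fun x => Δ (t, x)) volume x y :=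
    fun t ht x y => (hΔc t ht).intervalIntegrable _ _
  have hΔ0 : ∀ t ∈ Ioo (-ε₀) ε₀, ∀ x, x ∉ Ioo c d → Δ (t, x) = 0 := fun t ht x hx => by
    simp only [hΔ]
    by_cases hm : x ∈ Ioo a b
    · rw [indicator_of_mem hm, h.eq_off t ht x hm hx, sub_self]
    · exact indicator_of_notMem hm _
  have hΔI : ∀ t ∈ Ioo (-ε₀) ε₀, ∫ x in a..b, Δ (t, x) = 0 := fun t ht => by
    have := h.integral_eq hTi ht
    rw [hclosed t ht] at this
    exact left_eq_add.1 this
  have hΔτ : ∀ t ∈ Ioo (-ε₀) ε₀, ∀ x ∈ Icc a b, T x + Δ (t, x) = τ (t, x) := fun t ht x hx => by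
    simp only [hΔ]
    by_cases hm : x ∈ Ioo a b
    · rw [indicator_of_mem hm]; simp
    · rw [indicator_of_notMem hm, add_zero]
      exact (h.eq_off_Icc t ht x hx fun hc =>
        hm ⟨h.lt_left.trans hc.1, hc.2.trans h.lt_right⟩).symm
  -- Integrating the change of tangent keeps the left end fixed; the closing condition below makes
  -- the right end stationary as well.
  set Γ : ℝ → ℝ → E3 := fun t x => γ x + ∫ y in a..x, Δ (t, y) with hΓ
  have hΓd : ∀ t ∈ Ioo (-ε₀) ε₀, EqOn (D a b 1 (Γ t)) (fun x => τ (t, x)) (Icc a b) := by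
    intro t ht x hx
    have h1 := (SmoothOnIcc.hasDerivWithinAt hγ.1.1 hx).add
      (intervalIntegral.integral_hasDerivAt_right (hΔi t ht a x)
        ((hΔc t ht).stronglyMeasurableAtFilter _ _) (hΔc t ht).continuousAt).hasDerivWithinAt
    exact (h1.D_one_eq hab hx).trans (hΔτ t ht x hx)
  have hΓu : ∀ t ∈ Ioo (-ε₀) ε₀, ∀ x ∈ Icc a b, ‖D a b 1 (Γ t) x‖ = 1 := fun t ht x hx => by
    rw [hΓd t ht hx]; exact h.unit t ht x hx
  have hΓT : ∀ t ∈ Ioo (-ε₀) ε₀, ∀ x ∈ Icc a b, unitTangent a b (Γ t) x = τ (t, x) :=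
    fun t ht x hx => (unitTangent_eq_D (hΓu t ht) hx).trans (hΓd t ht hx)
  have hca : a ∉ Ioo c d := fun hc => absurd hc.1 h.lt_left.not_gt
  have hcb : b ∉ Ioo c d := fun hc => absurd hc.2 h.lt_right.not_gt
  have hvar : IsSmoothVariation a b γ ε Γ := by
    refine ⟨hεpos, ?_, fun x hx => ?_⟩
    · refine ContDiffOn.add ?_ ?_
      · exact ContDiffOn.comp (g := γ) (f := fun q : ℝ × ℝ => q.2) hγ.1.1 contDiffOn_snd
          fun q hq => hq.2
      · exact (contDiffOn_primitive isOpen_Ioo a hΔs).mono (prod_mono hsub (subset_univ _))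
    · have h0 : (0 : ℝ) ∈ Ioo (-ε₀) ε₀ := ⟨by linarith, hε₀⟩
      have : ∀ y, Δ (0, y) = 0 := fun y => by
        simp only [hΔ]
        by_cases hm : y ∈ Ioo a b
        · rw [indicator_of_mem hm, hτ y hm, sub_self]
        · exact indicator_of_notMem hm _
      simp [hΓ, this]
  have hcpt : HasCompactInteriorSupport a b γ ε Γ := by
    refine ⟨min (c - a) (b - d), lt_min (by linarith [h.lt_left]) (by linarith [h.lt_right]),
      fun t ht x hx hx' => ?_⟩
    have ht' := hsub ht
    have key : ∫ y in a..x, Δ (t, y) = 0 := by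
      rcases hx' with hx' | hx'
      · have hxc : x ≤ c := by linarith [min_le_left (c - a) (b - d)]
        rw [intervalIntegral_congr_Ioo hx.1 (g := fun _ => 0) fun y hy =>
          hΔ0 t ht' y fun hc => absurd hc.1 (hy.2.trans_le hxc).not_gt]
        simp
      · have hxd : d ≤ x := by linarith [min_le_right (c - a) (b - d)]
        have h1 : ∫ y in x..b, Δ (t, y) = 0 := by
          rw [intervalIntegral_congr_Ioo hx.2 (g := fun _ => 0) fun y hy =>
            hΔ0 t ht' y fun hc => absurd hc.2 (hxd.trans_lt hy.1).not_gt]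
          simp
        have h2 := intervalIntegral.integral_add_adjacent_intervals (hΔi t ht' a x)
          (hΔi t ht' x b)
        rw [h1, add_zero, hΔI t ht'] at h2
        exact h2
    simp only [hΓ, key, add_zero]
  have harc : PreservesArcLength a b γ ε Γ := fun t ht x hx => by
    rw [hΓu t (hsub ht) x hx, hγ.2 x hx]
  have hTunit : ∀ x ∈ Icc a b, ‖T x‖ = 1 := hγ.2
  have hhol : PreservesHolonomy a b γ ε Γ := by
    rintro Wa Wb ⟨hWa, hWb, hWaT, hWbT⟩
    rw [unitTangent_eq_D hγ.2 ha] at hWaT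
    rw [unitTangent_eq_D hγ.2 hb] at hWbT
    obtain ⟨α, hα⟩ := (adaptedFrame_frameNormal hab hTs hTunit hvT).exists_hasHolonomy
      hWa hWb hWaT hWbT
    refine ⟨((α - ∫ x in a..b, connectionForm a b v T x : ℝ) : Real.Angle), fun t ht => ?_⟩
    have ht' := hsub ht
    have e1 := h.eq_off_Icc t ht' a ha hca
    have e2 := h.eq_off_Icc t ht' b hb hcb
    have := hα (adaptedFrame_frameNormal hab (h.smooth_slice ht') (h.unit t ht') (hv t ht'))
      (Γ t) (hΓT t ht') e1 e2 (by rw [e1]) (by rw [e2])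
    rwa [hconn t ht'] at this
  have hcrit := hel ε Γ hvar hcpt harc hhol
  have h0 : (0 : ℝ) ∈ Ioo (-ε₀) ε₀ := ⟨by linarith, hε₀⟩
  have hE := (h.hasDerivAt_energy hρ h0 hτ).const_mul (1 / 2)
  have hEq : (fun t => bendingEnergy a b ρ (Γ t)) =ᶠ[𝓝 0] fun s => 1 / 2 * ∫ x in a..b, ρ x *
      inner ℝ (D a b 1 (fun y => τ (s, y)) x) (D a b 1 (fun y => τ (s, y)) x) := by
    filter_upwards [isOpen_Ioo.mem_nhds h0] with t ht
    exact bendingEnergy_eq hab.le ρ (hΓu t ht) (hΓd t ht)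
  have := (hE.congr_of_eventuallyEq hEq).unique hcrit
  unfold tangentGradient
  linarith

/-- In the pairing with the variation field u, the constant W drops out because the end points are
fixed and so u has integral zero, the μ term because the holonomy is fixed, and the ν term because u
is orthogonal to T. -/
theorem isHolonomyConstrainedElastic_of_tangentGradient (hab : a < b)
    (hγ : IsArcLengthCurve a b γ) (hρ : SmoothOnIcc a b ρ) (W : E3) (μ : ℝ) (ν : ℝ → ℝ)
    (hG : ∀ x ∈ Ioo a b, tangentGradient a b ρ (D a b 1 γ) x =
      W + μ • cross (D a b 1 γ x) (D a b 1 (D a b 1 γ) x) + ν x • D a b 1 γ x) :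
    IsHolonomyConstrainedElastic a b ρ γ := by
  rintro ε Γ ⟨hε, hΓs, hΓ0⟩ ⟨δ, hδ, hΓδ⟩ harc hhol
  set T := D a b 1 γ with hT
  have hTs : SmoothOnIcc a b T := SmoothOnIcc.D_one hab hγ.1.1
  have hTunit : ∀ x ∈ Icc a b, ‖T x‖ = 1 := hγ.2
  have ha : a ∈ Icc a b := left_mem_Icc.2 hab.le
  have hb : b ∈ Icc a b := right_mem_Icc.2 hab.le
  have h0ε : (0 : ℝ) ∈ Ioo (-ε) ε := ⟨by linarith, hε⟩
  have hsub : Ioo (-ε) ε ⊆ Icc (-ε) ε := Ioo_subset_Icc_self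
  have hO : IsOpen (Ioo (-ε) ε ×ˢ Ioo a b) := isOpen_Ioo.prod isOpen_Ioo
  set Γ' : ℝ × ℝ → E3 := fun p => Γ p.1 p.2 with hΓ'
  have hΓs' : ContDiffOn ℝ ∞ Γ' (Ioo (-ε) ε ×ˢ Ioo a b) :=
    hΓs.mono (prod_mono hsub Ioo_subset_Icc_self)
  have hΓslice : ∀ t ∈ Ioo (-ε) ε, SmoothOnIcc a b (Γ t) := fun t ht =>
    ContDiffOn.comp (g := fun p : ℝ × ℝ => Γ p.1 p.2) (f := fun x : ℝ => (t, x)) hΓs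
      (ContDiff.contDiffOn (by fun_prop)) fun x hx => ⟨hsub ht, hx⟩
  set τ : ℝ × ℝ → E3 := fun q => D a b 1 (Γ q.1) q.2 with hτ
  have hτX : ∀ q ∈ Ioo (-ε) ε ×ˢ Ioo a b, τ q = partialX Γ' q := fun q hq => by
    simp only [hτ]
    rw [← (hΓslice q.1 hq.1).deriv_eq hq.2]
    exact (hasDerivAt_partialX hO hΓs' (show (q.1, q.2) ∈ _ from hq)).deriv
  have hτoff : ∀ t ∈ Ioo (-ε) ε, ∀ x ∈ Icc a b, x ∉ Ioo (a + δ / 2) (b - δ / 2) →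
      τ (t, x) = T x := by
    intro t ht x hx hx'
    -- The support interval begins at δ/2 rather than δ, so that the curves agree on a neighbourhood
    -- of x and their derivatives can be compared.
    have hx2 : x < a + δ ∨ b - δ < x := by
      by_contra! hc
      exact hx' ⟨by linarith [hc.1], by linarith [hc.2]⟩
    simp only [hτ, hT, D_one]
    refine Filter.EventuallyEq.derivWithin_eq ?_ (hΓδ t (hsub ht) x hx (hx2.imp le_of_lt le_of_lt))
    rcases hx2 with hx2 | hx2
    · filter_upwards [self_mem_nhdsWithin, mem_nhdsWithin_of_mem_nhds (isOpen_Iio.mem_nhds hx2)]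
        with y hy hy' using hΓδ t (hsub ht) y hy (Or.inl (le_of_lt hy'))
    · filter_upwards [self_mem_nhdsWithin, mem_nhdsWithin_of_mem_nhds (isOpen_Ioi.mem_nhds hx2)]
        with y hy hy' using hΓδ t (hsub ht) y hy (Or.inr (le_of_lt hy'))
  have hΓu : ∀ t ∈ Ioo (-ε) ε, ∀ x ∈ Icc a b, ‖D a b 1 (Γ t) x‖ = 1 := fun t ht x hx => by
    rw [harc t (hsub ht) x hx]; exact hTunit x hx
  have hfam : IsTangentFamily a b (a + δ / 2) (b - δ / 2) T (Ioo (-ε) ε) τ :=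
    { isOpen := isOpen_Ioo
      lt_left := by linarith
      lt_right := by linarith
      le := hab.le
      smooth := (hΓs'.partialX hO).congr hτX
      smooth_base := hTs.Ioo
      eq_off := fun t ht x hx => hτoff t ht x (Ioo_subset_Icc_self hx)
      lt := hab
      smooth_T := hTs
      unit := hΓu
      eq_off_Icc := hτoff }
  have hτ0 : ∀ x ∈ Ioo a b, τ (0, x) = T x := fun x hx =>
    D_congr 1 (fun y hy => hΓ0 y hy) (Ioo_subset_Icc_self hx)
  obtain ⟨v, hv⟩ := exists_frame_vector hTs hTunit
  obtain ⟨V', hV'sub, hV'o, h0V'⟩ := eventually_nhds_iff.1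
    ((hfam.eventually_frame_vector hv h0ε hτ0).and (isOpen_Ioo.mem_nhds h0ε))
  have hfam' : IsTangentFamily a b (a + δ / 2) (b - δ / 2) T V' τ :=
    hfam.mono hV'o fun t ht => (hV'sub t ht).2
  have hTi : IntervalIntegrable T volume a b :=
    ContinuousOn.intervalIntegrable_Icc' hab.le (ContDiffOn.continuousOn hTs)
  set u : ℝ → E3 := fun x => partialT τ (0, x) with hu
  have hus : ContDiffOn ℝ ∞ u (Ioo a b) := hfam.smooth_partialT h0ε
  have hu0 : ∀ x ∈ Ioo a b, x ∉ Ioo (a + δ / 2) (b - δ / 2) → u x = 0 := fun x hx hx' =>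
    hfam.partialT_eq_zero h0ε hx hx'
  have hui : IntervalIntegrable u volume a b :=
    intervalIntegrable_of_support hab.le hfam.lt_left hfam.lt_right hus hu0
  have hu_int : ∫ x in a..b, u x = 0 := by
    have h1 := hfam.hasDerivAt_integral hTi h0ε
    have h2 : (fun t => ∫ x in a..b, τ (t, x)) =ᶠ[𝓝 0] fun _ => γ b - γ a := by
      filter_upwards [isOpen_Ioo.mem_nhds h0ε] with t ht
      have hs := (hfam.smooth_slice ht)
      rw [intervalIntegral.integral_eq_sub_of_hasDerivAt_of_le hab.le
        (ContDiffOn.continuousOn (hΓslice t ht)) (fun x hx => (hΓslice t ht).hasDerivAt hx)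
        (ContinuousOn.intervalIntegrable_Icc' hab.le (ContDiffOn.continuousOn hs)),
        hΓδ t (hsub ht) a ha (Or.inl (by linarith)), hΓδ t (hsub ht) b hb (Or.inr (by linarith))]
    have h3 := h1.unique ((hasDerivAt_const (0 : ℝ) (γ b - γ a)).congr_of_eventuallyEq h2)
    rw [← h3]
    exact intervalIntegral_congr_Ioo hab.le fun x hx => (hasDerivAt_partialT hO hfam.smooth
      (show ((0 : ℝ), x) ∈ _ from ⟨h0ε, hx⟩)).deriv.symm
  have hconn : ∫ x in a..b, inner ℝ (cross (T x) (D a b 1 T x)) (u x) = 0 := by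
    have h1 := hfam'.hasDerivAt_connection hv (fun t ht => (hV'sub t ht).1) h0V' hτ0
    set H : ℝ → ℝ := fun s => ∫ x in a..b, connectionForm a b v (fun y => τ (s, y)) x with hH
    set F := adaptedFrame_frameNormal hab hTs hTunit hv
    obtain ⟨θ, hθ⟩ := hhol (frameNormal v (T a)) (frameNormal v (T b)) ⟨F.norm_N a ha,
      F.norm_N b hb, by rw [unitTangent_eq_D hγ.2 ha, real_inner_comm]; exact F.inner_TN a ha,
      by rw [unitTangent_eq_D hγ.2 hb, real_inner_comm]; exact F.inner_TN b hb⟩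
    set w := θ.cos • frameNormal v (T b) + θ.sin • cross (T b) (frameNormal v (T b)) with hw
    -- The holonomy determines H modulo 2π only, so its cosine and sine are shown to be constant.
    -- Differentiating both and using cos² + sin² = 1 gives H'(0) = 0 without choosing a branch.
    have key : ∀ t ∈ V', Real.cos (H t) = inner ℝ w (frameNormal v (T b)) ∧
        Real.sin (H t) = -inner ℝ w (cross (T b) (frameNormal v (T b))) := by
      intro t ht
      have ht' := (hV'sub t ht).2
      have hta : τ (t, a) = T a := hτoff t ht' a ha fun hc => by linarith [hc.1]
      have htb : τ (t, b) = T b := hτoff t ht' b hb fun hc => by linarith [hc.2]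
      have hηt : ∀ x ∈ Icc a b, unitTangent a b (Γ t) x = τ (t, x) := fun x hx =>
        unitTangent_eq_D (hΓu t ht') hx
      obtain ⟨Z, hZ, hZa, hZb⟩ := hθ t (hsub ht')
      have := (adaptedFrame_frameNormal hab (hfam.smooth_slice ht') (hfam.unit t ht')
        (hV'sub t ht).1).parallel_end hηt hZ (by rw [hZa, hta])
      simp only [htb] at this
      rw [hηt b hb, htb] at hZb
      rw [hZb] at this
      exact this
    have hc : (fun t => Real.cos (H t)) =ᶠ[𝓝 0] fun _ => inner ℝ w (frameNormal v (T b)) := by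
      filter_upwards [hV'o.mem_nhds h0V'] with t ht using (key t ht).1
    have hs : (fun t => Real.sin (H t)) =ᶠ[𝓝 0]
        fun _ => -inner ℝ w (cross (T b) (frameNormal v (T b))) := by
      filter_upwards [hV'o.mem_nhds h0V'] with t ht using (key t ht).2
    have e1 := h1.cos.unique ((hasDerivAt_const (0 : ℝ) _).congr_of_eventuallyEq hc)
    have e2 := h1.sin.unique ((hasDerivAt_const (0 : ℝ) _).congr_of_eventuallyEq hs)
    have e3 := Real.sin_sq_add_cos_sq (H 0)
    change _ = (0 : ℝ)
    linear_combination (-Real.sin (H 0)) * e1 + Real.cos (H 0) * e2 - (∫ x in a..b, inner ℝ (cross (T x) (D a b 1 T x)) (partialT τ (0, x))) * e3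
  have hG0 : ∫ x in a..b, inner ℝ (tangentGradient a b ρ T x) (u x) = 0 := by
    have hT1 : SmoothOnIcc a b (D a b 1 T) := hTs.D_one hab
    have i1 : IntervalIntegrable (fun x => inner ℝ W (u x)) volume a b :=
      intervalIntegrable_of_support hab.le hfam.lt_left hfam.lt_right
        (contDiffOn_const.inner ℝ hus) fun x hx hx' => by rw [hu0 x hx hx', inner_zero_right]
    have i2 : IntervalIntegrable (fun x => μ * inner ℝ (cross (T x) (D a b 1 T x)) (u x))
        volume a b :=
      intervalIntegrable_of_support hab.le hfam.lt_left hfam.lt_right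
        (contDiffOn_const.mul ((hTs.Ioo.cross hT1.Ioo).inner ℝ hus))
        fun x hx hx' => by rw [hu0 x hx hx', inner_zero_right, mul_zero]
    rw [intervalIntegral_congr_Ioo hab.le (g := fun x => inner ℝ W (u x) +
      μ * inner ℝ (cross (T x) (D a b 1 T x)) (u x)) fun x hx => ?_,
      intervalIntegral.integral_add i1 i2, intervalIntegral.integral_const_mul, hconn, mul_zero,
      add_zero]
    · have := (innerSL ℝ W).intervalIntegral_comp_comm hui
      rw [hu_int] at this
      simpa using this
    · have hp := hfam.inner_partialT h0ε hx
      rw [hτ0 x hx] at hp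
      rw [hG x hx, inner_add_left, inner_add_left, real_inner_smul_left, real_inner_smul_left]
      change _ + ν x * inner ℝ (T x) (partialT τ (0, x)) = _
      rw [hp]
      ring
  have hE := (hfam.hasDerivAt_energy hρ h0ε hτ0).const_mul (1 / 2)
  change HasDerivAt _ (1 / 2 * (-2 * ∫ x in a..b, inner ℝ (tangentGradient a b ρ T x) (u x))) 0
    at hE
  rw [hG0, mul_zero, mul_zero] at hE
  refine hE.congr_of_eventuallyEq ?_
  filter_upwards [isOpen_Ioo.mem_nhds h0ε] with t ht
  exact bendingEnergy_eq hab.le ρ (hΓu t ht) fun x _ => rfl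

end Criticality

/-! ### Curves inside level sets. -/

section ImplicitFunction

variable {ι : Type} [Fintype ι] [DecidableEq ι]

/-- A one-parameter curve inside a level set of a smooth map, tangent to the first axis. -/
theorem exists_curve_in_level {W : Set (ℝ × (ι → ℝ))} (hW : IsOpen W)
    (h0 : (0 : ℝ × (ι → ℝ)) ∈ W) {f : ℝ × (ι → ℝ) → ι → ℝ} (hf : ContDiffOn ℝ ∞ f W)
    (hs : HasDerivAt (fun s : ℝ => f (s, 0)) 0 0)
    (hr : ∀ j, HasDerivAt (fun s : ℝ => f (0, Pi.single j s)) (Pi.single j 1) 0) :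
    ∃ ε > 0, ∃ r : ℝ → ι → ℝ, ContDiffOn ℝ ∞ r (Ioo (-ε) ε) ∧ r 0 = 0 ∧ HasDerivAt r 0 0 ∧
      ∀ t ∈ Ioo (-ε) ε, (t, r t) ∈ W ∧ f (t, r t) = f 0 := by
  have hat : ∀ p ∈ W, ContDiffAt ℝ ∞ f p := fun p hp => hf.contDiffAt (hW.mem_nhds hp)
  have hfd : HasFDerivAt f (fderiv ℝ f 0) 0 := ((hat 0 h0).differentiableAt (by simp)).hasFDerivAt
  have hsf : fderiv ℝ f 0 (1, 0) = 0 := by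
    have h1 : HasDerivAt (fun s : ℝ => ((s, 0) : ℝ × (ι → ℝ))) (1, 0) 0 :=
      (hasDerivAt_id (0 : ℝ)).prodMk (hasDerivAt_const _ _)
    exact (HasFDerivAt.comp_hasDerivAt (0 : ℝ) hfd h1).unique hs
  -- The hypothesis on the coordinate lines says that the partial derivative in the second factor is
  -- the identity.
  have hrf : fderiv ℝ f 0 ∘L .inr ℝ ℝ (ι → ℝ) = ContinuousLinearMap.id ℝ (ι → ℝ) := by
    have hb : ∀ j, fderiv ℝ f 0 (0, Pi.single j 1) = Pi.single j 1 := fun j => by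
      have h2 : HasDerivAt (fun s : ℝ => (Pi.single j s : ι → ℝ)) (Pi.single j 1) 0 := by
        rw [hasDerivAt_pi]
        intro i
        by_cases hij : i = j
        · subst hij; simpa using hasDerivAt_id' (0 : ℝ)
        · simpa [hij] using hasDerivAt_const (0 : ℝ) (0 : ℝ)
      have h1 : HasDerivAt (fun s : ℝ => ((0, Pi.single j s) : ℝ × (ι → ℝ)))
          (0, Pi.single j 1) 0 := (hasDerivAt_const _ _).prodMk h2
      have hfd' : HasFDerivAt f (fderiv ℝ f 0) (0, Pi.single j (0 : ℝ)) := by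
        rwa [Pi.single_zero]
      exact (HasFDerivAt.comp_hasDerivAt (0 : ℝ) hfd' h1).unique (hr j)
    apply ContinuousLinearMap.coe_injective
    refine (Pi.basisFun ℝ ι).ext fun j => ?_
    simpa using hb j
  have hinv : (fderiv ℝ f 0 ∘L .inr ℝ ℝ (ι → ℝ)).IsInvertible := by
    rw [hrf]; exact ContinuousLinearMap.isInvertible_equiv (f := ContinuousLinearEquiv.refl ℝ _)
  have hn : (∞ : WithTop ℕ∞) ≠ 0 := by simp
  set r := (hat 0 h0).implicitFunction hn hinv with hrdef
  have hr0 : r 0 = 0 := (hat 0 h0).implicitFunction_apply_self hn hinv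
  have hrd : HasDerivAt r 0 0 := by
    have := ((hat 0 h0).hasStrictFDerivAt_implicitFunction hn hinv).hasFDerivAt.hasDerivAt
    refine this.congr_deriv ?_
    simp [hsf]
  have hrc : ContDiffAt ℝ ∞ r 0 := (hat 0 h0).contDiffAt_implicitFunction hn hinv
  have hrc1 : ∀ᶠ t in 𝓝 (0 : ℝ), ContinuousAt r t :=
    ((hrc.of_le (m := 1) (by exact_mod_cast le_top)).eventually (by simp)).mono
      fun t ht => ht.continuousAt
  have hlev : ∀ᶠ t in 𝓝 (0 : ℝ), f (t, r t) = f 0 :=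
    (hat 0 h0).eventually_apply_implicitFunction hn hinv
  have hpair : ContinuousAt (fun t => (t, r t)) 0 :=
    continuousAt_id.prodMk hrc.continuousAt
  have hp0 : ((0 : ℝ), r 0) = 0 := by rw [hr0]; rfl
  have hW' : ∀ᶠ t in 𝓝 (0 : ℝ), (t, r t) ∈ W :=
    hpair.eventually (hW.mem_nhds (show ((0 : ℝ), r 0) ∈ W by rw [hp0]; exact h0))
  -- Smoothness at 0 alone gives a neighbourhood depending on the order of differentiation. To get
  -- all orders on one interval, invertibility is propagated to nearby t, the implicit function
  -- theorem is applied again at each (t, r t), and its uniqueness clause identifies the two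
  -- solutions.
  have hinv' : ∀ᶠ t in 𝓝 (0 : ℝ), (fderiv ℝ f (t, r t) ∘L .inr ℝ ℝ (ι → ℝ)).IsInvertible := by
    have hc : ContinuousAt (fun t => fderiv ℝ f (t, r t) ∘L .inr ℝ ℝ (ι → ℝ)) 0 := by
      have h1 : ContinuousAt (fderiv ℝ f) ((0 : ℝ), r 0) := by
        rw [hp0]
        exact (hf.continuousOn_fderiv_of_isOpen hW (by simp)).continuousAt (hW.mem_nhds h0)
      have h2 : ContinuousAt (fun t => fderiv ℝ f (t, r t)) 0 :=
        ContinuousAt.comp (f := fun t => (t, r t)) h1 hpair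
      exact h2.clm_comp continuousAt_const
    have hO : range ((↑) : ((ι → ℝ) ≃L[ℝ] (ι → ℝ)) → (ι → ℝ) →L[ℝ] (ι → ℝ)) ∈
        𝓝 (fderiv ℝ f ((0 : ℝ), r 0) ∘L .inr ℝ ℝ (ι → ℝ)) := by
      refine ContinuousLinearEquiv.isOpen.mem_nhds ?_
      rw [hp0]; exact hinv
    exact hc.eventually hO
  obtain ⟨ε, hε, hball⟩ := Metric.eventually_nhds_iff_ball.1
    (hrc1.and (hlev.and (hW'.and hinv')))
  rw [Real.ball_eq_Ioo, zero_sub, zero_add] at hball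
  refine ⟨ε, hε, r, fun t ht => ContDiffAt.contDiffWithinAt ?_, hr0, hrd,
    fun t ht => ⟨(hball t ht).2.2.1, (hball t ht).2.1⟩⟩
  obtain ⟨htc, htl, htW, hti⟩ := hball t ht
  have huniq := (hat _ htW).eventually_apply_eq_iff_implicitFunction hn hti
  have hpt : ContinuousAt (fun t => (t, r t)) t := continuousAt_id.prodMk htc
  refine ((hat _ htW).contDiffAt_implicitFunction hn hti).congr_of_eventuallyEq ?_
  filter_upwards [hpt.eventually huniq, isOpen_Ioo.mem_nhds ht] with s hs hs'
  exact (hs.1 (by rw [(hball s hs').2.1, htl])).symm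

end ImplicitFunction

/-! ### Admissible variations from level sets of the constraints. -/

section LevelCurve

theorem IsTangentFamily.comp {P Q : Type} [NormedAddCommGroup P] [NormedSpace ℝ P]
    [NormedAddCommGroup Q] [NormedSpace ℝ Q] {a b c d : ℝ} {T : ℝ → E3} {V : Set P}
    {τ : P × ℝ → E3} (h : IsTangentFamily a b c d T V τ) {V' : Set Q} (hV' : IsOpen V')
    {r : Q → P} (hr : ContDiffOn ℝ ∞ r V') (hrV : ∀ q ∈ V', r q ∈ V) :
    IsTangentFamily a b c d T V' (fun q : Q × ℝ => τ (r q.1, q.2)) := by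
  have h1 : ContDiffOn ℝ ∞ (fun q : Q × ℝ => τ (r q.1, q.2)) (V' ×ˢ Ioo a b) := by
    have h3 : ContDiffOn ℝ ∞ (fun q : Q × ℝ => r q.1) (V' ×ˢ Ioo a b) :=
      hr.comp contDiffOn_fst fun q hq => hq.1
    have h2 : ContDiffOn ℝ ∞ (fun q : Q × ℝ => (r q.1, q.2)) (V' ×ˢ Ioo a b) :=
      h3.prodMk contDiffOn_snd
    exact h.smooth.comp h2 fun q hq => ⟨hrV q.1 hq.1, hq.2⟩
  have h2 : ∀ t ∈ V', ∀ x ∈ Ioo a b, x ∉ Ioo c d → τ (r t, x) = T x :=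
    fun t ht => h.eq_off _ (hrV t ht)
  have h3 : ∀ t ∈ V', ∀ x ∈ Icc a b, ‖τ (r t, x)‖ = 1 := fun t ht => h.unit _ (hrV t ht)
  have h4 : ∀ t ∈ V', ∀ x ∈ Icc a b, x ∉ Ioo c d → τ (r t, x) = T x :=
    fun t ht => h.eq_off_Icc _ (hrV t ht)
  exact ⟨⟨hV', h.lt_left, h.lt_right, h.le, h1, h.smooth_base, h2⟩, h.lt, h.smooth_T, h3, h4⟩

/-- Curves tangent to the first axis give the partial derivative in the first direction. -/
theorem hasDerivAt_comp_tangent_curve {E G : Type} [NormedAddCommGroup E] [NormedSpace ℝ E]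
    [NormedAddCommGroup G] [NormedSpace ℝ G] {τ : (ℝ × E) × ℝ → G} {x : ℝ}
    (hτ : DifferentiableAt ℝ τ ((0, 0), x)) {r : ℝ → E} (hr0 : r 0 = 0) (hr : HasDerivAt r 0 0) :
    HasDerivAt (fun s => τ ((s, r s), x)) (deriv (fun s => τ ((s, 0), x)) 0) 0 := by
  have key : ∀ q : ℝ → E, q 0 = 0 → HasDerivAt q 0 0 →
      HasDerivAt (fun s => τ ((s, q s), x)) (fderiv ℝ τ ((0, 0), x) ((1, 0), 0)) 0 := by
    intro q hq0 hq
    have c2 : HasDerivAt (fun s : ℝ => (((s, q s), x) : (ℝ × E) × ℝ)) ((1, 0), 0) 0 :=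
      ((hasDerivAt_id (0 : ℝ)).prodMk hq).prodMk (hasDerivAt_const _ _)
    have h1 : HasFDerivAt τ (fderiv ℝ τ ((0, 0), x)) ((0, q 0), x) := by
      rw [hq0]; exact hτ.hasFDerivAt
    exact HasFDerivAt.comp_hasDerivAt (0 : ℝ) h1 c2
  rw [(key (fun _ => 0) rfl (hasDerivAt_const _ _)).deriv]
  exact key r hr0 hr

variable {ι : Type} [Fintype ι] [DecidableEq ι] {a b : ℝ} {γ : ℝ → E3} {ρ : ℝ → ℝ}

/-- The first variation of the bending energy vanishes in the first direction of a family which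
satisfies the constraints on the level set of a submersion, to first order constant in this
direction. -/
theorem IsHolonomyConstrainedElastic.integral_eq_zero_of_level (hab : a < b)
    (hγ : IsArcLengthCurve a b γ) (hρ : SmoothOnIcc a b ρ)
    (hel : IsHolonomyConstrainedElastic a b ρ γ) {c d : ℝ} {W : Set (ℝ × (ι → ℝ))}
    {τ : (ℝ × (ι → ℝ)) × ℝ → E3} (h : IsTangentFamily a b c d (D a b 1 γ) W τ)
    (h0 : (0 : ℝ × (ι → ℝ)) ∈ W)
    (hτ : ∀ x ∈ Ioo a b, τ (0, x) = D a b 1 γ x) {v : E3}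
    (hvT : ∀ x ∈ Icc a b, ‖v‖ ^ 2 - inner ℝ v (D a b 1 γ x) ^ 2 ≠ 0)
    (hv : ∀ p ∈ W, ∀ x ∈ Icc a b, ‖v‖ ^ 2 - inner ℝ v (τ (p, x)) ^ 2 ≠ 0)
    {f : ℝ × (ι → ℝ) → ι → ℝ} (hf : ContDiffOn ℝ ∞ f W)
    (hs : HasDerivAt (fun s : ℝ => f (s, 0)) 0 0)
    (hr : ∀ j, HasDerivAt (fun s : ℝ => f (0, Pi.single j s)) (Pi.single j 1) 0)
    (hclosed : ∀ p ∈ W, f p = f 0 → ∫ x in a..b, τ (p, x) = ∫ x in a..b, D a b 1 γ x)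
    (hconn : ∀ p ∈ W, f p = f 0 → ∫ x in a..b, connectionForm a b v (fun y => τ (p, y)) x =
      ∫ x in a..b, connectionForm a b v (D a b 1 γ) x) :
    ∫ x in a..b, inner ℝ (tangentGradient a b ρ (D a b 1 γ) x)
      (deriv (fun s : ℝ => τ ((s, 0), x)) 0) = 0 := by
  obtain ⟨ε, hε, r, hrs, hr0, hrd, hrW⟩ := exists_curve_in_level h.isOpen h0 hf hs hr
  have h0ε : (0 : ℝ) ∈ Ioo (-ε) ε := ⟨by linarith, hε⟩
  have hp0 : ((0 : ℝ), r 0) = 0 := by rw [hr0]; rfl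
  have hfam : IsTangentFamily a b c d (D a b 1 γ) (Ioo (-ε) ε)
      (fun q : ℝ × ℝ => τ ((q.1, r q.1), q.2)) :=
    h.comp (r := fun t => (t, r t)) isOpen_Ioo (contDiffOn_id.prodMk hrs) fun t ht => (hrW t ht).1
  have hσ0 : ∀ x ∈ Ioo a b, τ ((0, r 0), x) = D a b 1 γ x := fun x hx => by
    rw [hp0]; exact hτ x hx
  have hσv : ∀ t ∈ Ioo (-ε) ε, ∀ x ∈ Icc a b, ‖v‖ ^ 2 - inner ℝ v (τ ((t, r t), x)) ^ 2 ≠ 0 :=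
    fun t ht => hv (t, r t) (hrW t ht).1
  have hσcl : ∀ t ∈ Ioo (-ε) ε, ∫ x in a..b, τ ((t, r t), x) = ∫ x in a..b, D a b 1 γ x :=
    fun t ht => hclosed (t, r t) (hrW t ht).1 (hrW t ht).2
  have hσco : ∀ t ∈ Ioo (-ε) ε, ∫ x in a..b, connectionForm a b v (fun y => τ ((t, r t), y)) x =
      ∫ x in a..b, connectionForm a b v (D a b 1 γ) x :=
    fun t ht => hconn (t, r t) (hrW t ht).1 (hrW t ht).2
  have key := hel.integral_eq_zero hab hγ hρ hε hfam hσ0 hvT hσv hσcl hσco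
  refine Eq.trans ?_ key
  refine intervalIntegral_congr_Ioo hab.le fun x hx => ?_
  have hd : DifferentiableAt ℝ τ ((0, 0), x) :=
    (h.smooth.contDiffAt ((h.isOpen.prod isOpen_Ioo).mem_nhds
      (mk_mem_prod h0 hx))).differentiableAt (by simp)
  have d3 := hasDerivAt_partialT (isOpen_Ioo.prod isOpen_Ioo) hfam.smooth
    (mk_mem_prod h0ε hx)
  rw [d3.unique (hasDerivAt_comp_tangent_curve hd hr0 hrd)]

end LevelCurve

/-! ### Test functions, the fundamental lemma and Lagrange multipliers. -/

section TestFunctions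

variable {F : Type} [NormedAddCommGroup F] [InnerProductSpace ℝ F] {a b A B : ℝ}

/-- Smooth functions with compact support in `(a,b)`. -/
def testFunctions (F : Type) [NormedAddCommGroup F] [InnerProductSpace ℝ F] (a b : ℝ) :
    Submodule ℝ (ℝ → F) where
  carrier := {w | ContDiff ℝ ∞ w ∧ ∃ c d, a < c ∧ d < b ∧ ∀ x, x ∉ Ioo c d → w x = 0}
  add_mem' := by
    rintro w z ⟨hw, c, d, hc, hd, h0⟩ ⟨hz, c', d', hc', hd', h0'⟩
    refine ⟨hw.add hz, min c c', max d d', lt_min hc hc', max_lt hd hd', fun x hx => ?_⟩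
    rw [Pi.add_apply, h0 x fun h => hx ⟨(min_le_left _ _).trans_lt h.1, h.2.trans_le
      (le_max_left _ _)⟩, h0' x fun h => hx ⟨(min_le_right _ _).trans_lt h.1, h.2.trans_le
      (le_max_right _ _)⟩, add_zero]
  -- The support interval `Ioo c d` is allowed to be empty, so any c > a and d < b will do.
  zero_mem' := ⟨contDiff_const, a + 1, b - 1, by linarith, by linarith, fun _ _ => rfl⟩
  smul_mem' := by
    rintro r w ⟨hw, c, d, hc, hd, h0⟩
    exact ⟨contDiff_const.smul hw, c, d, hc, hd, fun x hx => by
      rw [Pi.smul_apply, h0 x hx, smul_zero]⟩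

theorem testFunctions_mono (ha : A ≤ a) (hb : b ≤ B) :
    testFunctions F a b ≤ testFunctions F A B := by
  rintro w ⟨hw, c, d, hc, hd, h0⟩
  exact ⟨hw, c, d, ha.trans_lt hc, hd.trans_le hb, h0⟩

/-- Finitely many test functions are supported in a common compact interval. -/
theorem exists_common_support {ι : Type} [Finite ι] {w : ι → ℝ → F}
    (hw : ∀ i, w i ∈ testFunctions F a b) :
    ∃ c d, a < c ∧ d < b ∧ ∀ i x, x ∉ Ioo c d → w i x = 0 := by
  choose c d hc hd h0 using fun i => (hw i).2
  have := Fintype.ofFinite ι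
  rcases isEmpty_or_nonempty ι with hι | hι
  · exact ⟨a + 1, b - 1, by linarith, by linarith, fun i => isEmptyElim i⟩
  · refine ⟨Finset.univ.inf' Finset.univ_nonempty c, Finset.univ.sup' Finset.univ_nonempty d,
      (Finset.lt_inf'_iff _).2 fun i _ => hc i, (Finset.sup'_lt_iff _).2 fun i _ => hd i,
      fun i x hx => h0 i x fun h => hx ⟨?_, ?_⟩⟩
    · exact (Finset.inf'_le _ (Finset.mem_univ i)).trans_lt h.1
    · exact h.2.trans_le (Finset.le_sup' _ (Finset.mem_univ i))

theorem intervalIntegrable_inner_test (hAB : A ≤ B) {g w : ℝ → F}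
    (hg : ContDiffOn ℝ ∞ g (Ioo A B)) (hw : w ∈ testFunctions F A B) :
    IntervalIntegrable (fun x => inner ℝ (g x) (w x)) volume A B := by
  obtain ⟨hws, c, d, hc, hd, h0⟩ := hw
  exact intervalIntegrable_of_support hAB hc hd (hg.inner ℝ hws.contDiffOn) fun x _ hx => by
    rw [h0 x hx, inner_zero_right]

/-- The linear functional `w ↦ ∫ ⟨g, w⟩`. -/
noncomputable def testPairing (hAB : A ≤ B) {g : ℝ → F} (hg : ContDiffOn ℝ ∞ g (Ioo A B))
    (ha : A ≤ a) (hb : b ≤ B) : testFunctions F a b →ₗ[ℝ] ℝ where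
  toFun w := ∫ x in A..B, inner ℝ (g x) ((w : ℝ → F) x)
  map_add' w z := by
    rw [← intervalIntegral.integral_add
      (intervalIntegrable_inner_test hAB hg (testFunctions_mono ha hb w.2))
      (intervalIntegrable_inner_test hAB hg (testFunctions_mono ha hb z.2))]
    simp [inner_add_right]
  map_smul' r w := by
    rw [RingHom.id_apply, smul_eq_mul, ← intervalIntegral.integral_const_mul]
    simp [real_inner_smul_right]

/-- The fundamental lemma of the calculus of variations. -/
theorem eq_zero_of_integral_test {g : ℝ → F} (ha : A ≤ a) (hb : b ≤ B)
    (hg : ContinuousOn g (Ioo a b))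
    (h : ∀ w ∈ testFunctions F a b, ∫ x in A..B, inner ℝ (g x) (w x) = 0) {x : ℝ}
    (hx : x ∈ Ioo a b) : g x = 0 := by
  refine ext_inner_right ℝ fun e => ?_
  rw [inner_zero_left]
  have hge : ContinuousOn (fun x => inner ℝ (g x) e) (Ioo a b) :=
    ContinuousOn.inner hg continuousOn_const
  have h1 := isOpen_Ioo.ae_eq_zero_of_integral_contDiff_smul_eq_zero
    (hge.locallyIntegrableOn (μ := volume) measurableSet_Ioo) fun φ hφ hφc hφs => by
      have hmem : (fun x => φ x • e) ∈ testFunctions F a b := by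
        refine ⟨hφ.smul contDiff_const, ?_⟩
        rcases (tsupport φ).eq_empty_or_nonempty with he | hne
        · refine ⟨a + 1, b - 1, by linarith, by linarith, fun y _ => ?_⟩
          have hz : φ y = 0 := image_eq_zero_of_notMem_tsupport (by rw [he]; simp)
          simp only [hz, zero_smul]
        · obtain ⟨m, hm⟩ := hφc.isCompact.exists_isLeast hne
          obtain ⟨M, hM⟩ := hφc.isCompact.exists_isGreatest hne
          refine ⟨(a + m) / 2, (M + b) / 2, by linarith [(hφs hm.1).1],
            by linarith [(hφs hM.1).2], fun y hy => ?_⟩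
          have hz : φ y = 0 := image_eq_zero_of_notMem_tsupport fun hyt =>
            hy ⟨by linarith [hm.2 hyt, (hφs hm.1).1], by linarith [hM.2 hyt, (hφs hM.1).2]⟩
          simp only [hz, zero_smul]
      have h2 := h _ hmem
      rw [intervalIntegral.integral_eq_integral_of_support_subset] at h2
      · rw [← h2]
        simp only [real_inner_smul_right, smul_eq_mul]
      · intro y hy
        have : φ y ≠ 0 := fun h0 => hy (by simp [h0])
        have := hφs (subset_tsupport _ this)
        exact ⟨ha.trans_lt this.1, this.2.le.trans hb⟩
  have h3 : EqOn (fun x => inner ℝ (g x) e) (fun _ => 0) (Ioo a b) :=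
    Measure.eqOn_open_of_ae_eq (μ := volume) ((ae_restrict_iff' measurableSet_Ioo).2 h1) isOpen_Ioo
      hge continuousOn_const
  exact h3 hx

variable {ι : Type} [Fintype ι]

/-- Lagrange multipliers for linear constraints on test functions. -/
theorem exists_multipliers (hAB : A ≤ B) (ha : A ≤ a) (hb : b ≤ B) {g : ℝ → F}
    (hg : ContDiffOn ℝ ∞ g (Ioo A B)) {f : ι → ℝ → F}
    (hf : ∀ i, ContDiffOn ℝ ∞ (f i) (Ioo A B))
    (h : ∀ w ∈ testFunctions F a b, (∀ i, ∫ x in A..B, inner ℝ (f i x) (w x) = 0) →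
      ∫ x in A..B, inner ℝ (g x) (w x) = 0) :
    ∃ l : ι → ℝ, ∀ x ∈ Ioo a b, g x = ∑ i, l i • f i x := by
  have h1 : testPairing hAB hg ha hb ∈
      Submodule.span ℝ (range fun i => testPairing hAB (hf i) ha hb) := by
    refine mem_span_of_iInf_ker_le_ker fun w hw => ?_
    rw [Submodule.mem_iInf] at hw
    exact h w w.2 fun i => hw i
  obtain ⟨l, hl⟩ := (Submodule.mem_span_range_iff_exists_fun ℝ).1 h1
  refine ⟨l, fun x hx => sub_eq_zero.1 ?_⟩
  have hfs : ContDiffOn ℝ ∞ (fun x => ∑ i, l i • f i x) (Ioo A B) :=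
    ContDiffOn.sum fun i _ => contDiffOn_const.smul (hf i)
  refine eq_zero_of_integral_test (g := fun x => g x - ∑ i, l i • f i x) ha hb
    ((hg.sub hfs).continuousOn.mono (Ioo_subset_Ioo ha hb)) (fun w hw => ?_) hx
  have hw' := testFunctions_mono ha hb hw
  have e := LinearMap.congr_fun hl ⟨w, hw⟩
  simp only [inner_sub_left]
  rw [intervalIntegral.integral_sub (intervalIntegrable_inner_test hAB hg hw')
    (intervalIntegrable_inner_test hAB hfs hw'), sub_eq_zero]
  simp only [sum_inner, real_inner_smul_left]
  rw [intervalIntegral.integral_finsetSum fun i _ =>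
    (intervalIntegrable_inner_test hAB (hf i) hw').const_mul _]
  simp only [intervalIntegral.integral_const_mul]
  simpa [LinearMap.sum_apply, testPairing] using e.symm

/-- Linearly independent functions have dual test functions. -/
theorem exists_dual_or_relation [DecidableEq ι] (hAB : A ≤ B) (ha : A ≤ a) (hb : b ≤ B)
    {f : ι → ℝ → F} (hf : ∀ i, ContDiffOn ℝ ∞ (f i) (Ioo A B)) :
    (∃ w : ι → ℝ → F, (∀ j, w j ∈ testFunctions F a b) ∧
      ∀ i j, ∫ x in A..B, inner ℝ (f i x) (w j x) = (Pi.single j 1 : ι → ℝ) i) ∨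
    ∃ l : ι → ℝ, l ≠ 0 ∧ ∀ x ∈ Ioo a b, ∑ i, l i • f i x = 0 := by
  set Φ : testFunctions F a b →ₗ[ℝ] (ι → ℝ) :=
    LinearMap.pi fun i => testPairing hAB (hf i) ha hb with hΦ
  -- If the evaluation map is onto, preimages of the basis vectors are dual; otherwise a nonzero
  -- functional kills its range, and the fundamental lemma makes this a pointwise relation.
  by_cases hsurj : LinearMap.range Φ = ⊤
  · left
    choose w hw using LinearMap.range_eq_top.1 hsurj
    refine ⟨fun j => w (Pi.single j 1), fun j => (w (Pi.single j 1)).2, fun i j => ?_⟩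
    exact congrFun (hw (Pi.single j 1)) i
  · right
    obtain ⟨l, hl0, hl⟩ := Submodule.exists_le_ker_of_lt_top _ (lt_top_iff_ne_top.2 hsurj)
    refine ⟨fun i => l (Pi.single i 1), fun h0 => hl0 ?_, fun x hx => ?_⟩
    · refine (Pi.basisFun ℝ ι).ext fun j => ?_
      simpa using congrFun h0 j
    · have hfs : ContDiffOn ℝ ∞ (fun x => ∑ i, l (Pi.single i 1) • f i x) (Ioo A B) :=
        ContDiffOn.sum fun i _ => contDiffOn_const.smul (hf i)
      refine eq_zero_of_integral_test (g := fun x => ∑ i, l (Pi.single i 1) • f i x) ha hb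
        (hfs.continuousOn.mono (Ioo_subset_Ioo ha hb)) (fun w hw => ?_) hx
      have hw' := testFunctions_mono ha hb hw
      have e : l (Φ ⟨w, hw⟩) = 0 := hl ⟨⟨w, hw⟩, rfl⟩
      simp only [sum_inner, real_inner_smul_left]
      rw [intervalIntegral.integral_finsetSum fun i _ =>
        (intervalIntegrable_inner_test hAB (hf i) hw').const_mul _]
      simp only [intervalIntegral.integral_const_mul]
      rw [LinearMap.pi_apply_eq_sum_univ l] at e
      simp only [smul_eq_mul] at e
      rw [← e]
      refine Finset.sum_congr rfl fun i _ => ?_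
      rw [mul_comm]
      congr 2
      ext k
      simp [Pi.single_apply, eq_comm]

end TestFunctions

/-! ### Derivatives of the constraints along lines of parameters. -/

section Lines

variable {P : Type} [NormedAddCommGroup P] [NormedSpace ℝ P] {a b c d : ℝ} {T : ℝ → E3}
  {W : Set P} {τ : P × ℝ → E3}

/-- Directional derivatives of the total tangent along a smooth curve of parameters. -/
theorem IsTangentFamily.hasDerivAt_integral_line (h : IsTangentFamily a b c d T W τ) {l : ℝ → P}
    (hl : ContDiff ℝ ∞ l) (hl0 : l 0 ∈ W) {u : ℝ → E3}
    (hu : ∀ x ∈ Ioo a b, HasDerivAt (fun s => τ (l s, x)) (u x) 0) :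
    HasDerivAt (fun s => ∫ x in a..b, τ (l s, x)) (∫ x in a..b, u x) 0 := by
  have hO : IsOpen (l ⁻¹' W) := h.isOpen.preimage hl.continuous
  have hfam := h.comp (V' := l ⁻¹' W) hO hl.contDiffOn fun q hq => hq
  have hTi : IntervalIntegrable T volume a b :=
    ContinuousOn.intervalIntegrable_Icc' h.le (ContDiffOn.continuousOn h.smooth_T)
  refine (hfam.hasDerivAt_integral hTi (t := 0) hl0).congr_deriv ?_
  exact intervalIntegral_congr_Ioo h.le fun x hx => (hu x hx).deriv

/-- Directional derivatives of the total connection form along a smooth curve of parameters. -/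
theorem IsTangentFamily.hasDerivAt_connection_line (h : IsTangentFamily a b c d T W τ) {v : E3}
    (hvT : ∀ x ∈ Icc a b, ‖v‖ ^ 2 - inner ℝ v (T x) ^ 2 ≠ 0)
    (hv : ∀ p ∈ W, ∀ x ∈ Icc a b, ‖v‖ ^ 2 - inner ℝ v (τ (p, x)) ^ 2 ≠ 0) {l : ℝ → P}
    (hl : ContDiff ℝ ∞ l) (hl0 : l 0 ∈ W) (hτ : ∀ x ∈ Ioo a b, τ (l 0, x) = T x) {u : ℝ → E3}
    (hu : ∀ x ∈ Ioo a b, HasDerivAt (fun s => τ (l s, x)) (u x) 0) :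
    HasDerivAt (fun s => ∫ x in a..b, connectionForm a b v (fun y => τ (l s, y)) x)
      (∫ x in a..b, inner ℝ (cross (T x) (D a b 1 T x)) (u x)) 0 := by
  have hO : IsOpen (l ⁻¹' W) := h.isOpen.preimage hl.continuous
  have hfam := h.comp (V' := l ⁻¹' W) hO hl.contDiffOn fun q hq => hq
  have hv' : ∀ t ∈ l ⁻¹' W, ∀ x ∈ Icc a b, ‖v‖ ^ 2 - inner ℝ v (τ (l t, x)) ^ 2 ≠ 0 :=
    fun t ht => hv (l t) ht
  refine (hfam.hasDerivAt_connection hvT hv' (t := 0) hl0 hτ).congr_deriv ?_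
  refine intervalIntegral_congr_Ioo h.le fun x hx => ?_
  have d3 := hasDerivAt_partialT (hO.prod isOpen_Ioo) hfam.smooth (mk_mem_prod hl0 hx)
  rw [d3.unique (hu x hx)]

theorem contDiff_pi_single {ι : Type} [Fintype ι] [DecidableEq ι] (j : ι) :
    ContDiff ℝ ∞ (fun s : ℝ => ((0, Pi.single j s) : ℝ × (ι → ℝ))) := by
  refine contDiff_const.prodMk (contDiff_pi.2 fun i => ?_)
  by_cases hij : i = j
  · subst hij; simpa using contDiff_fun_id
  · simpa [hij] using contDiff_const

end Lines

/-! ### Unit fields by central projection. -/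

section SphericalFamily

variable {a b c d : ℝ} {T : ℝ → E3}

/-- The component of `w` orthogonal to the unit field `T`. -/
noncomputable def perp (T w : ℝ → E3) (x : ℝ) : E3 := w x - inner ℝ (w x) (T x) • T x

theorem inner_perp {w : ℝ → E3} {x : ℝ} (hT : ‖T x‖ = 1) : inner ℝ (T x) (perp T w x) = 0 := by
  rw [perp, inner_sub_right, real_inner_smul_right, real_inner_self_eq_norm_sq, hT,
    real_inner_comm]
  ring

theorem inner_perp_comm (g w : ℝ → E3) (x : ℝ) :
    inner ℝ (perp T g x) (w x) = inner ℝ (g x) (perp T w x) := by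
  simp only [perp, inner_sub_left, inner_sub_right, real_inner_smul_left, real_inner_smul_right]
  rw [real_inner_comm (w x) (T x)]
  ring

theorem perp_contDiffOn {s : Set ℝ} (hT : ContDiffOn ℝ ∞ T s) {w : ℝ → E3}
    (hw : ContDiffOn ℝ ∞ w s) : ContDiffOn ℝ ∞ (perp T w) s :=
  hw.sub ((hw.inner ℝ hT).smul hT)

/-- Central projection to the sphere of `t + z`, `z` orthogonal to the unit vector `t`. -/
noncomputable def centralProjection (t z : E3) : E3 := (Real.sqrt (1 + ‖z‖ ^ 2))⁻¹ • (t + z)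

theorem norm_centralProjection {t z : E3} (ht : ‖t‖ = 1) (htz : inner ℝ t z = 0) :
    ‖centralProjection t z‖ = 1 := by
  have hpos : 0 < 1 + ‖z‖ ^ 2 := by positivity
  have h1 : ‖t + z‖ = Real.sqrt (1 + ‖z‖ ^ 2) := by
    rw [eq_comm, Real.sqrt_eq_iff_mul_self_eq_of_pos
      (norm_pos_iff.2 fun h0 => ?_), norm_add_mul_self_real, htz, ht]
    · ring
    · have : inner ℝ t (t + z) = 1 := by
        rw [inner_add_right, htz, real_inner_self_eq_norm_sq, ht]; norm_num
      rw [h0, inner_zero_right] at this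
      exact zero_ne_one this
  rw [centralProjection, norm_smul, h1, norm_inv, Real.norm_of_nonneg (Real.sqrt_nonneg _),
    inv_mul_cancel₀ (Real.sqrt_pos.2 hpos).ne']

theorem centralProjection_zero (t : E3) : centralProjection t 0 = t := by
  simp [centralProjection]

/-- The normalizing factor is even in s, so it does not contribute to first order. -/
theorem hasDerivAt_centralProjection (t u : E3) :
    HasDerivAt (fun s : ℝ => centralProjection t (s • u)) u 0 := by
  have h1 : HasDerivAt (fun s : ℝ => 1 + ‖s • u‖ ^ 2) 0 0 := by
    have : (fun s : ℝ => 1 + ‖s • u‖ ^ 2) = fun s => 1 + s ^ 2 * ‖u‖ ^ 2 := by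
      ext s; rw [norm_smul, mul_pow, Real.norm_eq_abs, sq_abs]
    rw [this]
    simpa using (((hasDerivAt_id (0 : ℝ)).pow 2).mul_const (‖u‖ ^ 2)).const_add 1
  have h2 := (h1.sqrt (by simp)).inv (by simp)
  have h3 : HasDerivAt (fun s : ℝ => t + s • u) u 0 := by
    simpa using ((hasDerivAt_id (0 : ℝ)).smul_const u).const_add t
  refine (h2.smul h3).congr_deriv ?_
  simp

theorem centralProjection_contDiffOn {E : Type} [NormedAddCommGroup E] [NormedSpace ℝ E]
    {f g : E → E3} {s : Set E} (hf : ContDiffOn ℝ ∞ f s) (hg : ContDiffOn ℝ ∞ g s) :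
    ContDiffOn ℝ ∞ (fun x => centralProjection (f x) (g x)) s := by
  have hpos : ∀ x, 0 < 1 + ‖g x‖ ^ 2 := fun x => by positivity
  exact (((contDiffOn_const.add (hg.norm_sq ℝ)).sqrt fun x _ => (hpos x).ne').inv
    fun x _ => (Real.sqrt_pos.2 (hpos x)).ne').smul (hf.add hg)

variable {ι : Type} [Fintype ι]

/-- A linear combination of vector fields, with the first one distinguished. -/
noncomputable def linearFamily (u : ℝ → E3) (w : ι → ℝ → E3) (p : ℝ × (ι → ℝ)) (x : ℝ) : E3 :=
  p.1 • u x + ∑ j, p.2 j • w j x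

theorem linearFamily_single [DecidableEq ι] (u : ℝ → E3) (w : ι → ℝ → E3) (j : ι) (s x : ℝ) :
    linearFamily u w (0, Pi.single j s) x = s • w j x := by
  rw [linearFamily, zero_smul, zero_add, Finset.sum_eq_single j]
  · simp
  · intro k _ hk; simp [hk]
  · simp

/-- Since 1 + |z|² never vanishes, the projection is smooth for all parameters and no restriction to
small ones is needed; a vanishing field returns T. -/
theorem sphericalFamily_isTangentFamily (hab : a < b) (hT : SmoothOnIcc a b T)
    (hunit : ∀ x ∈ Icc a b, ‖T x‖ = 1) (hac : a < c) (hdb : d < b) {u : ℝ → E3}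
    {w : ι → ℝ → E3} (hu : ContDiffOn ℝ ∞ u (Ioo a b)) (hw : ∀ j, ContDiffOn ℝ ∞ (w j) (Ioo a b))
    (huT : ∀ x ∈ Icc a b, inner ℝ (T x) (u x) = 0)
    (hwT : ∀ j, ∀ x ∈ Icc a b, inner ℝ (T x) (w j x) = 0)
    (hu0 : ∀ x, x ∉ Ioo c d → u x = 0) (hw0 : ∀ j x, x ∉ Ioo c d → w j x = 0) :
    IsTangentFamily a b c d T (univ : Set (ℝ × (ι → ℝ)))
      (fun q : (ℝ × (ι → ℝ)) × ℝ => centralProjection (T q.2) (linearFamily u w q.1 q.2)) := by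
  have hoff : ∀ (p : ℝ × (ι → ℝ)) (x : ℝ), x ∉ Ioo c d →
      centralProjection (T x) (linearFamily u w p x) = T x := fun p x hx => by
    simp [linearFamily, hu0 x hx, hw0 _ x hx, centralProjection_zero]
  refine ⟨⟨isOpen_univ, hac, hdb, hab.le, ?_, hT.Ioo, fun p _ x _ hx => hoff p x hx⟩, hab, hT,
    fun p _ x hx => norm_centralProjection (hunit x hx) ?_, fun p _ x _ hx => hoff p x hx⟩
  · refine centralProjection_contDiffOn (hT.Ioo.comp contDiffOn_snd fun q hq => hq.2) ?_
    refine ContDiffOn.add ?_ (ContDiffOn.sum fun j _ => ?_)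
    · have h1 : ContDiff ℝ ∞ fun q : (ℝ × (ι → ℝ)) × ℝ => q.1.1 := by fun_prop
      exact h1.contDiffOn.smul (hu.comp contDiffOn_snd fun q hq => hq.2)
    · have h1 : ContDiff ℝ ∞ fun q : (ℝ × (ι → ℝ)) × ℝ => q.1.2 j := by fun_prop
      exact h1.contDiffOn.smul ((hw j).comp contDiffOn_snd fun q hq => hq.2)
  · simp [linearFamily, inner_add_right, inner_sum, real_inner_smul_right, huT x hx, hwT _ x hx]

end SphericalFamily

/-! ### Multipliers when the constraint gradients are independent. -/

section RegularCase

variable {a b : ℝ} {γ : ℝ → E3} {ρ : ℝ → ℝ}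

/-- The gradients, on unit tangents, of the constraints: the coordinates of the total tangent and
the total connection form. -/
noncomputable def constraintField (a b : ℝ) (T : ℝ → E3) : Option (Fin 3) → ℝ → E3
  | none => fun x => cross (T x) (D a b 1 T x)
  | some k => perp T fun _ => EuclideanSpace.single k 1

theorem constraintField_smooth (hab : a < b) {T : ℝ → E3} (hT : SmoothOnIcc a b T)
    (i : Option (Fin 3)) : ContDiffOn ℝ ∞ (constraintField a b T i) (Ioo a b) := by
  cases i with
  | none => exact hT.Ioo.cross (hT.D_one hab).Ioo
  | some k => exact perp_contDiffOn hT.Ioo contDiffOn_const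

theorem sum_constraintField {T : ℝ → E3} (l : Option (Fin 3) → ℝ) (x : ℝ) :
    ∑ i, l i • constraintField a b T i x =
      l none • cross (T x) (D a b 1 T x) +
        perp T (fun _ => WithLp.toLp 2 fun k => l (some k)) x := by
  rw [Fintype.sum_option]
  congr 1
  have h1 : (WithLp.toLp 2 fun k => l (some k) : E3) =
      ∑ k, l (some k) • EuclideanSpace.single k (1 : ℝ) := by
    ext i; simp [Fin.sum_univ_three]
    fin_cases i <;> simp
  simp only [constraintField, perp, h1, sum_inner, real_inner_smul_left, smul_sub,
    Finset.sum_sub_distrib, Finset.sum_smul, smul_smul]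

/-- A test field z annihilated by the constraint gradients is used as the first direction of a
family whose other four directions are the dual fields. The constraint map is then a submersion in
those four, so z is tangent to a family of admissible fields and the energy gradient annihilates it.
-/
theorem IsHolonomyConstrainedElastic.exists_multipliers_of_dual (hab : a < b)
    (hγ : IsArcLengthCurve a b γ) (hρ : SmoothOnIcc a b ρ)
    (hel : IsHolonomyConstrainedElastic a b ρ γ) {w : Option (Fin 3) → ℝ → E3}
    (hw : ∀ j, w j ∈ testFunctions E3 a b)
    (hdual : ∀ i j, ∫ x in a..b, inner ℝ (constraintField a b (D a b 1 γ) i x) (w j x) =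
      (Pi.single j 1 : Option (Fin 3) → ℝ) i) :
    ∃ l : Option (Fin 3) → ℝ, ∀ x ∈ Ioo a b,
      perp (D a b 1 γ) (tangentGradient a b ρ (D a b 1 γ)) x =
        ∑ i, l i • constraintField a b (D a b 1 γ) i x := by
  set T := D a b 1 γ with hTdef
  have hT : SmoothOnIcc a b T := SmoothOnIcc.D_one hab hγ.1.1
  have hunit : ∀ x ∈ Icc a b, ‖T x‖ = 1 := hγ.2
  have hG : SmoothOnIcc a b (tangentGradient a b ρ T) :=
    SmoothOnIcc.D_one hab (ContDiffOn.smul hρ (hT.D_one hab))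
  refine exists_multipliers hab.le le_rfl le_rfl (perp_contDiffOn hT.Ioo hG.Ioo)
    (constraintField_smooth hab hT) fun z hz hz0 => ?_
  simp only [inner_perp_comm]
  obtain ⟨c, d, hac, hdb, h0⟩ := exists_common_support
    (w := fun i : Option (Option (Fin 3)) => i.elim z w) (a := a) (b := b) (F := E3) fun i => by
      cases i with
      | none => exact hz
      | some j => exact hw j
  have hz' : ∀ x, x ∉ Ioo c d → perp T z x = 0 := fun x hx => by
    have : z x = 0 := h0 none x hx
    simp [perp, this]
  have hw' : ∀ j x, x ∉ Ioo c d → perp T (w j) x = 0 := fun j x hx => by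
    have : w j x = 0 := h0 (some j) x hx
    simp [perp, this]
  set τ : (ℝ × (Option (Fin 3) → ℝ)) × ℝ → E3 := fun q =>
    centralProjection (T q.2) (linearFamily (perp T z) (fun j => perp T (w j)) q.1 q.2) with hτ
  have hfam0 : IsTangentFamily a b c d T univ τ :=
    sphericalFamily_isTangentFamily hab hT hunit hac hdb
      (perp_contDiffOn hT.Ioo hz.1.contDiffOn) (fun j => perp_contDiffOn hT.Ioo (hw j).1.contDiffOn)
      (fun x hx => inner_perp (hunit x hx)) (fun j x hx => inner_perp (hunit x hx)) hz' hw'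
  have hτ0 : ∀ x, τ (0, x) = T x := fun x => by
    simp [hτ, linearFamily, centralProjection_zero]
  have hds : ∀ x, HasDerivAt (fun s : ℝ => τ ((s, 0), x)) (perp T z x) 0 := fun x => by
    simpa [hτ, linearFamily] using hasDerivAt_centralProjection (T x) (perp T z x)
  have hdr : ∀ j x, HasDerivAt (fun s : ℝ => τ ((0, Pi.single j s), x)) (perp T (w j) x) 0 :=
    fun j x => by
      have := hasDerivAt_centralProjection (T x) (perp T (w j) x)
      simpa only [hτ, linearFamily_single] using this
  obtain ⟨v, hvT⟩ := exists_frame_vector hT hunit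
  obtain ⟨W, hWv, hWo, h0W⟩ := eventually_nhds_iff.1
    (hfam0.eventually_frame_vector hvT (mem_univ 0) fun x _ => hτ0 x)
  have hfam : IsTangentFamily a b c d T W τ := hfam0.mono hWo (subset_univ _)
  have hTi : IntervalIntegrable T volume a b :=
    ContinuousOn.intervalIntegrable_Icc' hab.le (ContDiffOn.continuousOn hT)
  set I : ℝ × (Option (Fin 3) → ℝ) → E3 := fun p => ∫ x in a..b, τ (p, x) with hI
  set H : ℝ × (Option (Fin 3) → ℝ) → ℝ := fun p =>
    ∫ x in a..b, connectionForm a b v (fun y => τ (p, y)) x with hH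
  -- The four constraints together: the total connection form and the three coordinates of the total
  -- tangent.
  set f : ℝ × (Option (Fin 3) → ℝ) → Option (Fin 3) → ℝ := fun p i =>
    i.elim (H p) fun k => I p k with hf
  have hIs : ContDiffOn ℝ ∞ I W := hfam.contDiffOn_integral hTi
  have hHs : ContDiffOn ℝ ∞ H W := hfam.contDiffOn_connection hvT hWv
  have hfs : ContDiffOn ℝ ∞ f W := by
    refine contDiffOn_pi.2 fun i => ?_
    cases i with
    | none => exact hHs
    | some k => exact (EuclideanSpace.proj k : E3 →L[ℝ] ℝ).contDiff.comp_contDiffOn hIs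
  have hline : ∀ (l : ℝ → ℝ × (Option (Fin 3) → ℝ)) (y : ℝ → E3), ContDiff ℝ ∞ l → l 0 = 0 →
      y ∈ testFunctions E3 a b → (∀ x, HasDerivAt (fun s => τ (l s, x)) (perp T y x) 0) →
      HasDerivAt (fun s => f (l s)) (fun i => ∫ x in a..b, inner ℝ (constraintField a b T i x) (y x))
        0 := by
    intro l y hl hl0 hy hd
    have hl0W : l 0 ∈ W := by rw [hl0]; exact h0W
    refine hasDerivAt_pi.2 fun i => ?_
    cases i with
    | none =>
      refine (hfam.hasDerivAt_connection_line hvT hWv hl hl0W (fun x _ => by rw [hl0, hτ0])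
        fun x _ => hd x).congr_deriv ?_
      refine intervalIntegral_congr_Ioo hab.le fun x hx => ?_
      simp only [constraintField, perp, inner_sub_right, real_inner_smul_right, inner_cross_left]
      ring
    | some k =>
      have h1 := hfam.hasDerivAt_integral_line hl hl0W fun x _ => hd x
      have h2 := (EuclideanSpace.proj k : E3 →L[ℝ] ℝ).hasFDerivAt.comp_hasDerivAt (0 : ℝ) h1
      refine h2.congr_deriv ?_
      obtain ⟨hys, c', d', hc', hd', hy0⟩ := hy
      rw [← ContinuousLinearMap.intervalIntegral_comp_comm _ (intervalIntegrable_of_support hab.le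
        hc' hd' (perp_contDiffOn hT.Ioo hys.contDiffOn) fun x _ hx => by simp [perp, hy0 x hx])]
      refine intervalIntegral_congr_Ioo hab.le fun x hx => ?_
      simp only [constraintField]
      rw [inner_perp_comm]
      simp [EuclideanSpace.inner_single_left]
  have hs := hline (fun s => (s, 0)) z (contDiff_id.prodMk contDiff_const) rfl hz hds
  have hr := fun j => hline (fun s => (0, Pi.single j s)) (w j) (contDiff_pi_single j)
    (by rw [Pi.single_zero]; rfl) (hw j) (hdr j)
  have hf0 : ∀ p ∈ W, f p = f 0 → I p = ∫ x in a..b, T x ∧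
      H p = ∫ x in a..b, connectionForm a b v T x := by
    intro p _ hp
    constructor
    · have : I p = I 0 := by ext k; exact congrFun hp (some k)
      rw [this]; simp only [hI, hτ0]
    · have : H p = H 0 := congrFun hp none
      rw [this]; simp only [hH, hτ0]
  have key := hel.integral_eq_zero_of_level hab hγ hρ hfam h0W (fun x _ => hτ0 x) hvT hWv hfs
    (hs.congr_deriv (funext fun i => hz0 i)) (fun j => (hr j).congr_deriv (funext fun i => hdual i j))
    (fun p hp hfp => (hf0 p hp hfp).1) (fun p hp hfp => (hf0 p hp hfp).2)
  refine Eq.trans (intervalIntegral_congr_Ioo hab.le fun x hx => ?_) key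
  rw [(hds x).deriv]

end RegularCase

/-! ### Tangents running on a circle, in height and longitude. -/

section CircleFrame

/-- `T` runs on a circle of the unit sphere around the axis `e`, at height `z₀` and with angular
velocity `κ`; `n` is the radial unit vector. -/
structure IsCircleFrame (a b : ℝ) (T : ℝ → E3) (e : E3) (n : ℝ → E3) (z₀ r₀ κ : ℝ) : Prop where
  lt : a < b
  norm_e : ‖e‖ = 1
  smooth_n : SmoothOnIcc a b n
  norm_n : ∀ x ∈ Icc a b, ‖n x‖ = 1
  inner_en : ∀ x ∈ Icc a b, inner ℝ e (n x) = 0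
  eq_T : ∀ x ∈ Icc a b, T x = z₀ • e + r₀ • n x
  pos : 0 < r₀
  sq_add_sq : z₀ ^ 2 + r₀ ^ 2 = 1
  ne_zero : κ ≠ 0
  D_n : ∀ x ∈ Icc a b, D a b 1 n x = κ • cross e (n x)

/-- A vector at height `z₀ + α` and at the longitude `β` with respect to `n`. -/
noncomputable def circlePoint (e n : E3) (z₀ α β : ℝ) : E3 :=
  (z₀ + α) • e + Real.sqrt (1 - (z₀ + α) ^ 2) • (Real.cos β • n + Real.sin β • cross e n)

variable {e n : E3} {z₀ r₀ α β : ℝ}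

theorem cross_e_cross (he : ‖e‖ = 1) (hen : inner ℝ e n = 0) : cross e (cross e n) = -n := by
  rw [cross_cross_eq, hen, real_inner_self_eq_norm_sq, he]; simp

theorem inner_circlePoint (he : ‖e‖ = 1) (hen : inner ℝ e n = 0) :
    inner ℝ e (circlePoint e n z₀ α β) = z₀ + α := by
  have h1 : inner ℝ e (cross e n) = 0 := by rw [real_inner_comm, inner_cross_left]
  simp only [circlePoint, inner_add_right, real_inner_smul_right, hen, h1,
    real_inner_self_eq_norm_sq, he]
  ring

theorem norm_circlePoint (he : ‖e‖ = 1) (hn : ‖n‖ = 1) (hen : inner ℝ e n = 0)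
    (hα : (z₀ + α) ^ 2 < 1) : ‖circlePoint e n z₀ α β‖ = 1 := by
  have h1 : inner ℝ e (cross e n) = 0 := by rw [real_inner_comm, inner_cross_left]
  have h2 : inner ℝ n (cross e n) = 0 := by rw [real_inner_comm, inner_cross_right]
  have h3 : ‖circlePoint e n z₀ α β‖ ^ 2 = 1 := by
    rw [← real_inner_self_eq_norm_sq]
    simp only [circlePoint, inner_add_left, inner_add_right, real_inner_smul_left,
      real_inner_smul_right]
    simp only [real_inner_self_eq_norm_sq, inner_cross_left, inner_cross_right, hen, h1, h2,
      real_inner_comm e n, he, hn, norm_cross_of_orthonormal he hn hen]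
    have hs := Real.sq_sqrt (show 0 ≤ 1 - (z₀ + α) ^ 2 by linarith)
    have ht := Real.sin_sq_add_cos_sq β
    linear_combination hs + (Real.sqrt (1 - (z₀ + α) ^ 2)) ^ 2 * ht
  nlinarith [norm_nonneg (circlePoint e n z₀ α β)]

theorem hasDerivAt_circlePoint (hr : 0 < r₀) (hzr : z₀ ^ 2 + r₀ ^ 2 = 1) (α β : ℝ) :
    HasDerivAt (fun s : ℝ => circlePoint e n z₀ (s * α) (s * β))
      (α • (e - (z₀ / r₀) • n) + (r₀ * β) • cross e n) 0 := by
  have hsq : Real.sqrt (1 - z₀ ^ 2) = r₀ := by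
    rw [Real.sqrt_eq_iff_mul_self_eq_of_pos hr]; linarith [hzr]
  have h1 : HasDerivAt (fun s : ℝ => z₀ + s * α) α 0 := by
    simpa using ((hasDerivAt_id (0 : ℝ)).mul_const α).const_add z₀
  have h2 : HasDerivAt (fun s : ℝ => s * β) β 0 := by
    simpa using (hasDerivAt_id (0 : ℝ)).mul_const β
  have hne : 1 - z₀ ^ 2 ≠ 0 := by nlinarith
  have h3 : HasDerivAt (fun s : ℝ => Real.sqrt (1 - (z₀ + s * α) ^ 2)) (-(z₀ * α) / r₀) 0 := by
    have := ((h1.pow 2).const_sub 1).sqrt (by simpa using hne)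
    refine this.congr_deriv ?_
    simp only [Pi.pow_apply, zero_mul, add_zero, hsq, Nat.cast_ofNat]
    field_simp
    try ring
  have h4 := (h1.smul_const e).add (h3.smul ((h2.cos.smul_const n).add
    (h2.sin.smul_const (cross e n))))
  refine h4.congr_deriv ?_
  simp only [Pi.add_apply, zero_mul, add_zero, hsq, Real.cos_zero, Real.sin_zero]
  match_scalars <;> field_simp <;> ring

theorem circlePoint_zero (hr : 0 < r₀) (hzr : z₀ ^ 2 + r₀ ^ 2 = 1) :
    circlePoint e n z₀ 0 0 = z₀ • e + r₀ • n := by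
  have hsq : Real.sqrt (1 - z₀ ^ 2) = r₀ := by
    rw [Real.sqrt_eq_iff_mul_self_eq_of_pos hr]; linarith [hzr]
  simp [circlePoint, hsq]

theorem circlePoint_contDiffOn {E : Type} [NormedAddCommGroup E] [NormedSpace ℝ E]
    {f : E → E3} {p q : E → ℝ} {s : Set E} (e : E3) (hf : ContDiffOn ℝ ∞ f s)
    (hp : ContDiffOn ℝ ∞ p s) (hq : ContDiffOn ℝ ∞ q s) (hpz : ∀ x ∈ s, (z₀ + p x) ^ 2 < 1) :
    ContDiffOn ℝ ∞ (fun x => circlePoint e (f x) z₀ (p x) (q x)) s := by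
  have h1 : ContDiffOn ℝ ∞ (fun x => z₀ + p x) s := contDiffOn_const.add hp
  exact (h1.smul contDiffOn_const).add (((contDiffOn_const.sub (h1.pow 2)).sqrt fun x hx =>
    (sub_pos.2 (hpz x hx)).ne').smul (((Real.contDiff_cos.comp_contDiffOn hq).smul hf).add
      ((Real.contDiff_sin.comp_contDiffOn hq).smul (contDiffOn_const.cross hf))))

namespace IsCircleFrame

variable {a b : ℝ} {T : ℝ → E3} {e : E3} {n : ℝ → E3} {z₀ r₀ κ : ℝ}

theorem hasDerivAt_n (C : IsCircleFrame a b T e n z₀ r₀ κ) {x : ℝ} (hx : x ∈ Ioo a b) :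
    HasDerivAt n (κ • cross e (n x)) x := by
  rw [← C.D_n x (Ioo_subset_Icc_self hx)]; exact C.smooth_n.hasDerivAt hx

theorem hasDerivAt_cross (C : IsCircleFrame a b T e n z₀ r₀ κ) {x : ℝ} (hx : x ∈ Ioo a b) :
    HasDerivAt (fun x => cross e (n x)) (-κ • n x) x := by
  refine ((crossL e).hasFDerivAt.comp_hasDerivAt x (C.hasDerivAt_n hx)).congr_deriv ?_
  rw [map_smul, crossL_apply, cross_e_cross C.norm_e (C.inner_en x (Ioo_subset_Icc_self hx))]
  module

/-- Around the axis e the potential is height times the differential of the longitude, and here the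
longitude moves with velocity ψ' + κ. -/
theorem connectionForm_eq (C : IsCircleFrame a b T e n z₀ r₀ κ) {ζ ψ : ℝ → ℝ} {ψ' x : ℝ}
    (hx : x ∈ Ioo a b) (hζ : DifferentiableAt ℝ ζ x) (hψ : HasDerivAt ψ ψ' x)
    (hz : (z₀ + ζ x) ^ 2 < 1) :
    connectionForm a b e (fun y => circlePoint e (n y) z₀ (ζ y) (ψ y)) x =
      (z₀ + ζ x) * (ψ' + κ) := by
  have hx' := Ioo_subset_Icc_self hx
  have hen := C.inner_en x hx'
  have hn := C.norm_n x hx'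
  have hpos : 0 < 1 - (z₀ + ζ x) ^ 2 := by linarith
  have h1 : HasDerivAt (fun y => z₀ + ζ y) (deriv ζ x) x := hζ.hasDerivAt.const_add z₀
  have h2 := ((h1.pow 2).const_sub 1).sqrt hpos.ne'
  set R' := -(↑2 * (z₀ + ζ x) ^ (2 - 1) * deriv ζ x) / (2 * Real.sqrt (1 - (z₀ + ζ x) ^ 2))
  have h3 := (h1.smul_const e).add (h2.smul ((hψ.cos.smul (C.hasDerivAt_n hx)).add
    (hψ.sin.smul (C.hasDerivAt_cross hx))))
  have h4 : D a b 1 (fun y => circlePoint e (n y) z₀ (ζ y) (ψ y)) x = _ :=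
    h3.hasDerivWithinAt.D_one_eq C.lt hx'
  have hcross : cross e (circlePoint e (n x) z₀ (ζ x) (ψ x)) =
      Real.sqrt (1 - (z₀ + ζ x) ^ 2) •
        (Real.cos (ψ x) • cross e (n x) - Real.sin (ψ x) • n x) := by
    simp only [circlePoint, cross_add_right, cross_smul_right, cross_self_eq_zero,
      cross_e_cross C.norm_e hen]
    module
  have e1 : inner ℝ e (cross e (n x)) = 0 := by rw [real_inner_comm, inner_cross_left]
  have e2 : inner ℝ (n x) (cross e (n x)) = 0 := by rw [real_inner_comm, inner_cross_right]
  have e3 : inner ℝ (n x) e = 0 := by rw [real_inner_comm, hen]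
  have hs := Real.sq_sqrt hpos.le
  rw [connectionForm, h4, areaPotential, hcross, inner_circlePoint C.norm_e hen, C.norm_e]
  simp only [inner_add_right, inner_sub_left, real_inner_smul_left,
    real_inner_smul_right, Pi.add_apply, Pi.pow_apply, Pi.smul_apply']
  simp only [inner_cross_left, inner_cross_right, e2, e3,
    real_inner_self_eq_norm_sq, hn, norm_cross_of_orthonormal C.norm_e hn hen, one_pow]
  set S := Real.sqrt (1 - (z₀ + ζ x) ^ 2)
  have ht := Real.sin_sq_add_cos_sq (ψ x)
  have hq : (1 - (z₀ + ζ x) ^ 2) ≠ 0 := hpos.ne'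
  -- The squared radius of the parallel cancels the denominator of the potential.
  have hQ : z₀ + ζ x = (z₀ + ζ x) / (1 - (z₀ + ζ x) ^ 2) * S ^ 2 := by
    rw [hs, div_mul_cancel₀ _ hq]
  linear_combination ((z₀ + ζ x) / (1 - (z₀ + ζ x) ^ 2) * S ^ 2 * (ψ' + κ)) * ht - (ψ' + κ) * hQ

end IsCircleFrame

end CircleFrame

/-! ### Explicit admissible variations over a circle. -/

section CircleFamily

variable {a b : ℝ}

theorem connectionForm_congr {T S : ℝ → E3} (v : E3) (h : EqOn T S (Icc a b)) {x : ℝ}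
    (hx : x ∈ Icc a b) : connectionForm a b v T x = connectionForm a b v S x := by
  rw [connectionForm, connectionForm, h hx, D_congr 1 h hx]

theorem integral_deriv_eq_zero {ψ : ℝ → ℝ} (hψ : ψ ∈ testFunctions ℝ a b) :
    ∫ x in a..b, deriv ψ x = 0 := by
  obtain ⟨hs, c, d, hc, hd, h0⟩ := hψ
  have hcont : Continuous (deriv ψ) := hs.continuous_deriv (by simp)
  rw [intervalIntegral.integral_deriv_eq_sub
    (fun x _ => hs.differentiable (by simp) x) (hcont.intervalIntegrable _ _),
    h0 b fun h => by linarith [h.2], h0 a fun h => by linarith [h.1], sub_zero]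

theorem exists_bound_of_testFunction {ζ : ℝ → ℝ} (hζ : ζ ∈ testFunctions ℝ a b) :
    ∃ M, 0 < M ∧ ∀ x, |ζ x| ≤ M := by
  obtain ⟨hs, c, d, hc, hd, h0⟩ := hζ
  obtain ⟨M, hM⟩ := (isCompact_Icc (a := c) (b := d)).exists_bound_of_continuousOn
    hs.continuous.continuousOn
  refine ⟨max M 1, by positivity, fun x => ?_⟩
  by_cases hx : x ∈ Ioo c d
  · exact (hM x (Ioo_subset_Icc_self hx)).trans (le_max_left _ _)
  · rw [h0 x hx, abs_zero]; positivity

namespace IsCircleFrame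

variable {T : ℝ → E3} {e : E3} {n : ℝ → E3} {z₀ r₀ κ : ℝ}

/-- In (z₀ + ζ)(ψ' + κ) the product ζψ' vanishes, and ζ and ψ' have integral zero. The holonomy
constraint therefore holds exactly, not merely to first order. -/
theorem integral_connectionForm (C : IsCircleFrame a b T e n z₀ r₀ κ) {ζ ψ : ℝ → ℝ}
    (hζ : ζ ∈ testFunctions ℝ a b) (hψ : ψ ∈ testFunctions ℝ a b)
    (hζψ : ∀ x, ζ x * deriv ψ x = 0) (hint : ∫ x in a..b, ζ x = 0)
    (hz : ∀ x, (z₀ + ζ x) ^ 2 < 1) :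
    ∫ x in a..b, connectionForm a b e (fun y => circlePoint e (n y) z₀ (ζ y) (ψ y)) x =
      z₀ * κ * (b - a) := by
  have h1 : ∫ x in a..b, connectionForm a b e (fun y => circlePoint e (n y) z₀ (ζ y) (ψ y)) x =
      ∫ x in a..b, (z₀ * deriv ψ x + κ * ζ x + z₀ * κ) := by
    refine intervalIntegral_congr_Ioo C.lt.le fun x hx => ?_
    rw [C.connectionForm_eq hx (hζ.1.differentiable (by simp) x)
      (hψ.1.differentiable (by simp) x).hasDerivAt (hz x)]
    linear_combination hζψ x
  have hc1 : Continuous fun x => z₀ * deriv ψ x :=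
    continuous_const.mul (hψ.1.continuous_deriv (by simp))
  have hc2 : Continuous fun x => κ * ζ x := continuous_const.mul hζ.1.continuous
  have hc3 : Continuous fun x => z₀ * deriv ψ x + κ * ζ x := hc1.add hc2
  rw [h1, intervalIntegral.integral_add (hc3.intervalIntegrable _ _)
    (continuous_const.intervalIntegrable _ _), intervalIntegral.integral_add
    (hc1.intervalIntegrable _ _) (hc2.intervalIntegrable _ _),
    intervalIntegral.integral_const_mul, intervalIntegral.integral_const_mul, hint,
    integral_deriv_eq_zero hψ, intervalIntegral.integral_const]
  simp; ring

/-- Tangents running at varying height and longitude over the circle. -/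
noncomputable def circleFamily (e : E3) (n : ℝ → E3) (z₀ : ℝ) {ι : Type} [Fintype ι]
    (ζ ψ₀ : ℝ → ℝ) (ψ : ι → ℝ → ℝ) (q : (ℝ × (ι → ℝ)) × ℝ) : E3 :=
  circlePoint e (n q.2) z₀ ((q.1.1 • ζ) q.2) ((q.1.1 • ψ₀ + ∑ j, q.1.2 j • ψ j) q.2)

variable {ι : Type} [Fintype ι] {ζ ψ₀ : ℝ → ℝ} {ψ : ι → ℝ → ℝ}

theorem isTangentFamily (C : IsCircleFrame a b T e n z₀ r₀ κ) (hT : SmoothOnIcc a b T) {c d : ℝ}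
    (hac : a < c) (hdb : d < b) (hζ : ContDiff ℝ ∞ ζ) (hψ₀ : ContDiff ℝ ∞ ψ₀)
    (hψ : ∀ j, ContDiff ℝ ∞ (ψ j)) (hζ0 : ∀ x, x ∉ Ioo c d → ζ x = 0)
    (hψ₀0 : ∀ x, x ∉ Ioo c d → ψ₀ x = 0) (hψ0 : ∀ j x, x ∉ Ioo c d → ψ j x = 0)
    {W : Set (ℝ × (ι → ℝ))} (hW : IsOpen W) (hz : ∀ p ∈ W, ∀ x, (z₀ + p.1 * ζ x) ^ 2 < 1) :
    IsTangentFamily a b c d T W (circleFamily e n z₀ ζ ψ₀ ψ) := by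
  have hoff : ∀ (p : ℝ × (ι → ℝ)) (x : ℝ), x ∈ Icc a b → x ∉ Ioo c d →
      circleFamily e n z₀ ζ ψ₀ ψ (p, x) = T x := fun p x hx hx' => by
    rw [C.eq_T x hx, ← circlePoint_zero C.pos C.sq_add_sq]
    simp [circleFamily, hζ0 x hx', hψ₀0 x hx', hψ0 _ x hx']
  refine ⟨⟨hW, hac, hdb, C.lt.le, ?_, hT.Ioo, fun p _ x hx hx' =>
    hoff p x (Ioo_subset_Icc_self hx) hx'⟩, C.lt, hT, fun p hp x hx => ?_,
    fun p _ x hx hx' => hoff p x hx hx'⟩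
  · have h1 : ContDiff ℝ ∞ fun q : (ℝ × (ι → ℝ)) × ℝ => q.1.1 := by fun_prop
    refine circlePoint_contDiffOn e (C.smooth_n.Ioo.comp contDiffOn_snd fun q hq => hq.2)
      ((h1.mul (hζ.comp contDiff_snd)).contDiffOn) ?_ fun q hq => hz q.1 hq.1 q.2
    have h2 : ContDiff ℝ ∞ fun q : (ℝ × (ι → ℝ)) × ℝ =>
        q.1.1 * ψ₀ q.2 + ∑ j, q.1.2 j * ψ j q.2 := by
      refine (h1.mul (hψ₀.comp contDiff_snd)).add (ContDiff.sum fun j _ => ?_)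
      have h3 : ContDiff ℝ ∞ fun q : (ℝ × (ι → ℝ)) × ℝ => q.1.2 j := by fun_prop
      exact h3.mul ((hψ j).comp contDiff_snd)
    refine h2.contDiffOn.congr fun q _ => ?_
    simp [Finset.sum_apply]
  · exact norm_circlePoint C.norm_e (C.norm_n x hx) (C.inner_en x hx) (hz p hp x)

/-- The variation field of height `ζ` and longitude `ψ`. -/
noncomputable def circleField (e : E3) (n : ℝ → E3) (z₀ r₀ : ℝ) (ζ ψ : ℝ → ℝ) (x : ℝ) : E3 :=
  ζ x • (e - (z₀ / r₀) • n x) + (r₀ * ψ x) • cross e (n x)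

theorem circleField_contDiffOn (C : IsCircleFrame a b T e n z₀ r₀ κ) {ζ ψ : ℝ → ℝ}
    (hζ : ContDiff ℝ ∞ ζ) (hψ : ContDiff ℝ ∞ ψ) :
    ContDiffOn ℝ ∞ (circleField e n z₀ r₀ ζ ψ) (Ioo a b) := by
  have h1 : ContDiffOn ℝ ∞ (fun x => (z₀ / r₀) • n x) (Ioo a b) :=
    C.smooth_n.Ioo.const_smul (z₀ / r₀)
  have h2 : ContDiffOn ℝ ∞ (fun x => ζ x • (e - (z₀ / r₀) • n x)) (Ioo a b) :=
    hζ.contDiffOn.smul (contDiffOn_const.sub h1)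
  have h3 : ContDiffOn ℝ ∞ (fun x => cross e (n x)) (Ioo a b) :=
    contDiffOn_const.cross C.smooth_n.Ioo
  have h4 : ContDiffOn ℝ ∞ (fun x => r₀ * ψ x) (Ioo a b) := contDiffOn_const.mul hψ.contDiffOn
  exact h2.add (h4.smul h3)

theorem intervalIntegrable_circleField (C : IsCircleFrame a b T e n z₀ r₀ κ) {ζ ψ : ℝ → ℝ}
    (hζ : ζ ∈ testFunctions ℝ a b) (hψ : ψ ∈ testFunctions ℝ a b) :
    IntervalIntegrable (circleField e n z₀ r₀ ζ ψ) volume a b := by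
  obtain ⟨c, d, hac, hdb, h0⟩ := exists_common_support (a := a) (b := b)
    (w := fun i : Bool => cond i ζ ψ) fun i => by cases i <;> assumption
  refine intervalIntegrable_of_support C.lt.le hac hdb (C.circleField_contDiffOn hζ.1 hψ.1)
    fun x _ hx => ?_
  have h1 : ζ x = 0 := h0 true x hx
  have h2 : ψ x = 0 := h0 false x hx
  simp [circleField, h1, h2]

/-- Two vectors which together with the axis span space. -/
def lateralFrame (a : ℝ) (e : E3) (n : ℝ → E3) : Fin 2 → E3 := ![n a, cross e (n a)]

variable {γ : ℝ → E3} {ρ : ℝ → ℝ}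

/-- Along the whole family the total connection form and the axial component of the total tangent
are constant. Only its two lateral components have to be held by the implicit function theorem, and
the longitudes ψ j make these a submersion. -/
theorem integral_eq_zero (C : IsCircleFrame a b (D a b 1 γ) e n z₀ r₀ κ)
    (hγ : IsArcLengthCurve a b γ) (hρ : SmoothOnIcc a b ρ)
    (hel : IsHolonomyConstrainedElastic a b ρ γ) {ψ : Fin 2 → ℝ → ℝ}
    (hζ : ζ ∈ testFunctions ℝ a b) (hψ₀ : ψ₀ ∈ testFunctions ℝ a b)
    (hψ : ∀ j, ψ j ∈ testFunctions ℝ a b)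
    (hζψ₀ : ∀ x, ζ x * deriv ψ₀ x = 0) (hζψ : ∀ j x, ζ x * deriv (ψ j) x = 0)
    (hint : ∫ x in a..b, ζ x = 0)
    (h₀ : ∀ i, ∫ x in a..b, inner ℝ (lateralFrame a e n i) (circleField e n z₀ r₀ ζ ψ₀ x) = 0)
    (hdual : ∀ i j, ∫ x in a..b, inner ℝ (lateralFrame a e n i)
      (circleField e n z₀ r₀ 0 (ψ j) x) = (Pi.single j 1 : Fin 2 → ℝ) i) :
    ∫ x in a..b, inner ℝ (tangentGradient a b ρ (D a b 1 γ) x)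
      (circleField e n z₀ r₀ ζ ψ₀ x) = 0 := by
  set T := D a b 1 γ with hTdef
  have hab := C.lt
  have hT : SmoothOnIcc a b T := SmoothOnIcc.D_one hab hγ.1.1
  have ha : a ∈ Icc a b := left_mem_Icc.2 hab.le
  obtain ⟨M, hM, hζM⟩ := exists_bound_of_testFunction hζ
  have hz₀ : |z₀| < 1 := (sq_lt_one_iff_abs_lt_one z₀).1 (by nlinarith [C.pos, C.sq_add_sq])
  -- For parameters below this bound the heights z₀ + tζ stay strictly between the poles.
  set ε := (1 - |z₀|) / M with hε
  have hεpos : 0 < ε := div_pos (by linarith) hM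
  set W : Set (ℝ × (Fin 2 → ℝ)) := Ioo (-ε) ε ×ˢ univ with hW
  have hWo : IsOpen W := isOpen_Ioo.prod isOpen_univ
  have h0W : (0 : ℝ × (Fin 2 → ℝ)) ∈ W := ⟨⟨neg_lt_zero.2 hεpos, hεpos⟩, mem_univ _⟩
  have hz : ∀ p ∈ W, ∀ x, (z₀ + p.1 * ζ x) ^ 2 < 1 := by
    intro p hp x
    rw [sq_lt_one_iff_abs_lt_one]
    have h1 : |p.1| * |ζ x| < ε * M :=
      (mul_le_mul_of_nonneg_left (hζM x) (abs_nonneg _)).trans_lt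
        (mul_lt_mul_of_pos_right (abs_lt.2 hp.1) hM)
    have h2 : ε * M = 1 - |z₀| := div_mul_cancel₀ _ hM.ne'
    calc |z₀ + p.1 * ζ x| ≤ |z₀| + |p.1 * ζ x| := abs_add_le _ _
      _ = |z₀| + |p.1| * |ζ x| := by rw [abs_mul]
      _ < 1 := by linarith
  obtain ⟨c, d, hac, hdb, hsupp⟩ := exists_common_support (a := a) (b := b) (F := ℝ)
    (w := fun i : Option (Option (Fin 2)) => i.elim ζ fun j => j.elim ψ₀ ψ) fun i => by
      rcases i with _ | _ | j
      · exact hζ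
      · exact hψ₀
      · exact hψ j
  set τ := circleFamily e n z₀ ζ ψ₀ ψ with hτ
  have hfam : IsTangentFamily a b c d T W τ :=
    C.isTangentFamily hT hac hdb hζ.1 hψ₀.1 (fun j => (hψ j).1) (hsupp none) (hsupp (some none))
      (fun j => hsupp (some (some j))) hWo hz
  have hτ0 : ∀ x ∈ Icc a b, τ (0, x) = T x := fun x hx => by
    rw [C.eq_T x hx, ← circlePoint_zero C.pos C.sq_add_sq]
    simp [hτ, circleFamily]
  have hds : ∀ x, HasDerivAt (fun s : ℝ => τ ((s, 0), x)) (circleField e n z₀ r₀ ζ ψ₀ x) 0 :=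
    fun x => by
      have := hasDerivAt_circlePoint (e := e) (n := n x) C.pos C.sq_add_sq (ζ x) (ψ₀ x)
      simpa [hτ, circleFamily, circleField] using this
  have hdr : ∀ j x, HasDerivAt (fun s : ℝ => τ ((0, Pi.single j s), x))
      (circleField e n z₀ r₀ 0 (ψ j) x) 0 := fun j x => by
    have := hasDerivAt_circlePoint (e := e) (n := n x) C.pos C.sq_add_sq 0 (ψ j x)
    have h2 : ∀ s : ℝ, ∑ k, (Pi.single j s : Fin 2 → ℝ) k • ψ k = s • ψ j := fun s => by
      rw [Finset.sum_eq_single j]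
      · simp
      · intro k _ hk; simp [hk]
      · simp
    simpa [hτ, circleFamily, circleField, h2] using this
  have hinner : ∀ p ∈ W, ∀ x ∈ Icc a b, inner ℝ e (τ (p, x)) = z₀ + p.1 * ζ x :=
    fun p _ x hx => inner_circlePoint C.norm_e (C.inner_en x hx)
  have hv : ∀ p ∈ W, ∀ x ∈ Icc a b, ‖e‖ ^ 2 - inner ℝ e (τ (p, x)) ^ 2 ≠ 0 := by
    intro p hp x hx
    rw [hinner p hp x hx, C.norm_e, one_pow]
    exact (sub_pos.2 (hz p hp x)).ne'
  have hvT : ∀ x ∈ Icc a b, ‖e‖ ^ 2 - inner ℝ e (T x) ^ 2 ≠ 0 := fun x hx => by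
    rw [← hτ0 x hx]; exact hv 0 h0W x hx
  have hTi : IntervalIntegrable T volume a b :=
    ContinuousOn.intervalIntegrable_Icc' hab.le (ContDiffOn.continuousOn hT)
  have hτi : ∀ p ∈ W, IntervalIntegrable (fun x => τ (p, x)) volume a b := fun p hp =>
    ContinuousOn.intervalIntegrable_Icc' hab.le (ContDiffOn.continuousOn (hfam.smooth_slice hp))
  have hpull : ∀ (v : E3) (u : ℝ → E3), IntervalIntegrable u volume a b →
      inner ℝ v (∫ x in a..b, u x) = ∫ x in a..b, inner ℝ v (u x) := fun v u hu =>
    ((innerSL ℝ v).intervalIntegral_comp_comm hu).symm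
  have hI := hfam.contDiffOn_integral hTi
  set f : ℝ × (Fin 2 → ℝ) → Fin 2 → ℝ := fun p i =>
    inner ℝ (lateralFrame a e n i) (∫ x in a..b, τ (p, x)) with hf
  have hfs : ContDiffOn ℝ ∞ f W := contDiffOn_pi.2 fun i => contDiffOn_const.inner ℝ hI
  have hline : ∀ (l : ℝ → ℝ × (Fin 2 → ℝ)) (ζ' ψ' : ℝ → ℝ), ContDiff ℝ ∞ l → l 0 = 0 →
      ζ' ∈ testFunctions ℝ a b → ψ' ∈ testFunctions ℝ a b →
      (∀ x, HasDerivAt (fun s => τ (l s, x)) (circleField e n z₀ r₀ ζ' ψ' x) 0) →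
      HasDerivAt (fun s => f (l s)) (fun i => ∫ x in a..b, inner ℝ (lateralFrame a e n i)
        (circleField e n z₀ r₀ ζ' ψ' x)) 0 := by
    intro l ζ' ψ' hl hl0 h1 h2 hd
    refine hasDerivAt_pi.2 fun i => ?_
    have h3 := hfam.hasDerivAt_integral_line hl (by rw [hl0]; exact h0W) fun x _ => hd x
    have h4 := (innerSL ℝ (lateralFrame a e n i)).hasFDerivAt.comp_hasDerivAt (0 : ℝ) h3
    refine h4.congr_deriv ?_
    exact hpull _ _ (C.intervalIntegrable_circleField h1 h2)
  have hs := hline (fun s => (s, 0)) ζ ψ₀ (contDiff_id.prodMk contDiff_const) rfl hζ hψ₀ hds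
  have hr := fun j => hline (fun s => (0, Pi.single j s)) 0 (ψ j) (contDiff_pi_single j)
    (by rw [Pi.single_zero]; rfl) (Submodule.zero_mem _) (hψ j) (hdr j)
  have hie : ∀ p ∈ W, inner ℝ e (∫ x in a..b, τ (p, x)) = z₀ * (b - a) := by
    intro p hp
    rw [hpull _ _ (hτi p hp)]
    have h1 : ∫ x in a..b, inner ℝ e (τ (p, x)) = ∫ x in a..b, (z₀ + p.1 * ζ x) :=
      intervalIntegral_congr_Ioo hab.le fun x hx => hinner p hp x (Ioo_subset_Icc_self hx)
    have h2 : Continuous fun x => p.1 * ζ x := continuous_const.mul hζ.1.continuous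
    rw [h1, intervalIntegral.integral_add (continuous_const.intervalIntegrable _ _)
      (h2.intervalIntegrable _ _),
      intervalIntegral.integral_const_mul, hint, intervalIntegral.integral_const]
    simp; ring
  have hI0 : ∫ x in a..b, τ (0, x) = ∫ x in a..b, T x :=
    intervalIntegral_congr_Ioo hab.le fun x hx => hτ0 x (Ioo_subset_Icc_self hx)
  have hclosed : ∀ p ∈ W, f p = f 0 → ∫ x in a..b, τ (p, x) = ∫ x in a..b, T x := by
    intro p hp hfp
    rw [← hI0, ← sub_eq_zero]
    have h1 := congrFun hfp 0
    have h2 := congrFun hfp 1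
    simp only [hf, lateralFrame, Matrix.cons_val_zero, Matrix.cons_val_one] at h1 h2
    refine eq_zero_of_frame C.norm_e (C.norm_n a ha) (C.inner_en a ha) ?_ ?_ ?_
    · rw [real_inner_comm, inner_sub_right, hie p hp, hie 0 h0W, sub_self]
    · rw [real_inner_comm, inner_sub_right, h1, sub_self]
    · rw [real_inner_comm, inner_sub_right, h2, sub_self]
  have hco : ∀ p ∈ W, ∫ x in a..b, connectionForm a b e (fun y => τ (p, y)) x =
      z₀ * κ * (b - a) := by
    intro p hp
    have hm : p.1 • ψ₀ + ∑ j, p.2 j • ψ j ∈ testFunctions ℝ a b :=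
      Submodule.add_mem _ (Submodule.smul_mem _ _ hψ₀)
        (Submodule.sum_mem _ fun j _ => Submodule.smul_mem _ _ (hψ j))
    have hm' : p.1 • ζ ∈ testFunctions ℝ a b := Submodule.smul_mem _ _ hζ
    refine C.integral_connectionForm (ζ := p.1 • ζ) (ψ := p.1 • ψ₀ + ∑ j, p.2 j • ψ j) hm' hm
      (fun x => ?_) ?_ (hz p hp)
    · have hd : HasDerivAt (p.1 • ψ₀ + ∑ j, p.2 j • ψ j)
          (p.1 • deriv ψ₀ x + ∑ j, p.2 j • deriv (ψ j) x) x :=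
        ((hψ₀.1.differentiable (by simp) x).hasDerivAt.const_smul p.1).add
          (HasDerivAt.sum fun j _ =>
            ((hψ j).1.differentiable (by simp) x).hasDerivAt.const_smul (p.2 j))
      rw [hd.deriv, Fin.sum_univ_two]
      simp only [Pi.smul_apply, smul_eq_mul]
      linear_combination p.1 ^ 2 * hζψ₀ x + p.1 * p.2 0 * hζψ 0 x + p.1 * p.2 1 * hζψ 1 x
    · simp only [Pi.smul_apply, smul_eq_mul, intervalIntegral.integral_const_mul, hint, mul_zero]
  have hco0 : ∫ x in a..b, connectionForm a b e T x = z₀ * κ * (b - a) := by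
    rw [← hco 0 h0W]
    exact intervalIntegral_congr_Ioo hab.le fun x hx =>
      connectionForm_congr e (fun y hy => (hτ0 y hy).symm) (Ioo_subset_Icc_self hx)
  have key := hel.integral_eq_zero_of_level hab hγ hρ hfam h0W
    (fun x hx => hτ0 x (Ioo_subset_Icc_self hx)) hvT hv hfs
    (hs.congr_deriv (funext fun i => h₀ i)) (fun j => (hr j).congr_deriv (funext fun i => hdual i j))
    hclosed (fun p hp _ => (hco p hp).trans hco0.symm)
  refine Eq.trans (intervalIntegral_congr_Ioo hab.le fun x hx => ?_) key
  rw [(hds x).deriv]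

end IsCircleFrame

end CircleFamily

/-! ### The Lagrange condition when the tangent runs on a circle. -/

section CircleMultipliers

variable {a b : ℝ}

/-- Height variations to the left of c and longitude variations to its right do not interact in the
connection integrand. -/
theorem mul_deriv_eq_zero_of_disjoint {c : ℝ} {ζ ψ : ℝ → ℝ} (hζ : ζ ∈ testFunctions ℝ a c)
    (hψ : ψ ∈ testFunctions ℝ c b) (x : ℝ) : ζ x * deriv ψ x = 0 := by
  obtain ⟨-, p, q, -, hq, h0⟩ := hζ
  obtain ⟨-, p', q', hp', -, h0'⟩ := hψ
  rcases lt_or_ge x c with hx | hx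
  · have h1 : ψ =ᶠ[𝓝 x] fun _ => 0 := by
      filter_upwards [Iio_mem_nhds hx] with y hy
      exact h0' y fun h => by linarith [h.1, show y < c from hy]
    rw [h1.deriv_eq, deriv_const, mul_zero]
  · rw [h0 x fun h => by linarith [h.2], zero_mul]

namespace IsCircleFrame

variable {T : ℝ → E3} {e : E3} {n : ℝ → E3} {z₀ r₀ κ : ℝ}

/-- The height component of a vector field along the circle. -/
noncomputable def heightPart (e : E3) (n : ℝ → E3) (z₀ r₀ : ℝ) (X : ℝ → E3) (x : ℝ) : ℝ :=
  inner ℝ (X x) (e - (z₀ / r₀) • n x)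

/-- The longitude component of a vector field along the circle. -/
noncomputable def longitudePart (e : E3) (n : ℝ → E3) (r₀ : ℝ) (X : ℝ → E3) (x : ℝ) : ℝ :=
  r₀ * inner ℝ (X x) (cross e (n x))

theorem inner_circleField (X : ℝ → E3) (ζ ψ : ℝ → ℝ) (x : ℝ) :
    inner ℝ (X x) (circleField e n z₀ r₀ ζ ψ x) =
      inner ℝ (heightPart e n z₀ r₀ X x) (ζ x) + inner ℝ (longitudePart e n r₀ X x) (ψ x) := by
  simp only [circleField, heightPart, longitudePart, inner_add_right, real_inner_smul_right,
    RCLike.inner_apply, conj_trivial]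
  ring

theorem heightPart_contDiffOn (C : IsCircleFrame a b T e n z₀ r₀ κ) {X : ℝ → E3}
    (hX : ContDiffOn ℝ ∞ X (Ioo a b)) : ContDiffOn ℝ ∞ (heightPart e n z₀ r₀ X) (Ioo a b) := by
  have h1 : ContDiffOn ℝ ∞ (fun x => (z₀ / r₀) • n x) (Ioo a b) :=
    C.smooth_n.Ioo.const_smul (z₀ / r₀)
  exact hX.inner ℝ (contDiffOn_const.sub h1)

theorem longitudePart_contDiffOn (C : IsCircleFrame a b T e n z₀ r₀ κ) {X : ℝ → E3}
    (hX : ContDiffOn ℝ ∞ X (Ioo a b)) : ContDiffOn ℝ ∞ (longitudePart e n r₀ X) (Ioo a b) := by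
  have h1 : ContDiffOn ℝ ∞ (fun x => cross e (n x)) (Ioo a b) :=
    contDiffOn_const.cross C.smooth_n.Ioo
  exact contDiffOn_const.mul (hX.inner ℝ h1)

theorem integral_inner_circleField (C : IsCircleFrame a b T e n z₀ r₀ κ) {X : ℝ → E3}
    (hX : ContDiffOn ℝ ∞ X (Ioo a b)) {ζ ψ : ℝ → ℝ} (hζ : ζ ∈ testFunctions ℝ a b)
    (hψ : ψ ∈ testFunctions ℝ a b) :
    ∫ x in a..b, inner ℝ (X x) (circleField e n z₀ r₀ ζ ψ x) =
      (∫ x in a..b, inner ℝ (heightPart e n z₀ r₀ X x) (ζ x)) +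
        ∫ x in a..b, inner ℝ (longitudePart e n r₀ X x) (ψ x) := by
  rw [← intervalIntegral.integral_add
    (intervalIntegrable_inner_test C.lt.le (C.heightPart_contDiffOn hX) hζ)
    (intervalIntegrable_inner_test C.lt.le (C.longitudePart_contDiffOn hX) hψ)]
  simp only [inner_circleField]

theorem inner_e_lateralFrame (C : IsCircleFrame a b T e n z₀ r₀ κ) (i : Fin 2) :
    inner ℝ (lateralFrame a e n i) e = 0 := by
  have ha : a ∈ Icc a b := left_mem_Icc.2 C.lt.le
  fin_cases i
  · simpa [lateralFrame, real_inner_comm] using C.inner_en a ha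
  · simp [lateralFrame, inner_cross_left]

theorem inner_lateralFrame (C : IsCircleFrame a b T e n z₀ r₀ κ) (i j : Fin 2) :
    inner ℝ (lateralFrame a e n i) (lateralFrame a e n j) = if i = j then (1 : ℝ) else 0 := by
  have ha : a ∈ Icc a b := left_mem_Icc.2 C.lt.le
  have h1 := norm_cross_of_orthonormal C.norm_e (C.norm_n a ha) (C.inner_en a ha)
  have h2 : inner ℝ (cross e (n a)) (n a) = 0 := inner_cross_right _ _
  have h3 : inner ℝ (n a) (cross e (n a)) = 0 := by rw [real_inner_comm, h2]
  fin_cases i <;> fin_cases j <;>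
    simp [lateralFrame, h1, h2, h3, C.norm_n a ha]

/-- The longitude components of the lateral frame have dual test functions on any subinterval. -/
theorem exists_dual (C : IsCircleFrame a b T e n z₀ r₀ κ) {c d : ℝ} (hac : a ≤ c) (hcd : c < d)
    (hdb : d ≤ b) : ∃ ψ : Fin 2 → ℝ → ℝ, (∀ j, ψ j ∈ testFunctions ℝ c d) ∧
      ∀ i j, ∫ x in a..b, inner ℝ (longitudePart e n r₀ (fun _ => lateralFrame a e n i) x) (ψ j x) =
        (Pi.single j 1 : Fin 2 → ℝ) i := by
  rcases exists_dual_or_relation C.lt.le hac hdb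
    (f := fun i => longitudePart e n r₀ (fun _ => lateralFrame a e n i))
    (fun i => C.longitudePart_contDiffOn contDiffOn_const) with h | ⟨l, hl0, hl⟩
  · exact h
  refine absurd ?_ hl0
  -- A relation says that L is orthogonal to e × n on an interval. Differentiation gives
  -- orthogonality to n since κ ≠ 0, and L is orthogonal to e by construction, so L = 0.
  set L : E3 := ∑ i, l i • lateralFrame a e n i with hL
  have hLm : ∀ x ∈ Ioo c d, inner ℝ L (cross e (n x)) = 0 := by
    intro x hx
    have h1 := hl x hx
    simp only [longitudePart, smul_eq_mul] at h1
    have h2 : r₀ * inner ℝ L (cross e (n x)) = 0 := by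
      rw [← h1, hL, sum_inner, Finset.mul_sum]
      refine Finset.sum_congr rfl fun i _ => ?_
      rw [real_inner_smul_left]; ring
    exact (mul_eq_zero.1 h2).resolve_left C.pos.ne'
  set x := (c + d) / 2
  have hx : x ∈ Ioo c d := ⟨by simp only [x]; linarith, by simp only [x]; linarith⟩
  have hx' : x ∈ Ioo a b := ⟨hac.trans_lt hx.1, hx.2.trans_le hdb⟩
  have hLn : inner ℝ L (n x) = 0 := by
    have h1 := (innerSL ℝ L).hasFDerivAt.comp_hasDerivAt x (C.hasDerivAt_cross hx')
    have h2 : HasDerivAt (fun y => inner ℝ L (cross e (n y))) 0 x := by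
      refine (hasDerivAt_const x (0 : ℝ)).congr_of_eventuallyEq ?_
      filter_upwards [isOpen_Ioo.mem_nhds hx] with y hy using hLm y hy
    have h3 := h1.unique h2
    rw [map_smul, innerSL_apply_apply, smul_eq_mul] at h3
    exact (mul_eq_zero.1 h3).resolve_left (neg_ne_zero.2 C.ne_zero)
  have hLe : inner ℝ L e = 0 := by
    rw [hL, sum_inner]
    exact Finset.sum_eq_zero fun i _ => by
      rw [real_inner_smul_left, C.inner_e_lateralFrame, mul_zero]
  have hxI := Ioo_subset_Icc_self hx'
  have hL0 : L = 0 := eq_zero_of_frame C.norm_e (C.norm_n x hxI) (C.inner_en x hxI) hLe hLn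
    (hLm x hx)
  ext j
  have h1 : inner ℝ L (lateralFrame a e n j) = 0 := by rw [hL0, inner_zero_left]
  rw [hL, sum_inner] at h1
  simpa only [real_inner_smul_left, C.inner_lateralFrame, mul_ite, mul_one, mul_zero,
    Finset.sum_ite_eq', Finset.mem_univ, if_true, Pi.zero_apply] using h1

variable {γ : ℝ → E3} {ρ : ℝ → ℝ}

/-- The Euler-Lagrange equation of an elastic curve whose tangent runs on a circle. -/
theorem exists_perp_eq (C : IsCircleFrame a b (D a b 1 γ) e n z₀ r₀ κ)
    (hγ : IsArcLengthCurve a b γ) (hρ : SmoothOnIcc a b ρ)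
    (hel : IsHolonomyConstrainedElastic a b ρ γ) :
    ∃ V : E3, ∀ x ∈ Ioo a b, perp (D a b 1 γ) (tangentGradient a b ρ (D a b 1 γ)) x =
      perp (D a b 1 γ) (fun _ => V) x := by
  have hab := C.lt
  set T := D a b 1 γ with hTdef
  have hT : SmoothOnIcc a b T := SmoothOnIcc.D_one hab hγ.1.1
  set G := tangentGradient a b ρ T with hGdef
  have hG : SmoothOnIcc a b G := SmoothOnIcc.D_one hab (ContDiffOn.smul hρ (hT.D_one hab))
  set E : Fin 2 → ℝ → E3 := fun i _ => lateralFrame a e n i with hE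
  have hEs : ∀ i, ContDiffOn ℝ ∞ (E i) (Ioo a b) := fun i => contDiffOn_const
  have hA := fun {X : ℝ → E3} (hX : ContDiffOn ℝ ∞ X (Ioo a b)) => C.heightPart_contDiffOn hX
  have hB := fun {X : ℝ → E3} (hX : ContDiffOn ℝ ∞ X (Ioo a b)) => C.longitudePart_contDiffOn hX
  have hzero : ∀ X : ℝ → ℝ, ∫ x in a..b, inner ℝ (X x) ((0 : ℝ → ℝ) x) = 0 := by simp
  have hdual0 : ∀ ψ : Fin 2 → ℝ → ℝ, (∀ j, ψ j ∈ testFunctions ℝ a b) →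
      (∀ i j, ∫ x in a..b, inner ℝ (longitudePart e n r₀ (E i) x) (ψ j x) =
        (Pi.single j 1 : Fin 2 → ℝ) i) → ∀ i j, ∫ x in a..b, inner ℝ (lateralFrame a e n i)
      (circleField e n z₀ r₀ 0 (ψ j) x) = (Pi.single j 1 : Fin 2 → ℝ) i := by
    intro ψ hψ hd i j
    have := C.integral_inner_circleField (hEs i) (Submodule.zero_mem _) (hψ j)
    rw [hzero, zero_add, hd] at this
    exact this
  -- Pure longitude variations, ζ = 0, are constrained by the two lateral components only.
  obtain ⟨l, hl⟩ : ∃ l : Fin 2 → ℝ, ∀ x ∈ Ioo a b, longitudePart e n r₀ G x =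
      ∑ i, l i • longitudePart e n r₀ (E i) x := by
    refine exists_multipliers hab.le le_rfl le_rfl (hB hG.Ioo) (fun i => hB (hEs i))
      fun ψ₀ hψ₀ h0 => ?_
    obtain ⟨ψ, hψ, hd⟩ := C.exists_dual le_rfl hab le_rfl
    have key := C.integral_eq_zero hγ hρ hel (ζ := 0) (Submodule.zero_mem _) hψ₀ hψ (by simp)
      (by simp) (by simp) (fun i => ?_) (hdual0 ψ hψ hd)
    · rw [C.integral_inner_circleField hG.Ioo (Submodule.zero_mem _) hψ₀, hzero, zero_add] at key
      exact key
    · have := C.integral_inner_circleField (hEs i) (Submodule.zero_mem _) hψ₀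
      rw [hzero, zero_add, h0 i] at this
      exact this
  -- The height component left over by the lateral multipliers. Once shown to be constant, it is the
  -- axial component of V.
  set F : ℝ → ℝ := fun x => heightPart e n z₀ r₀ G x - ∑ i, l i • heightPart e n z₀ r₀ (E i) x
    with hF
  have hFs : ContDiffOn ℝ ∞ F (Ioo a b) :=
    (hA hG.Ioo).sub (ContDiffOn.sum fun i _ => (hA (hEs i)).const_smul (l i))
  -- For ζ supported in (a, c), a longitude ψ₀ supported in (c, b) repairs the lateral closing
  -- error. The mean of ζ is then the only constraint left, and its multiplier is a constant.
  have hconst : ∀ c ∈ Ioo a b, ∃ α : ℝ, ∀ x ∈ Ioo a c, F x = α := by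
    intro c hc
    obtain ⟨ψ, hψ', hd⟩ := C.exists_dual hc.1.le hc.2 le_rfl
    have hψ : ∀ j, ψ j ∈ testFunctions ℝ a b := fun j =>
      testFunctions_mono hc.1.le le_rfl (hψ' j)
    obtain ⟨α, hα⟩ := exists_multipliers (ι := Unit) (f := fun _ _ => (1 : ℝ)) hab.le le_rfl hc.2.le
      hFs (fun _ => contDiffOn_const) fun ζ hζ' h1 => by
        have hζ : ζ ∈ testFunctions ℝ a b := testFunctions_mono le_rfl hc.2.le hζ'
        have hint : ∫ x in a..b, ζ x = 0 := by simpa using h1 ()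
        -- Minus the lateral error caused by ζ; duality of the ψ j makes ψ₀ compensate it.
        set k : Fin 2 → ℝ := fun j => -∫ x in a..b, inner ℝ (heightPart e n z₀ r₀ (E j) x) (ζ x)
          with hk
        set ψ₀ : ℝ → ℝ := ∑ j, k j • ψ j with hψ₀def
        have hψ₀' : ψ₀ ∈ testFunctions ℝ c b :=
          Submodule.sum_mem _ fun j _ => Submodule.smul_mem _ _ (hψ' j)
        have hψ₀ : ψ₀ ∈ testFunctions ℝ a b := testFunctions_mono hc.1.le le_rfl hψ₀'
        have hBψ₀ : ∀ i, ∫ x in a..b, inner ℝ (longitudePart e n r₀ (E i) x) (ψ₀ x) = k i := by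
          intro i
          have e1 : ∀ x, inner ℝ (longitudePart e n r₀ (E i) x) (ψ₀ x) =
              ∑ j, k j * inner ℝ (longitudePart e n r₀ (E i) x) (ψ j x) := fun x => by
            rw [hψ₀def, Finset.sum_apply, inner_sum]
            exact Finset.sum_congr rfl fun j _ => real_inner_smul_right _ _ _
          simp only [e1]
          rw [intervalIntegral.integral_finsetSum fun j _ =>
            (intervalIntegrable_inner_test hab.le (hB (hEs i)) (hψ j)).const_mul _]
          simp only [intervalIntegral.integral_const_mul, hE, hd]
          simp [Pi.single_apply]
        have key := C.integral_eq_zero hγ hρ hel hζ hψ₀ hψ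
          (mul_deriv_eq_zero_of_disjoint hζ' hψ₀')
          (fun j => mul_deriv_eq_zero_of_disjoint hζ' (hψ' j)) hint (fun i => ?_) (hdual0 ψ hψ hd)
        · rw [C.integral_inner_circleField hG.Ioo hζ hψ₀] at key
          have e2 : ∫ x in a..b, inner ℝ (longitudePart e n r₀ G x) (ψ₀ x) = ∑ i, l i * k i := by
            have e3 : ∫ x in a..b, inner ℝ (longitudePart e n r₀ G x) (ψ₀ x) =
                ∫ x in a..b, ∑ i, l i * inner ℝ (longitudePart e n r₀ (E i) x) (ψ₀ x) := by
              refine intervalIntegral_congr_Ioo hab.le fun x hx => ?_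
              rw [hl x hx, sum_inner]
              exact Finset.sum_congr rfl fun j _ => real_inner_smul_left _ _ _
            rw [e3, intervalIntegral.integral_finsetSum fun i _ =>
              (intervalIntegrable_inner_test hab.le (hB (hEs i)) hψ₀).const_mul _]
            simp only [intervalIntegral.integral_const_mul, hBψ₀]
          have e4 : ∀ x, inner ℝ (F x) (ζ x) = inner ℝ (heightPart e n z₀ r₀ G x) (ζ x) -
              ∑ i, l i * inner ℝ (heightPart e n z₀ r₀ (E i) x) (ζ x) := fun x => by
            rw [hF, inner_sub_left, sum_inner]
            congr 1
            exact Finset.sum_congr rfl fun j _ => real_inner_smul_left _ _ _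
          simp only [e4]
          have hsum : IntervalIntegrable
              (fun x => ∑ i, l i * inner ℝ (heightPart e n z₀ r₀ (E i) x) (ζ x)) volume a b := by
            simpa only [Finset.sum_fn] using IntervalIntegrable.sum Finset.univ fun i _ =>
              (intervalIntegrable_inner_test hab.le (hA (hEs i)) hζ).const_mul (l i)
          rw [intervalIntegral.integral_sub (intervalIntegrable_inner_test hab.le (hA hG.Ioo) hζ)
            hsum,
            intervalIntegral.integral_finsetSum fun i _ =>
              (intervalIntegrable_inner_test hab.le (hA (hEs i)) hζ).const_mul _]
          simp only [intervalIntegral.integral_const_mul]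
          rw [e2] at key
          rw [← key]
          simp [hk, Finset.sum_neg_distrib, sub_eq_add_neg]
        · have := C.integral_inner_circleField (hEs i) hζ hψ₀
          rw [hBψ₀, hk] at this
          simpa using this
    exact ⟨α (), fun x hx => by simpa using hα x hx⟩
  set x₀ := (a + b) / 2 with hx₀def
  have hx₀ : x₀ ∈ Ioo a b := ⟨by linarith, by linarith⟩
  -- The constant obtained on (a, c) does not depend on c: any x lies with x₀ in one such interval.
  have hFc : ∀ x ∈ Ioo a b, F x = F x₀ := by
    intro x hx
    have hm := max_lt hx.2 hx₀.2
    have hm' : a < max x x₀ := hx.1.trans_le (le_max_left _ _)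
    obtain ⟨α, hα⟩ := hconst ((max x x₀ + b) / 2) ⟨by linarith, by linarith⟩
    rw [hα x ⟨hx.1, by linarith [le_max_left x x₀]⟩,
      hα x₀ ⟨hx₀.1, by linarith [le_max_right x x₀]⟩]
  refine ⟨∑ i, l i • lateralFrame a e n i + F x₀ • e, fun x hx => ?_⟩
  have hxI := Ioo_subset_Icc_self hx
  have hen := C.inner_en x hxI
  have hne : inner ℝ (n x) e = 0 := by rw [real_inner_comm, hen]
  set w : E3 := G x - (∑ i, l i • lateralFrame a e n i + F x₀ • e) with hw
  have hem : inner ℝ e (cross e (n x)) = 0 := by rw [real_inner_comm, inner_cross_left]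
  have h1 : inner ℝ w (cross e (n x)) = 0 := by
    have h2 := hl x hx
    simp only [longitudePart, smul_eq_mul, hE] at h2
    refine (mul_eq_zero.1 (?_ : r₀ * inner ℝ w (cross e (n x)) = 0)).resolve_left C.pos.ne'
    rw [hw, inner_sub_left, inner_add_left, sum_inner, real_inner_smul_left, hem]
    simp only [real_inner_smul_left, Fin.sum_univ_two] at h2 ⊢
    linear_combination h2
  have h3 : inner ℝ w (e - (z₀ / r₀) • n x) = 0 := by
    have h2 := hFc x hx
    have h4 : inner ℝ e (e - (z₀ / r₀) • n x) = 1 := by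
      rw [inner_sub_right, real_inner_smul_right, hen, real_inner_self_eq_norm_sq, C.norm_e]; ring
    rw [hw, inner_sub_left, inner_add_left, sum_inner, real_inner_smul_left, h4, ← h2]
    simp only [hF, heightPart, hE, real_inner_smul_left, Fin.sum_univ_two, smul_eq_mul]
    ring
  have h5 : inner ℝ w e = z₀ / r₀ * inner ℝ w (n x) := by
    rw [inner_sub_right, real_inner_smul_right] at h3; linarith
  -- The height and longitude directions span the plane tangent to the sphere at T, so a vector
  -- orthogonal to both is a multiple of T = z₀e + r₀n.
  have h6 : w = (inner ℝ w (n x) / r₀) • T x := by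
    rw [C.eq_T x hxI]
    conv_lhs => rw [frame_expansion C.norm_e (C.norm_n x hxI) hen w, h1, h5]
    have := C.pos.ne'
    match_scalars <;> field_simp
  have h7 : w - inner ℝ w (T x) • T x = 0 := by
    rw [h6, real_inner_smul_left, real_inner_self_eq_norm_sq, hγ.2 x hxI]
    module
  rw [hw, inner_sub_left] at h7
  simp only [perp]
  rw [← sub_eq_zero, ← h7]
  module

end IsCircleFrame

end CircleMultipliers

/-! ### The Lagrange condition in general. -/

section EulerLagrange

variable {a b : ℝ} {T : ℝ → E3}

theorem eqOn_Icc_of_eqOn_Ioo {F : Type*} [TopologicalSpace F] [T2Space F] (hab : a < b)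
    {f g : ℝ → F} (hf : ContinuousOn f (Icc a b)) (hg : ContinuousOn g (Icc a b))
    (h : EqOn f g (Ioo a b)) : EqOn f g (Icc a b) :=
  h.of_subset_closure hf hg Ioo_subset_Icc_self (closure_Ioo hab.ne).ge

theorem cross_perp (hx : ℝ) (w : ℝ → E3) : cross (T hx) (perp T w hx) = cross (T hx) (w hx) := by
  rw [perp, cross_sub_right, cross_smul_right, cross_self_eq_zero, smul_zero, sub_zero]

/-- A unit field which satisfies a nontrivial linear ordinary differential equation `T' = T × U`
runs on a circle. -/
theorem exists_circleFrame (hab : a < b) (hT : SmoothOnIcc a b T)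
    (hunit : ∀ x ∈ Icc a b, ‖T x‖ = 1) {U : E3} (hU : ∀ x ∈ Icc a b, D a b 1 T x = cross (T x) U)
    {x₁ : ℝ} (hx₁ : x₁ ∈ Icc a b) (hne : D a b 1 T x₁ ≠ 0) :
    ∃ e n z₀ r₀ κ, IsCircleFrame a b T e n z₀ r₀ κ := by
  have hU0 : U ≠ 0 := by
    rintro rfl
    refine hne ?_
    rw [hU x₁ hx₁]
    exact (crossL (T x₁)).map_zero
  have hUpos : 0 < ‖U‖ := norm_pos_iff.2 hU0
  set e : E3 := ‖U‖⁻¹ • U with he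
  have hUe : U = ‖U‖ • e := by rw [he, smul_inv_smul₀ hUpos.ne']
  have hen : ‖e‖ = 1 := by
    rw [he, norm_smul, norm_inv, norm_norm, inv_mul_cancel₀ hUpos.ne']
  set z₀ := inner ℝ e (T a) with hz₀
  have hz : ∀ x ∈ Icc a b, inner ℝ e (T x) = z₀ := by
    intro x hx
    refine eq_of_derivWithin_eq_zero (g := fun x => inner ℝ e (T x)) hab (fun y hy => ?_) hx
    have h1 := (innerSL ℝ e).hasFDerivAt.comp_hasDerivWithinAt y (hT.hasDerivWithinAt hy)
    refine h1.congr_deriv ?_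
    rw [hU y hy, hUe, cross_smul_right, map_smul, innerSL_apply_apply, real_inner_comm,
      inner_cross_right, smul_zero]
  -- The circle does not degenerate to a pole, since T' ≠ 0 at x₁ prevents T from being parallel to
  -- the axis there.
  have hzpos : 0 < 1 - z₀ ^ 2 := by
    have h1 := inner_cross_cross (T x₁) e (T x₁) e
    rw [real_inner_comm e (T x₁), hz x₁ hx₁, real_inner_self_eq_norm_sq,
      real_inner_self_eq_norm_sq, real_inner_self_eq_norm_sq, hen, hunit x₁ hx₁] at h1
    have h2 : cross (T x₁) e ≠ 0 := fun h0 => hne (by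
      rw [hU x₁ hx₁, hUe, cross_smul_right, h0, smul_zero])
    have h3 := norm_pos_iff.2 h2
    nlinarith
  set r₀ := Real.sqrt (1 - z₀ ^ 2) with hr₀
  have hr : 0 < r₀ := Real.sqrt_pos.2 hzpos
  have hsq : r₀ ^ 2 = 1 - z₀ ^ 2 := Real.sq_sqrt hzpos.le
  -- The angular velocity is negative because T × U = -‖U‖ e × T.
  refine ⟨e, fun x => r₀⁻¹ • (T x - z₀ • e), z₀, r₀, -‖U‖, hab, hen,
    (ContDiffOn.sub hT contDiffOn_const).const_smul r₀⁻¹, fun x hx => ?_, fun x hx => ?_,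
    fun x hx => ?_, hr, by linarith, neg_ne_zero.2 hUpos.ne', fun x hx => ?_⟩
  · have h1 : ‖T x - z₀ • e‖ = r₀ := by
      have h2 := norm_sub_sq_real (T x) (z₀ • e)
      rw [real_inner_smul_right, real_inner_comm, hz x hx, norm_smul, hen, hunit x hx, mul_one,
        Real.norm_eq_abs, sq_abs] at h2
      nlinarith [norm_nonneg (T x - z₀ • e)]
    rw [norm_smul, h1, norm_inv, Real.norm_of_nonneg hr.le, inv_mul_cancel₀ hr.ne']
  · rw [real_inner_smul_right, inner_sub_right, hz x hx, real_inner_smul_right,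
      real_inner_self_eq_norm_sq, hen]
    ring
  · rw [smul_inv_smul₀ hr.ne']; module
  · have h1 := ((hT.hasDerivWithinAt hx).sub_const (z₀ • e)).const_smul r₀⁻¹
    refine (HasDerivWithinAt.D_one_eq hab hx h1).trans ?_
    rw [hU x hx, hUe, cross_smul_right, cross_comm_neg e (T x), cross_smul_right, cross_sub_right,
      cross_smul_right, cross_self_eq_zero, ← hUe]
    module

variable {γ : ℝ → E3} {ρ : ℝ → ℝ}

theorem tangentGradient_eq_zero {x : ℝ} (hx : x ∈ Ioo a b)
    (h : ∀ y ∈ Ioo a b, D a b 1 T y = 0) : tangentGradient a b ρ T x = 0 := by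
  have hab : a < b := hx.1.trans hx.2
  refine HasDerivWithinAt.D_one_eq hab (Ioo_subset_Icc_self hx) (HasDerivAt.hasDerivWithinAt ?_)
  refine (hasDerivAt_const x (0 : E3)).congr_of_eventuallyEq ?_
  filter_upwards [isOpen_Ioo.mem_nhds hx] with y hy
  rw [h y hy, smul_zero]

/-- Here V = ⟨V, T⟩T on the whole interval. As V is parallel to T, it is orthogonal to T', so
differentiating leaves ⟨V, T⟩T' = 0. -/
theorem perp_eq_zero_imp (hT : SmoothOnIcc a b T) (hunit : ∀ x ∈ Icc a b, ‖T x‖ = 1) {V : E3}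
    (h : ∀ x ∈ Ioo a b, perp T (fun _ => V) x = 0) {x : ℝ} (hx : x ∈ Ioo a b)
    (hne : D a b 1 T x ≠ 0) : V = 0 := by
  have hab : a < b := hx.1.trans hx.2
  have hV : ∀ y ∈ Ioo a b, inner ℝ V (T y) • T y = V := fun y hy => (sub_eq_zero.1 (h y hy)).symm
  have hd := hT.hasDerivAt hx
  have h1 : HasDerivAt (fun y => inner ℝ V (T y) • T y)
      (inner ℝ V (T x) • D a b 1 T x + inner ℝ V (D a b 1 T x) • T x) x :=
    ((innerSL ℝ V).hasFDerivAt.comp_hasDerivAt x hd).smul hd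
  have h2 : HasDerivAt (fun y => inner ℝ V (T y) • T y) 0 x := by
    refine (hasDerivAt_const x V).congr_of_eventuallyEq ?_
    filter_upwards [isOpen_Ioo.mem_nhds hx] with y hy using hV y hy
  have h3 := h1.unique h2
  have h4 : inner ℝ V (D a b 1 T x) = 0 := by
    rw [← hV x hx, real_inner_smul_left, real_inner_comm (D a b 1 T x),
      inner_D_eq_zero_of_norm hab hT hunit (Ioo_subset_Icc_self hx), mul_zero]
  rw [h4, zero_smul, add_zero] at h3
  rw [← hV x hx, (smul_eq_zero.1 h3).resolve_right hne, zero_smul]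

/-- The Euler-Lagrange equation of holonomy constrained elastic curves, on tangents. -/
theorem IsHolonomyConstrainedElastic.exists_perp_eq (hab : a < b) (hγ : IsArcLengthCurve a b γ)
    (hρ : SmoothOnIcc a b ρ) (hel : IsHolonomyConstrainedElastic a b ρ γ) :
    ∃ (V : E3) (μ : ℝ), ∀ x ∈ Icc a b,
      perp (D a b 1 γ) (tangentGradient a b ρ (D a b 1 γ)) x =
        μ • cross (D a b 1 γ x) (D a b 1 (D a b 1 γ) x) + perp (D a b 1 γ) (fun _ => V) x := by
  set T := D a b 1 γ with hTdef
  have hT : SmoothOnIcc a b T := SmoothOnIcc.D_one hab hγ.1.1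
  have hT' : SmoothOnIcc a b (D a b 1 T) := SmoothOnIcc.D_one hab hT
  have hunit : ∀ x ∈ Icc a b, ‖T x‖ = 1 := hγ.2
  have hG : SmoothOnIcc a b (tangentGradient a b ρ T) :=
    SmoothOnIcc.D_one hab (ContDiffOn.smul hρ hT')
  have hcT : ContDiffOn ℝ ∞ (fun x => cross (T x) (D a b 1 T x)) (Icc a b) :=
    ContDiffOn.cross hT hT'
  -- The test functions see only the interior; the end points follow by continuity.
  suffices h : ∃ (V : E3) (μ : ℝ), ∀ x ∈ Ioo a b, perp T (tangentGradient a b ρ T) x =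
      μ • cross (T x) (D a b 1 T x) + perp T (fun _ => V) x by
    obtain ⟨V, μ, h⟩ := h
    exact ⟨V, μ, eqOn_Icc_of_eqOn_Ioo hab (perp_contDiffOn hT hG).continuousOn
      ((hcT.continuousOn.const_smul μ).add (perp_contDiffOn hT contDiffOn_const).continuousOn) h⟩
  rcases exists_dual_or_relation hab.le le_rfl le_rfl (constraintField_smooth hab hT) with
    ⟨w, hw, hdual⟩ | ⟨l, hl0, hl⟩
  · obtain ⟨l, hl⟩ := hel.exists_multipliers_of_dual hab hγ hρ hw hdual
    exact ⟨_, l none, fun x hx => (hl x hx).trans (sum_constraintField l x)⟩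
  by_cases hT0 : ∀ y ∈ Ioo a b, D a b 1 T y = 0
  · refine ⟨0, 0, fun x hx => ?_⟩
    simp [perp, tangentGradient_eq_zero hx hT0]
  push Not at hT0
  obtain ⟨x₁, hx₁, hne⟩ := hT0
  set V : E3 := WithLp.toLp 2 fun k => l (some k) with hVdef
  have hrel : ∀ x ∈ Ioo a b, l none • cross (T x) (D a b 1 T x) + perp T (fun _ => V) x = 0 :=
    fun x hx => (sum_constraintField l x).symm.trans (hl x hx)
  by_cases hμ : l none = 0
  · refine absurd ?_ hl0
    have hV : V = 0 := perp_eq_zero_imp hT hunit (fun x hx => by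
      simpa [hμ] using hrel x hx) hx₁ hne
    ext i
    cases i with
    | none => exact hμ
    | some k => exact congrArg (fun v : E3 => v k) hV
  -- Crossing the relation with T turns T × T' into -T' and removes the projection of V.
  · have hU : EqOn (D a b 1 T) (fun x => cross (T x) ((l none)⁻¹ • V)) (Icc a b) := by
      refine eqOn_Icc_of_eqOn_Ioo hab (ContDiffOn.continuousOn hT')
        (ContDiffOn.continuousOn (ContDiffOn.cross hT contDiffOn_const)) fun x hx => ?_
      have hxI := Ioo_subset_Icc_self hx
      have h1 := congrArg (cross (T x)) (hrel x hx)
      rw [cross_add_right, cross_smul_right, cross_perp, cross_cross_eq,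
        real_inner_comm (D a b 1 T x), inner_D_eq_zero_of_norm hab hT hunit hxI,
        real_inner_self_eq_norm_sq, hunit x hxI, show cross (T x) 0 = 0 from
          (crossL (T x)).map_zero] at h1
      have h2 : cross (T x) V = l none • D a b 1 T x := by
        rw [← sub_eq_zero, ← h1]; module
      rw [cross_smul_right, h2, inv_smul_smul₀ hμ]
    obtain ⟨e, n, z₀, r₀, κ, C⟩ := exists_circleFrame hab hT hunit hU
      (Ioo_subset_Icc_self hx₁) hne
    obtain ⟨V', hV'⟩ := C.exists_perp_eq hγ hρ hel
    exact ⟨V', 0, fun x hx => by rw [hV' x hx, zero_smul, zero_add]⟩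

end EulerLagrange

/-! ### The Euler-Lagrange equations and their first integral. -/

section Equations

variable {a b : ℝ} {γ : ℝ → E3} {ρ Λ : ℝ → ℝ} {μ x : ℝ}

theorem D_two {F : Type*} [NormedAddCommGroup F] [NormedSpace ℝ F] (a b : ℝ) (g : ℝ → F) :
    D a b 2 g = D a b 1 (D a b 1 g) := D_succ a b 1 g

theorem D_three {F : Type*} [NormedAddCommGroup F] [NormedSpace ℝ F] (a b : ℝ) (g : ℝ → F) :
    D a b 3 g = D a b 1 (D a b 1 (D a b 1 g)) := by
  rw [← D_two a b g]; exact D_succ a b 2 g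

theorem D_four {F : Type*} [NormedAddCommGroup F] [NormedSpace ℝ F] (a b : ℝ) (g : ℝ → F) :
    D a b 4 g = D a b 1 (D a b 1 (D a b 1 (D a b 1 g))) := by
  rw [← D_three a b g]; exact D_succ a b 3 g

theorem arcDeriv_eqOn {F : Type*} [NormedAddCommGroup F] [NormedSpace ℝ F]
    (hγ : IsArcLengthCurve a b γ) {g h : ℝ → F} (hgh : EqOn g h (Icc a b)) :
    EqOn (arcDeriv a b γ g) (D a b 1 h) (Icc a b) :=
  (arcDeriv_eq_D hγ.2 g).trans (D_congr 1 hgh)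

/-- The constrained gradient in terms of the derivatives of the velocity. -/
theorem gradBConstrained_eq (hγ : IsArcLengthCurve a b γ) (hx : x ∈ Icc a b) :
    let T := D a b 1 γ
    gradBConstrained a b ρ γ Λ μ x =
      ρ x • D a b 3 T x + (3 * ρ x * inner ℝ (D a b 2 T x) (D a b 1 T x)) • T x
        + (3 / 2 * ρ x * inner ℝ (D a b 1 T x) (D a b 1 T x)) • D a b 1 T x
        + D a b 2 ρ x • D a b 1 T x + D a b 1 ρ x • ((2 : ℝ) • D a b 2 T x +
          (3 / 2 * inner ℝ (D a b 1 T x) (D a b 1 T x)) • T x)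
        - (2 * D a b 1 Λ x) • T x - (2 * Λ x) • D a b 1 T x - μ • cross (T x) (D a b 2 T x) := by
  intro T
  have h0 : EqOn (unitTangent a b γ) T (Icc a b) := unitTangent_eq_D hγ.2
  have h1 := arcDeriv_eqOn hγ h0
  have h2 := arcDeriv_eqOn hγ h1
  have h3 := arcDeriv_eqOn hγ h2
  have r1 := arcDeriv_eqOn hγ (eqOn_refl ρ (Icc a b))
  have r2 := arcDeriv_eqOn hγ r1
  simp only [gradBConstrained, gradB, h0 hx, h1 hx, h2 hx, h3 hx, r1 hx, r2 hx, D_congr 1 h0 hx,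
    D_congr 2 h0 hx, D_two, D_three]

/-- The first integral of the Euler-Lagrange equation. -/
noncomputable def firstIntegral (a b : ℝ) (ρ : ℝ → ℝ) (T : ℝ → E3) (Λ : ℝ → ℝ) (μ x : ℝ) : E3 :=
  tangentGradient a b ρ T x
    + (3 / 2 * ρ x * inner ℝ (D a b 1 T x) (D a b 1 T x) - 2 * Λ x) • T x
    - μ • cross (T x) (D a b 1 T x)

/-- The product rule, where T' × T' = 0 leaves only T × T'' from the torsion term. -/
theorem hasDerivWithinAt_firstIntegral (hab : a < b) (hγ : IsArcLengthCurve a b γ)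
    (hρ : SmoothOnIcc a b ρ) (hΛ : SmoothOnIcc a b Λ) (hx : x ∈ Icc a b) :
    HasDerivWithinAt (firstIntegral a b ρ (D a b 1 γ) Λ μ) (gradBConstrained a b ρ γ Λ μ x)
      (Icc a b) x := by
  rw [gradBConstrained_eq hγ hx]
  simp only [D_two, D_three]
  set T := D a b 1 γ
  have hT : SmoothOnIcc a b T := SmoothOnIcc.D_one hab hγ.1.1
  have hT1 : SmoothOnIcc a b (D a b 1 T) := SmoothOnIcc.D_one hab hT
  have hT2 : SmoothOnIcc a b (D a b 1 (D a b 1 T)) := SmoothOnIcc.D_one hab hT1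
  have hρ1 : SmoothOnIcc a b (D a b 1 ρ) := SmoothOnIcc.D_one hab hρ
  have hG : EqOn (tangentGradient a b ρ T)
      (fun y => ρ y • D a b 1 (D a b 1 T) y + D a b 1 ρ y • D a b 1 T y) (Icc a b) :=
    fun y hy => HasDerivWithinAt.D_one_eq hab hy
      ((hρ.hasDerivWithinAt hy).smul (hT1.hasDerivWithinAt hy))
  have dT := hT.hasDerivWithinAt hx
  have dT1 := hT1.hasDerivWithinAt hx
  have dρ := hρ.hasDerivWithinAt hx
  have dG : HasDerivWithinAt (tangentGradient a b ρ T) _ (Icc a b) x :=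
    ((dρ.smul (hT2.hasDerivWithinAt hx)).add ((hρ1.hasDerivWithinAt hx).smul dT1)).congr
      (fun y hy => hG hy) (hG hx)
  have dK := ((dρ.const_mul (3 / 2)).mul (dT1.inner ℝ dT1)).sub
    ((hΛ.hasDerivWithinAt hx).const_mul 2)
  have dC := (HasDerivWithinAt.cross dT dT1).const_smul μ
  have h := (dG.add (dK.smul dT)).sub dC
  refine h.congr_deriv ?_
  simp only [cross_self_eq_zero, zero_add, Pi.sub_apply, Pi.mul_apply]
  rw [real_inner_comm (D a b 1 T x) (D a b 1 (D a b 1 T) x)]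
  module

/-- The equation says that the first integral is a constant vector V. Its normal part is the
Lagrange condition, and its tangential part defines Λ. -/
theorem isHolonomyConstrainedElastic_iff_gradBConstrained (hab : a < b) (hγ : IsArcLengthCurve a b γ)
    (hρ : SmoothOnIcc a b ρ) :
    IsHolonomyConstrainedElastic a b ρ γ ↔
      ∃ Λ : ℝ → ℝ, SmoothOnIcc a b Λ ∧ ∃ μ : ℝ,
        ∀ x ∈ Icc a b, gradBConstrained a b ρ γ Λ μ x = 0 := by
  set T := D a b 1 γ with hTdef
  have hT : SmoothOnIcc a b T := SmoothOnIcc.D_one hab hγ.1.1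
  have hT1 : SmoothOnIcc a b (D a b 1 T) := SmoothOnIcc.D_one hab hT
  have hG : SmoothOnIcc a b (tangentGradient a b ρ T) :=
    SmoothOnIcc.D_one hab (ContDiffOn.smul hρ hT1)
  constructor
  · intro hel
    obtain ⟨V, μ, h⟩ := hel.exists_perp_eq hab hγ hρ
    -- Solved from the tangential component of the equation that sets the first integral equal to V.
    set Λ : ℝ → ℝ := fun x => (1 / 2) * (3 / 2 * ρ x * inner ℝ (D a b 1 T x) (D a b 1 T x) +
      (inner ℝ (tangentGradient a b ρ T x) (T x) - inner ℝ V (T x))) with hΛdef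
    have hΛ : SmoothOnIcc a b Λ :=
      contDiffOn_const.mul (((contDiffOn_const.mul hρ).mul (ContDiffOn.inner ℝ hT1 hT1)).add
        ((ContDiffOn.inner ℝ hG hT).sub (contDiffOn_const.inner ℝ hT)))
    refine ⟨Λ, hΛ, μ, fun x hx => ?_⟩
    have h1 := hasDerivWithinAt_firstIntegral (μ := μ) hab hγ hρ hΛ hx
    have h2 : ∀ y ∈ Icc a b, firstIntegral a b ρ T Λ μ y = V := by
      intro y hy
      have h3 := h y hy
      rw [← hTdef, ← sub_eq_zero] at h3
      simp only [perp] at h3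
      rw [← sub_eq_zero, ← h3, firstIntegral, hΛdef]
      module
    exact (uniqueDiffOn_Icc hab x hx).eq_deriv _ h1
      ((hasDerivWithinAt_const x _ V).congr h2 (h2 x hx))
  · rintro ⟨Λ, hΛ, μ, h⟩
    refine isHolonomyConstrainedElastic_of_tangentGradient hab hγ hρ
      (firstIntegral a b ρ T Λ μ a) μ
      (fun x => 2 * Λ x - 3 / 2 * ρ x * inner ℝ (D a b 1 T x) (D a b 1 T x)) fun x hx => ?_
    have h1 := eq_of_derivWithin_eq_zero hab (g := firstIntegral a b ρ T Λ μ) (fun y hy => by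
      rw [← h y hy]; exact hasDerivWithinAt_firstIntegral hab hγ hρ hΛ hy)
      (Ioo_subset_Icc_self hx)
    rw [← h1, firstIntegral]
    module

/-- Differentiating |T|² = 1 three times gives ⟨T''', T⟩ = -3⟨T'', T'⟩, which matches the two
tangential terms; the factor 2 is absorbed into Λ. -/
theorem gradBConstrained_eq_tangentODE (hab : a < b) (hγ : IsArcLengthCurve a b γ)
    (hΛ : SmoothOnIcc a b Λ) (hx : x ∈ Icc a b) :
    gradBConstrained a b ρ γ Λ μ x = tangentODE a b ρ γ (fun y => 2 * Λ y) μ x := by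
  have hT : SmoothOnIcc a b (D a b 1 γ) := SmoothOnIcc.D_one hab hγ.1.1
  have hT1 := hT.D_one hab
  have hT2 := hT1.D_one hab
  have h0 : EqOn (unitTangent a b γ) (D a b 1 γ) (Icc a b) := unitTangent_eq_D hγ.2
  have hΛ2 : D a b 1 (fun y => 2 * Λ y) x = 2 * D a b 1 Λ x :=
    HasDerivWithinAt.D_one_eq hab hx ((hΛ.hasDerivWithinAt hx).const_mul 2)
  have e1 : ∀ y ∈ Icc a b, inner ℝ (D a b 1 γ y) (D a b 1 (D a b 1 γ) y) = 0 := fun y hy => by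
    rw [real_inner_comm, inner_D_eq_zero_of_norm hab hT hγ.2 hy]
  have e2 : ∀ y ∈ Icc a b, inner ℝ (D a b 1 γ y) (D a b 1 (D a b 1 (D a b 1 γ)) y) +
      inner ℝ (D a b 1 (D a b 1 γ) y) (D a b 1 (D a b 1 γ) y) = 0 := fun y hy =>
    inner_D_add_eq_zero hab hT hT1 e1 hy
  have e3 : inner ℝ (D a b 1 (D a b 1 (D a b 1 (D a b 1 γ))) x) (D a b 1 γ x) =
      -(3 * inner ℝ (D a b 1 (D a b 1 (D a b 1 γ)) x) (D a b 1 (D a b 1 γ) x)) := by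
    have d1 := ((hT.hasDerivWithinAt hx).inner ℝ (hT2.hasDerivWithinAt hx)).add
      ((hT1.hasDerivWithinAt hx).inner ℝ (hT1.hasDerivWithinAt hx))
    have d2 := (uniqueDiffOn_Icc hab x hx).eq_deriv _ d1
      ((hasDerivWithinAt_const x _ (0 : ℝ)).congr e2 (e2 x hx))
    rw [real_inner_comm (D a b 1 (D a b 1 (D a b 1 (D a b 1 γ))) x),
      real_inner_comm (D a b 1 (D a b 1 (D a b 1 γ)) x) (D a b 1 (D a b 1 γ) x)] at d2
    linarith
  rw [gradBConstrained_eq hγ hx]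
  simp only [tangentODE, h0 hx, D_congr 1 h0 hx, D_congr 2 h0 hx, D_congr 3 h0 hx, hΛ2, D_two,
    D_three, e3]
  module

theorem tangentODE_eq_curveODE (hγ : IsArcLengthCurve a b γ) (hx : x ∈ Icc a b) :
    tangentODE a b ρ γ Λ μ x = curveODE a b ρ γ Λ μ x := by
  have h0 : EqOn (unitTangent a b γ) (D a b 1 γ) (Icc a b) := unitTangent_eq_D hγ.2
  simp only [tangentODE, curveODE, h0 hx, D_congr 1 h0 hx, D_congr 2 h0 hx, D_congr 3 h0 hx, D_two,
    D_three, D_four]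

end Equations

theorem theorem3p4 (a b : ℝ) (hab : a < b) (γ : ℝ → E3) (hγ : IsArcLengthCurve a b γ)
    (ρ : ℝ → ℝ) (hρ : SmoothOnIcc a b ρ) (hρpos : ∀ x ∈ Icc a b, 0 < ρ x) :
    (IsHolonomyConstrainedElastic a b ρ γ ↔
      ∃ Λ : ℝ → ℝ, SmoothOnIcc a b Λ ∧ ∃ μ : ℝ,
        ∀ x ∈ Icc a b, gradBConstrained a b ρ γ Λ μ x = 0) ∧
    (IsHolonomyConstrainedElastic a b ρ γ ↔
      ∃ Λ : ℝ → ℝ, SmoothOnIcc a b Λ ∧ ∃ μ : ℝ,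
        ∀ x ∈ Icc a b, tangentODE a b ρ γ Λ μ x = 0) ∧
    (IsHolonomyConstrainedElastic a b ρ γ ↔
      ∃ Λ : ℝ → ℝ, SmoothOnIcc a b Λ ∧ ∃ μ : ℝ,
        ∀ x ∈ Icc a b, curveODE a b ρ γ Λ μ x = 0) ∧
    (∀ (Λ : ℝ → ℝ) (μ : ℝ), SmoothOnIcc a b Λ → ∀ x ∈ Icc a b,
      gradBConstrained a b ρ γ Λ μ x = tangentODE a b ρ γ (fun y => 2 * Λ y) μ x ∧
      tangentODE a b ρ γ Λ μ x = curveODE a b ρ γ Λ μ x) := by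
  have h2 := isHolonomyConstrainedElastic_iff_gradBConstrained hab hγ hρ
  have h3 : IsHolonomyConstrainedElastic a b ρ γ ↔
      ∃ Λ : ℝ → ℝ, SmoothOnIcc a b Λ ∧ ∃ μ : ℝ,
        ∀ x ∈ Icc a b, tangentODE a b ρ γ Λ μ x = 0 := by
    rw [h2]
    constructor
    · rintro ⟨Λ, hΛ, μ, h⟩
      exact ⟨fun y => 2 * Λ y, contDiffOn_const.mul hΛ, μ, fun x hx => by
        rw [← gradBConstrained_eq_tangentODE hab hγ hΛ hx, h x hx]⟩
    · rintro ⟨Λ, hΛ, μ, h⟩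
      -- Halving undoes the doubling of Λ between the two normalizations.
      have hΛ' : SmoothOnIcc a b fun y => (1 / 2) * Λ y := contDiffOn_const.mul hΛ
      refine ⟨_, hΛ', μ, fun x hx => ?_⟩
      rw [gradBConstrained_eq_tangentODE hab hγ hΛ' hx, ← h x hx]
      congr 1
      ext y
      ring
  refine ⟨h2, h3, h3.trans ?_, fun Λ μ hΛ x hx =>
    ⟨gradBConstrained_eq_tangentODE hab hγ hΛ hx, tangentODE_eq_curveODE hγ hx⟩⟩
  refine exists_congr fun Λ => and_congr_right fun _ => exists_congr fun μ =>
    forall₂_congr fun x hx => ?_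
  rw [tangentODE_eq_curveODE hγ hx]
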